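/- Let $N, m \ge 0$ be integers. A $C^\infty$ (resp. real analytic) submanifold of $\mathbb{R}^N$ of dimension $m \le N$ is a subset $M \subset \mathbb{R}^N$, not necessarily closed, such that each $p \in M$ has an open neighbourhood $U$ in $\mathbb{R}^N$ and a $C^\infty$ (resp. real analytic) diffeomorphism $\varphi$ of $U$ onto an open set $\varphi(U) \subset \mathbb{R}^N$ with $\varphi(M \cap U) = \{x \in \varphi(U) : x_{m+1} = \cdots = x_N = 0\}$. A $C^\infty$ submanifold with boundary of dimension $m$ is a set $Y \subset \mathbb{R}^N$ together with a (possibly empty) subset $\partial Y \subset Y$ such that $Y \setminus \partial Y$ is a $C^\infty$ submanifold of dimension $m$ and, if $\partial Y \neq \emptyset$, then $m \ge 1$ and each $p \in \partial Y$ has an open neighbourhood $U$ in $\mathbb{R}^N$ and a $C^\infty$ diffeomorphism $\varphi$ of $U$ onto an open set $\varphi(U) \subset \mathbb{R}^N$ with $$\varphi(Y \cap U) = \{x \in \varphi(U) : x_m \ge 0,\ x_{m+1} = \cdots = x_N = 0\}, \qquad \varphi(\partial Y \cap U) = \{x \in \varphi(U) : x_m = x_{m+1} = \cdots = x_N = 0\}.$$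 A set $V \subset \mathbb{R}^N$ is a local real analytic subvariety if there is an open set $U \subset \mathbb{R}^N$ such that $V$ is a subset of $U$, closed in $U$, and near each of its points $V$ is the common zero set of a family of real analytic functions. Its dimension is the largest $d$ such that $V$ contains a nonempty real analytic submanifold of dimension $d$. \textbf{Theorem.} Suppose that $Y \subset \mathbb{R}^N$ is a $C^\infty$ submanifold with boundary, of dimension $m$, and $V \subset \mathbb{R}^N$ is a local real analytic subvariety of the same dimension $m$, such that $Y \subset V$. Then there exists a real analytic submanifold $\mathcal{Y}$ (without boundary) of dimension $m$ such that $Y \subset \mathcal{Y}$. In particular $Y$ extends uniquely past its boundary as a real analytic submanifold: every point of $\partial Y$ is in the closure of $\mathcal{Y} \setminus Y$, and if $\mathcal{Y}_1, \mathcal{Y}_2$ are real analytic submanifolds of dimension $m$ both containing $Y$, then there is an open set $W \supset Y$ with $\mathcal{Y}_1 \cap W = \mathcal{Y}_2 \cap W$. -/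

import Mathlib

open scoped ContDiff

/-- The coordinate subspace `{x | x_{m+1} = ⋯ = x_N = 0}` of `ℝ^N` (coordinates are indexed from `0`
in the code, so these are the `x i` with `m ≤ i`). -/
def flatModel (N m : ℕ) : Set (EuclideanSpace ℝ (Fin N)) :=
  {x | ∀ i : Fin N, m ≤ (i : ℕ) → x i = 0}

/-- The half space `{x | x_m ≥ 0, x_{m+1} = ⋯ = x_N = 0}` (used for `1 ≤ m ≤ N` only). -/
def halfModel (N m : ℕ) : Set (EuclideanSpace ℝ (Fin N)) :=
  {x | x ∈ flatModel N m ∧ ∀ i : Fin N, (i : ℕ) + 1 = m → 0 ≤ x i}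

/-- The boundary `{x | x_m = 0, x_{m+1} = ⋯ = x_N = 0}` of the half space
(used for `1 ≤ m ≤ N` only). -/
def halfModelBoundary (N m : ℕ) : Set (EuclideanSpace ℝ (Fin N)) :=
  {x | x ∈ flatModel N m ∧ ∀ i : Fin N, (i : ℕ) + 1 = m → x i = 0}

/-- `φ` is a `C^n` diffeomorphism from an open subset of `ℝ^N` (its source) onto an open subset of
`ℝ^N` (its target). Here `n = ∞` means smooth and `n = ω` means real analytic. -/
structure IsLocalDiffeo (n : WithTop ℕ∞) {N : ℕ}
    (φ : OpenPartialHomeomorph (EuclideanSpace ℝ (Fin N)) (EuclideanSpace ℝ (Fin N))) : Prop where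
  contDiffOn : ContDiffOn ℝ n φ φ.source
  contDiffOn_symm : ContDiffOn ℝ n φ.symm φ.target

/-- `M` is an embedded (not necessarily closed) `C^n` submanifold of `ℝ^N` of dimension `m`, without
boundary: near each of its points it is straightened by a `C^n` change of coordinates of `ℝ^N`. -/
structure IsSubmanifold (n : WithTop ℕ∞) {N : ℕ} (m : ℕ)
    (M : Set (EuclideanSpace ℝ (Fin N))) : Prop where
  dim_le : m ≤ N
  exists_chart : ∀ p ∈ M,
    ∃ φ : OpenPartialHomeomorph (EuclideanSpace ℝ (Fin N)) (EuclideanSpace ℝ (Fin N)),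
      p ∈ φ.source ∧ IsLocalDiffeo n φ ∧
      φ '' (M ∩ φ.source) = flatModel N m ∩ φ.target

/-- `Y` is an embedded (not necessarily closed) `C^n` submanifold with boundary of `ℝ^N`, of
dimension `m`, with boundary `∂Y = B` (possibly empty). -/
structure IsSubmanifoldWithBoundary (n : WithTop ℕ∞) {N : ℕ} (m : ℕ)
    (Y B : Set (EuclideanSpace ℝ (Fin N))) : Prop where
  boundary_subset : B ⊆ Y
  interior : IsSubmanifold n m (Y \ B)
  exists_boundary_chart : ∀ p ∈ B, 1 ≤ m ∧
    ∃ φ : OpenPartialHomeomorph (EuclideanSpace ℝ (Fin N)) (EuclideanSpace ℝ (Fin N)),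
      p ∈ φ.source ∧ IsLocalDiffeo n φ ∧
      φ '' (Y ∩ φ.source) = halfModel N m ∩ φ.target ∧
      φ '' (B ∩ φ.source) = halfModelBoundary N m ∩ φ.target

/-- `V` is a real analytic subvariety of the open set `U`: a subset of `U`, closed in `U`, which is
locally the common zero set of a family (of any size) of real analytic functions. -/
structure IsAnalyticSubvariety {N : ℕ} (U V : Set (EuclideanSpace ℝ (Fin N))) : Prop where
  isOpen : IsOpen U
  subset : V ⊆ U
  closed_in : closure V ∩ U ⊆ V
  locally_zeros : ∀ p ∈ V, ∃ W : Set (EuclideanSpace ℝ (Fin N)), IsOpen W ∧ p ∈ W ∧ W ⊆ U ∧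
    ∃ F : Set (EuclideanSpace ℝ (Fin N) → ℝ), (∀ f ∈ F, AnalyticOnNhd ℝ f W) ∧
      V ∩ W = {x ∈ W | ∀ f ∈ F, f x = 0}

/-- `V` is a local real analytic subvariety: a real analytic subvariety of some open set. -/
def IsLocalAnalyticSubvariety {N : ℕ} (V : Set (EuclideanSpace ℝ (Fin N))) : Prop :=
  ∃ U : Set (EuclideanSpace ℝ (Fin N)), IsAnalyticSubvariety U V

/-- `V` has dimension `d`: `d` is the largest dimension of a nonempty real analytic submanifold
contained in `V`. (The empty set has no dimension.) -/
def HasAnalyticDim {N : ℕ} (V : Set (EuclideanSpace ℝ (Fin N))) (d : ℕ) : Prop :=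
  IsGreatest {k : ℕ | ∃ M : Set (EuclideanSpace ℝ (Fin N)),
    IsSubmanifold ω k M ∧ M.Nonempty ∧ M ⊆ V} d

/-! Near a point of `Y`, linear coordinates turn `Y` into the graph of a smooth `f : X → F` with
`dim X = m`, over a domain with dense interior, while `V` is cut out by analytic equations. It
suffices to find an analytic `g` that agrees with `f` on that domain: the graph of `g` is a local
extension, two local extensions have the same germ along `Y` by the identity theorem, and a locally
finite cover glues them.

Rank. By Taylor's formula the equations of `V` vanish to infinite order (are flat) along the graph
at a base point `q`. Among all analytic functions with this property take a maximal system `h 1, …,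
h r` having a Jacobian minor in `F`-directions that is not flat. A weighted blow-up along a Taylor
polynomial of `f` parametrizes zeros of this system by `dim X + dim F - r` variables. By maximality,
the pullbacks of all flat functions generate an ideal closed under differentiation up to powers of
the blow-up parameter; they are flat along a curve, hence vanish. So `V` contains an analytic family
of that dimension, which forces `r = dim F` (`exists_full_rank`).

Convergence. When `r = dim F`, the blow-up gives an analytic `κ` such that `f (q + t ξ) - κ (ξ, t)`
is flat in `t` for all `ξ` in an open set. The homogeneous Taylor polynomials of `f` are then
geometrically bounded on a ball of directions, and by polarization the Taylor series converges to an
analytic `g` with `f - g` flat (`exists_taylorBound_of_full_rank`).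

Flat differences vanish. Let `f` be analytic on a convex open set with `q` in its closure. Along a
ray from `q`, the difference `f - g` is smaller than every power of `t` and solves a nondegenerate
analytic system. Elimination by Weierstrass division (`eventually_mem_span_of_hasVanishingRank`)
forces it to be zero (`IsEquationSet.eventually_eq_of_flat`).

Interior regularity. The last argument needs `f` analytic inside the domain. Baire's theorem gives
uniform Taylor bounds on a relatively open piece of the set of non-analytic points. A nearby point
off this set is the centre of a ball touching it, and the previous argument at the touching point
transfers the bound to the centre. Uniform bounds mean analyticity
(`IsEquationSet.analyticOnNhd_of_contDiff`). Boundary points are then covered by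
`IsEquationSet.exists_analyticAt_extension`. -/

open scoped ContDiff Topology BoundedContinuousFunction
open Filter Set Asymptotics

/-! ### Power series evaluated on noncommuting elements of a Banach algebra. -/

section OperatorCalculus

variable {E ι A : Type*} [NormedAddCommGroup E] [NormedSpace ℝ E] [Fintype ι]
  [NormedRing A] [NormedAlgebra ℝ A]

/-- A real power series on a space with a basis, with elements of a (noncommutative) algebra
substituted for the coordinates. -/
noncomputable def FormalMultilinearSeries.substAlgebra (p : FormalMultilinearSeries ℝ E ℝ)
    (b : Module.Basis ι ℝ E) (A : Type*) [NormedRing A] [NormedAlgebra ℝ A] :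
    FormalMultilinearSeries ℝ (ι → A) A := fun k =>
  ∑ i : Fin k → ι, p k (fun j => b (i j)) •
    (ContinuousMultilinearMap.mkPiAlgebraFin ℝ k A).compContinuousLinearMap
      (fun j => ContinuousLinearMap.proj (i j))

theorem FormalMultilinearSeries.substAlgebra_radius_pos [NormOneClass A]
    {p : FormalMultilinearSeries ℝ E ℝ} (hp : 0 < p.radius) (b : Module.Basis ι ℝ E) :
    0 < (p.substAlgebra b A).radius := by
  obtain ⟨r, hr0, hr⟩ := ENNReal.lt_iff_exists_nnreal_btwn.1 hp
  obtain ⟨C, hC, hpC⟩ := p.norm_mul_pow_le_of_lt_radius hr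
  have hr0' : 0 < r := by exact_mod_cast hr0
  set β : ℝ := ∑ i, ‖b i‖ with hβ
  have hβ0 : 0 ≤ β := Finset.sum_nonneg fun i _ => norm_nonneg (b i)
  have hbβ : ∀ i, ‖b i‖ ≤ β := fun i =>
    Finset.single_le_sum (f := fun i => ‖b i‖) (fun i _ => norm_nonneg (b i)) (Finset.mem_univ i)
  -- There are `card ι ^ n` words of length `n`, each costing at most `β ^ n`; the summand `1` keeps
  -- `κ` positive when `ι` is empty.
  set κ : ℝ := Fintype.card ι * β + 1 with hκ
  have hκ0 : 0 < κ := by positivity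
  set s : NNReal := r / κ.toNNReal with hs
  have hs0 : 0 < s := div_pos hr0' (Real.toNNReal_pos.2 hκ0)
  refine lt_of_lt_of_le (b := (s : ENNReal)) (by exact_mod_cast hs0)
    (FormalMultilinearSeries.le_radius_of_bound _ C fun n => ?_)
  have h1 : ‖p.substAlgebra b A n‖ ≤ ∑ _i : Fin n → ι, ‖p n‖ * β ^ n := by
    refine ContinuousMultilinearMap.opNorm_le_bound
      (Finset.sum_nonneg fun _ _ => by positivity) fun v => ?_
    rw [FormalMultilinearSeries.substAlgebra, _root_.sum_apply, Finset.sum_mul]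
    refine le_trans (norm_sum_le _ _) (Finset.sum_le_sum fun i _ => ?_)
    rw [_root_.smul_apply, norm_smul, ContinuousMultilinearMap.compContinuousLinearMap_apply,
      ContinuousMultilinearMap.mkPiAlgebraFin_apply]
    have h2 : ‖p n (fun j => b (i j))‖ ≤ ‖p n‖ * β ^ n := by
      refine ((p n).le_opNorm _).trans ?_
      gcongr
      refine (Finset.prod_le_prod (fun _ _ => norm_nonneg _) fun j _ => hbβ (i j)).trans ?_
      simp
    have h3 : ‖(List.ofFn fun j => (ContinuousLinearMap.proj (R := ℝ) (φ := fun _ : ι => A)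
        (i j)) (v j)).prod‖ ≤ ∏ j, ‖v j‖ := by
      refine (List.norm_prod_le _).trans ?_
      rw [List.map_ofFn, List.prod_ofFn]
      exact Finset.prod_le_prod (fun _ _ => norm_nonneg _) fun j _ => norm_le_pi_norm (v j) (i j)
    gcongr
  have h4 : ∑ _i : Fin n → ι, ‖p n‖ * β ^ n ≤ ‖p n‖ * κ ^ n := by
    rw [Finset.sum_const, nsmul_eq_mul, Finset.card_univ, Fintype.card_fun, Fintype.card_fin]
    push_cast
    calc _ = ‖p n‖ * ((Fintype.card ι : ℝ) * β) ^ n := by rw [mul_pow]; ring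
      _ ≤ _ := by gcongr; linarith
  calc _ ≤ ‖p n‖ * κ ^ n * (s : ℝ) ^ n := by gcongr; exact h1.trans h4
    _ = ‖p n‖ * (r : ℝ) ^ n := by
      rw [mul_assoc, ← mul_pow, hs]
      congr 2
      rw [NNReal.coe_div, Real.coe_toNNReal _ hκ0.le]
      exact mul_div_cancel₀ _ hκ0.ne'
    _ ≤ C := hpC n

/-- Peeling off letters from the left, `Λ` sees each word in the noncommuting `a i` as the
corresponding monomial in the numbers `x i`. -/
theorem FormalMultilinearSeries.map_substAlgebra_apply {W : Type*} [NormedAddCommGroup W]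
    [NormedSpace ℝ W]
    (p : FormalMultilinearSeries ℝ E ℝ) (b : Module.Basis ι ℝ E) (a : ι → A) (x : ι → ℝ)
    (Λ : A →L[ℝ] W) (hΛ : ∀ i c, Λ (a i * c) = x i • Λ c) (n : ℕ) :
    Λ (p.substAlgebra b A n (fun _ => a)) = p n (fun _ => ∑ i, x i • b i) • Λ 1 := by
  have hprod : ∀ l : List ι, Λ ((l.map a).prod) = (l.map x).prod • Λ 1 := by
    intro l
    induction l with
    | nil => simp
    | cons i l ih => rw [List.map_cons, List.prod_cons, hΛ, ih, List.map_cons, List.prod_cons,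
        smul_smul]
  have h1 : p n (fun _ => ∑ i, x i • b i) =
      ∑ i : Fin n → ι, (∏ j, x (i j)) • p n (fun j => b (i j)) := by
    have := (p n).toMultilinearMap.map_sum (fun (_ : Fin n) (i : ι) => x i • b i)
    refine this.trans (Finset.sum_congr rfl fun i _ => ?_)
    exact (p n).toMultilinearMap.map_smul_univ (fun j => x (i j)) (fun j => b (i j))
  rw [h1, Finset.sum_smul, substAlgebra, _root_.sum_apply, map_sum]
  refine Finset.sum_congr rfl fun i _ => ?_
  rw [_root_.smul_apply, map_smul,
    ContinuousMultilinearMap.compContinuousLinearMap_apply,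
    ContinuousMultilinearMap.mkPiAlgebraFin_apply]
  have h2 : List.ofFn (fun j => (ContinuousLinearMap.proj (R := ℝ) (φ := fun _ : ι => A) (i j)) a)
      = (List.ofFn i).map a := by
    rw [List.map_ofFn]; rfl
  rw [h2, hprod, List.map_ofFn, List.prod_ofFn, smul_smul, mul_comm]
  rfl

/-- Functional calculus: an analytic function germ at `0`, evaluated on tuples of small elements of
a Banach algebra, compatibly with simultaneous eigenfunctionals. -/
theorem AnalyticAt.exists_algebra_extension {A W : Type*} [NormedRing A] [NormedAlgebra ℝ A]
    [NormOneClass A] [CompleteSpace A] [NormedAddCommGroup W] [NormedSpace ℝ W]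
    {f : E → ℝ} (hf : AnalyticAt ℝ f 0) (b : Module.Basis ι ℝ E) :
    ∃ g : (ι → A) → A, ∃ r > 0, AnalyticOnNhd ℝ g (Metric.ball 0 r) ∧ g 0 = algebraMap ℝ A (f 0) ∧
      ∀ (a : ι → A) (x : ι → ℝ), ‖a‖ < r → ‖x‖ < r →
        ∀ Λ : A →L[ℝ] W, (∀ i c, Λ (a i * c) = x i • Λ c) →
          Λ (g a) = f (∑ i, x i • b i) • Λ 1 := by
  obtain ⟨p, R, hp⟩ := hf
  have hq := FormalMultilinearSeries.substAlgebra_radius_pos (A := A)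
    (hp.r_pos.trans_le hp.r_le) b
  set q := p.substAlgebra b A with hqdef
  have hqs := q.hasFPowerSeriesOnBall hq
  obtain ⟨r₁, hr₁, hr₁q⟩ := ENNReal.lt_iff_exists_nnreal_btwn.1 hq
  have hr₁' : (0 : ℝ) < r₁ := by exact_mod_cast hr₁
  have hcont : Tendsto (fun x : ι → ℝ => ∑ i, x i • b i) (𝓝 0) (𝓝 0) := by
    have : Continuous (fun x : ι → ℝ => ∑ i, x i • b i) := by fun_prop
    simpa using this.tendsto 0
  obtain ⟨r₂, hr₂, hr₂b⟩ := Metric.eventually_nhds_iff_ball.1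
    (hcont.eventually (Metric.eball_mem_nhds (0 : E) hp.r_pos))
  refine ⟨q.sum, min r₁ r₂, lt_min hr₁' hr₂, ?_, ?_, ?_⟩
  · refine hqs.analyticOnNhd.mono fun a ha => ?_
    rw [Metric.mem_ball, dist_zero_right] at ha
    rw [Metric.mem_eball, edist_zero_right]
    refine lt_trans ?_ hr₁q
    have : ‖a‖ < r₁ := ha.trans_le (min_le_left _ _)
    rw [← ofReal_norm, ENNReal.ofReal_lt_coe_iff (norm_nonneg _)]
    exact this
  · have h0 := hqs.coeff_zero (fun _ => 0)
    rw [← h0]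
    have h0' := hp.coeff_zero (fun _ => 0)
    rw [← h0']
    have := FormalMultilinearSeries.map_substAlgebra_apply p b (0 : ι → A) 0
      (ContinuousLinearMap.id ℝ A) (by simp) 0
    simp only [ContinuousLinearMap.id_apply] at this
    rw [Algebra.algebraMap_eq_smul_one]
    convert this using 3
  · intro a x ha hx Λ hΛ
    have ha' : a ∈ Metric.eball (0 : ι → A) q.radius := by
      rw [Metric.mem_eball, edist_zero_right]
      refine lt_trans ?_ hr₁q
      rw [← ofReal_norm, ENNReal.ofReal_lt_coe_iff (norm_nonneg _)]
      exact ha.trans_le (min_le_left _ _)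
    have hs := hqs.hasSum ha'
    rw [zero_add] at hs
    have hs' := Λ.hasSum hs
    have hx' := hr₂b x (by rw [Metric.mem_ball, dist_zero_right]; exact hx.trans_le (min_le_right _ _))
    have ht := hp.hasSum hx'
    rw [zero_add] at ht
    refine hs'.unique ?_
    have := ht.smul_const (Λ 1)
    convert this using 1
    ext n
    exact FormalMultilinearSeries.map_substAlgebra_apply p b a x Λ hΛ n

end OperatorCalculus

/-! ### Shift operators on bounded sequences, as a model of power series in one variable. -/

section Shift

/-- A Banach space of sequences with its shifts, presented abstractly. -/
structure ShiftModel (𝔅 : Type*) [NormedAddCommGroup 𝔅] [NormedSpace ℝ 𝔅] where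
  right : 𝔅 →L[ℝ] 𝔅
  left : 𝔅 →L[ℝ] 𝔅
  unit : 𝔅
  head : 𝔅 →L[ℝ] ℝ
  norm_left_le : ‖left‖ ≤ 1
  left_right : ∀ b, left (right b) = b
  left_unit : left unit = 0
  head_right : ∀ b, head (right b) = 0
  head_unit : head unit = 1
  head_smul_unit_add : ∀ b, head b • unit + right (left b) = b
  eq_zero_of_head : ∀ b, (∀ n, head (left^[n] b) = 0) → b = 0

/-- Bounded sequences with the usual shifts. -/
noncomputable def boundedSeqShift : ShiftModel (ℕ →ᵇ ℝ) where
  right := LinearMap.mkContinuous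
    { toFun := fun b => BoundedContinuousFunction.ofNormedAddCommGroupDiscrete
        (fun n => Nat.casesOn n 0 fun k => b k) ‖b‖ (by
          rintro (_ | n)
          · simp
          · exact b.norm_coe_le_norm n)
      map_add' := fun b c => by ext (_ | n) <;> simp
      map_smul' := fun r b => by ext (_ | n) <;> simp } 1 (fun b => by
        rw [one_mul]
        refine (BoundedContinuousFunction.norm_le (norm_nonneg _)).2 ?_
        rintro (_ | n)
        · simp
        · exact b.norm_coe_le_norm n)
  left := LinearMap.mkContinuous
    { toFun := fun b => BoundedContinuousFunction.ofNormedAddCommGroupDiscrete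
        (fun n => b (n + 1)) ‖b‖ (fun n => b.norm_coe_le_norm (n + 1))
      map_add' := fun b c => by ext n; simp
      map_smul' := fun r b => by ext n; simp } 1 (fun b => by
        rw [one_mul]
        exact (BoundedContinuousFunction.norm_le (norm_nonneg _)).2
          fun n => b.norm_coe_le_norm (n + 1))
  unit := BoundedContinuousFunction.ofNormedAddCommGroupDiscrete
    (fun n => if n = 0 then 1 else 0) 1 (fun n => by split_ifs <;> simp)
  head := BoundedContinuousFunction.evalCLM ℝ 0
  norm_left_le := LinearMap.mkContinuous_norm_le _ zero_le_one _
  left_right b := by ext n; rfl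
  left_unit := by ext n; rfl
  head_right b := rfl
  head_unit := rfl
  head_smul_unit_add b := by
    ext (_ | n)
    · simp
    · simp
  eq_zero_of_head b hb := by
    have key : ∀ n, ∀ (L : (ℕ →ᵇ ℝ) → (ℕ →ᵇ ℝ)) (_ : ∀ c k, L c k = c (k + 1)) (c : ℕ →ᵇ ℝ),
        (L^[n] c) 0 = c n := by
      intro n L hL
      induction n with
      | zero => intro c; rfl
      | succ n ih => intro c; rw [Function.iterate_succ_apply, ih, hL]
    ext n
    rw [← key n _ (fun c k => ?_) b]
    · exact hb n
    · rfl

namespace ShiftModel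

variable {𝔅 : Type*} [NormedAddCommGroup 𝔅] [NormedSpace ℝ 𝔅] [CompleteSpace 𝔅] (M : ShiftModel 𝔅)

/-- The functional `b ↦ ∑ bₙ yⁿ`, for `|y| < 1`. -/
noncomputable def powerSum (y : ℝ) : 𝔅 →L[ℝ] ℝ :=
  M.head ∘L Ring.inverse (1 - y • M.left)

theorem isUnit_one_sub_smul_left {y : ℝ} (hy : |y| < 1) : IsUnit (1 - y • M.left) := by
  refine isUnit_one_sub_of_norm_lt_one ?_
  rw [norm_smul, Real.norm_eq_abs]
  calc |y| * ‖M.left‖ ≤ |y| * 1 := by gcongr; exact M.norm_left_le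
    _ < 1 := by simpa

theorem analyticAt_powerSum : AnalyticAt ℝ M.powerSum 0 := by
  have h1 : AnalyticAt ℝ (fun y : ℝ => Ring.inverse (1 - y • M.left)) 0 := by
    have h := analyticAt_inverse_one_sub ℝ (𝔅 →L[ℝ] 𝔅)
    have h2 : AnalyticAt ℝ (fun y : ℝ => y • M.left) 0 := by fun_prop
    exact AnalyticAt.fun_comp_of_eq (g := fun x => Ring.inverse (1 - x)) h h2 (by simp)
  exact ((ContinuousLinearMap.compL ℝ 𝔅 𝔅 ℝ M.head).analyticAt _).fun_comp h1

/-- Apply `(1 - y • left)⁻¹ * (1 - y • left) = 1` to `right b` and take heads: `left` undoes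
`right`, and `right b` has head zero. -/
theorem powerSum_right {y : ℝ} (hy : |y| < 1) (b : 𝔅) :
    M.powerSum y (M.right b) = y * M.powerSum y b := by
  have hu := M.isUnit_one_sub_smul_left hy
  set R := Ring.inverse (1 - y • M.left) with hR
  have h1 : R * (1 - y • M.left) = 1 := Ring.inverse_mul_cancel _ hu
  have h2 := congrArg (fun T : 𝔅 →L[ℝ] 𝔅 => M.head (T (M.right b))) h1
  simp [M.left_right, M.head_right] at h2
  simp only [powerSum, ← hR, ContinuousLinearMap.comp_apply]
  linarith

theorem powerSum_unit {y : ℝ} (hy : |y| < 1) : M.powerSum y M.unit = 1 := by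
  have hu := M.isUnit_one_sub_smul_left hy
  have h1 : Ring.inverse (1 - y • M.left) * (1 - y • M.left) = 1 :=
    Ring.inverse_mul_cancel _ hu
  have h2 := congrArg (fun T : 𝔅 →L[ℝ] 𝔅 => M.head (T M.unit)) h1
  simpa [powerSum, M.left_unit, M.head_unit] using h2

omit [CompleteSpace 𝔅] in
theorem powerSum_zero (b : 𝔅) : M.powerSum 0 b = M.head b := by simp [powerSum]

theorem eventually_abs_lt_one : ∀ᶠ y in 𝓝 (0 : ℝ), |y| < 1 := by
  have := (continuous_abs (G := ℝ)).tendsto 0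
  rw [abs_zero] at this
  exact this.eventually (gt_mem_nhds zero_lt_one)

/-- The identity theorem for power series: the value at `0` is the head; if it vanishes, dividing by
`y` and using continuity at `0` passes to the left shift, and so on. -/
theorem eq_zero_of_powerSum_eq_zero {b : 𝔅} (hb : ∀ᶠ y in 𝓝 (0 : ℝ), M.powerSum y b = 0) :
    b = 0 := by
  have hcont : ∀ c : 𝔅, ContinuousAt (fun y => M.powerSum y c) 0 := fun c =>
    M.analyticAt_powerSum.continuousAt.clm_apply continuousAt_const
  have step : ∀ c : 𝔅, (∀ᶠ y in 𝓝 (0 : ℝ), M.powerSum y c = 0) →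
      M.head c = 0 ∧ ∀ᶠ y in 𝓝 (0 : ℝ), M.powerSum y (M.left c) = 0 := by
    intro c hc
    have h0 : M.head c = 0 := by rw [← M.powerSum_zero]; exact hc.self_of_nhds
    have hc' : M.right (M.left c) = c := by
      have := M.head_smul_unit_add c
      rwa [h0, zero_smul, zero_add] at this
    have h1 : ∀ᶠ y in 𝓝[≠] (0 : ℝ), M.powerSum y (M.left c) = 0 := by
      filter_upwards [nhdsWithin_le_nhds hc, nhdsWithin_le_nhds eventually_abs_lt_one,
        self_mem_nhdsWithin] with y hy hy1 hy0
      rw [← hc', M.powerSum_right hy1] at hy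
      exact (mul_eq_zero.1 hy).resolve_left hy0
    refine ⟨h0, ?_⟩
    have h2 : M.powerSum 0 (M.left c) = 0 := by
      have ht := (hcont (M.left c)).tendsto.mono_left (nhdsWithin_le_nhds (s := {0}ᶜ))
      exact tendsto_nhds_unique (ht.congr' h1) tendsto_const_nhds
    have h3 := eventually_nhdsWithin_iff.1 h1
    filter_upwards [h3] with y hy
    by_cases hy0 : y = 0
    · rw [hy0, h2]
    · exact hy hy0
  refine M.eq_zero_of_head b fun n => ?_
  have key : ∀ n, ∀ c : 𝔅, (∀ᶠ y in 𝓝 (0 : ℝ), M.powerSum y c = 0) →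
      M.head (M.left^[n] c) = 0 := by
    intro n
    induction n with
    | zero => exact fun c hc => (step c hc).1
    | succ n ih =>
      intro c hc
      rw [Function.iterate_succ_apply]
      exact ih (M.left c) (step c hc).2
  exact key n b hb

end ShiftModel

end Shift

/-! ### Division of sequences by a power of the shift, and Weierstrass division. -/

namespace ShiftModel

variable {𝔅 : Type*} [NormedAddCommGroup 𝔅] [NormedSpace ℝ 𝔅] (M : ShiftModel 𝔅)

/-- The polynomial with coefficients `r`. -/
noncomputable def poly (d : ℕ) : (Fin d → ℝ) →L[ℝ] 𝔅 :=
  ∑ i : Fin d, (ContinuousLinearMap.proj (R := ℝ) (φ := fun _ : Fin d => ℝ) i).smulRight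
    ((M.right ^ (i : ℕ)) M.unit)

theorem poly_apply (d : ℕ) (r : Fin d → ℝ) :
    M.poly d r = ∑ i : Fin d, r i • (M.right ^ (i : ℕ)) M.unit := by
  simp [poly]

theorem poly_succ (d : ℕ) (r : Fin (d + 1) → ℝ) :
    M.poly (d + 1) r = r 0 • M.unit + M.right (M.poly d (fun i => r i.succ)) := by
  rw [poly_apply, poly_apply, Fin.sum_univ_succ, map_sum]
  simp [pow_succ']

/-- With `exists_pow_add_poly` this says that the Banach space is the direct sum of the range of
`right ^ d` and the polynomials of degree less than `d`: division by `y ^ d` with remainder. -/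
theorem pow_add_poly_injective (d : ℕ) : ∀ (c : 𝔅) (r : Fin d → ℝ),
    (M.right ^ d) c + M.poly d r = 0 → c = 0 ∧ r = 0 := by
  induction d with
  | zero =>
    intro c r h
    refine ⟨?_, Subsingleton.elim _ _⟩
    simpa [poly_apply] using h
  | succ d ih =>
    intro c r h
    rw [poly_succ, pow_succ'] at h
    have h1 := congrArg M.head h
    simp [M.head_right, M.head_unit] at h1
    have h2 := congrArg M.left h
    simp only [mul_apply_eq_comp, map_add, map_smul, map_zero, M.left_right, M.left_unit, smul_zero,
      zero_add] at h2
    obtain ⟨h3, h4⟩ := ih c _ h2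
    refine ⟨h3, ?_⟩
    ext i
    refine Fin.cases ?_ (fun j => ?_) i
    · exact h1
    · exact congrFun h4 j

theorem exists_pow_add_poly (d : ℕ) : ∀ b : 𝔅, ∃ c r, (M.right ^ d) c + M.poly d r = b := by
  induction d with
  | zero => exact fun b => ⟨b, 0, by simp [poly_apply]⟩
  | succ d ih =>
    intro b
    obtain ⟨c, r, h⟩ := ih (M.left b)
    refine ⟨c, Fin.cons (M.head b) r, ?_⟩
    rw [poly_succ, pow_succ']
    simp only [Fin.cons_zero, Fin.cons_succ]
    conv_rhs => rw [← M.head_smul_unit_add b, ← h]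
    simp only [mul_apply_eq_comp, map_add]
    abel

variable [CompleteSpace 𝔅]

theorem powerSum_pow_right {y : ℝ} (hy : |y| < 1) (d : ℕ) (b : 𝔅) :
    M.powerSum y ((M.right ^ d) b) = y ^ d * M.powerSum y b := by
  induction d with
  | zero => simp
  | succ d ih =>
    rw [pow_succ', mul_apply_eq_comp, M.powerSum_right hy, ih, pow_succ']
    ring

theorem powerSum_poly {y : ℝ} (hy : |y| < 1) (d : ℕ) (r : Fin d → ℝ) :
    M.powerSum y (M.poly d r) = ∑ i : Fin d, r i * y ^ (i : ℕ) := by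
  rw [poly_apply, map_sum]
  refine Finset.sum_congr rfl fun i _ => ?_
  rw [map_smul, M.powerSum_pow_right hy, M.powerSum_unit hy, mul_one, smul_eq_mul]

end ShiftModel

/-- Replace the last variable by the operator `ρ • right` and keep the others as scalars. Division
of `h` by `H` becomes the linear equation `H(z, ρ • right) c + poly r = h(z, ρ • right) unit`. At `z
= 0` its operator is invertible because `H(0, ρ • right)` is `right ^ d` times a unit. Invertibility
is an open condition and inversion is analytic, so the solution depends analytically on `z`;
`powerSum` turns it back into functions. -/
theorem weierstrass_division_aux {𝔅 : Type*} [NormedAddCommGroup 𝔅] [NormedSpace ℝ 𝔅]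
    [CompleteSpace 𝔅] (M : ShiftModel 𝔅)
    {Z : Type*} [NormedAddCommGroup Z] [NormedSpace ℝ Z] [FiniteDimensional ℝ Z]
    {H h : Z × ℝ → ℝ} (hH : AnalyticAt ℝ H 0) (hh : AnalyticAt ℝ h 0) {d : ℕ} {u : ℝ → ℝ}
    (hu : AnalyticAt ℝ u 0) (hu0 : u 0 ≠ 0) (hHu : ∀ᶠ y in 𝓝 (0 : ℝ), H (0, y) = y ^ d * u y) :
    ∃ (Q : Z × ℝ → ℝ) (r : ℕ → Z → ℝ), AnalyticAt ℝ Q 0 ∧ (∀ i, AnalyticAt ℝ (r i) 0) ∧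
      ∀ᶠ x in 𝓝 (0 : Z × ℝ), h x = Q x * H x + ∑ i ∈ Finset.range d, r i x.1 * x.2 ^ i := by
  -- This makes the identity operator have norm one, as the functional calculus requires.
  have : Nontrivial 𝔅 := ⟨M.unit, 0, fun h => by simpa [h] using M.head_unit⟩
  set b := Module.finBasis ℝ Z
  set B := b.prod (Module.Basis.singleton Unit ℝ) with hB
  obtain ⟨gH, rH, hrH, hgH, -, eH⟩ := hH.exists_algebra_extension (A := 𝔅 →L[ℝ] 𝔅)
    (W := 𝔅 →L[ℝ] ℝ) B
  obtain ⟨gh, rh, hrh, hgh, -, eh⟩ := hh.exists_algebra_extension (A := 𝔅 →L[ℝ] 𝔅)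
    (W := 𝔅 →L[ℝ] ℝ) B
  obtain ⟨gu, ru, hru, hgu, hgu0, eu⟩ := hu.exists_algebra_extension (A := 𝔅 →L[ℝ] 𝔅)
    (W := 𝔅 →L[ℝ] ℝ) (Module.Basis.singleton Unit ℝ)
  -- the scaling parameter
  obtain ⟨ρ, hρ0, hρ1, hρS, hρU⟩ : ∃ ρ : ℝ, 0 < ρ ∧ ρ < min (min rH rh) ru ∧
      ‖ρ • M.right‖ < min (min rH rh) ru ∧ IsUnit (gu fun _ => ρ • M.right) := by
    have hpos : 0 < min (min rH rh) ru := lt_min (lt_min hrH hrh) hru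
    have c1 : Tendsto (fun ρ : ℝ => ρ • M.right) (𝓝[>] 0) (𝓝 0) := by
      have : Continuous fun ρ : ℝ => ρ • M.right := by fun_prop
      simpa using (this.tendsto 0).mono_left nhdsWithin_le_nhds
    have c2 : Tendsto (fun ρ : ℝ => fun _ : Unit => ρ • M.right) (𝓝[>] 0) (𝓝 0) :=
      tendsto_pi_nhds.2 fun _ => c1
    have c3 : Tendsto (fun ρ : ℝ => gu fun _ => ρ • M.right) (𝓝[>] 0) (𝓝 (gu 0)) :=
      ((hgu 0 (Metric.mem_ball_self hru)).continuousAt.tendsto).comp c2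
    have c4 : IsUnit (gu 0) := by
      rw [hgu0]; exact (IsUnit.mk0 _ hu0).map (algebraMap ℝ (𝔅 →L[ℝ] 𝔅))
    have c5 := c3.eventually (Units.isOpen.mem_nhds c4)
    have c6 := c1.norm.eventually (gt_mem_nhds (by rw [norm_zero]; exact hpos))
    have c7 : ∀ᶠ ρ : ℝ in 𝓝[>] 0, ρ < min (min rH rh) ru :=
      nhdsWithin_le_nhds (gt_mem_nhds hpos)
    obtain ⟨ρ, h5, h6, h7, h8⟩ := (c5.and (c6.and (c7.and self_mem_nhdsWithin))).exists
    exact ⟨ρ, h8, h7, h6, h5⟩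
  set U := gu fun _ => ρ • M.right with hU
  -- substitution point
  set a : Z → (Fin (Module.finrank ℝ Z) ⊕ Unit) → (𝔅 →L[ℝ] 𝔅) := fun z =>
    Sum.elim (fun i => b.repr z i • 1) (fun _ => ρ • M.right) with ha
  have haA : ∀ z, AnalyticAt ℝ a z := by
    intro z
    refine AnalyticAt.pi fun i => ?_
    rcases i with i | i
    · have : AnalyticAt ℝ (fun z => b.repr z i) z :=
        ((LinearMap.toContinuousLinearMap (b.coord i)).analyticAt z)
      exact this.smul analyticAt_const
    · exact analyticAt_const
  have ha0 : ‖a 0‖ < min (min rH rh) ru := by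
    refine (pi_norm_lt_iff (lt_min (lt_min hrH hrh) hru)).2 ?_
    rintro (i | i)
    · simpa [ha] using ⟨⟨hrH, hrh⟩, hru⟩
    · exact hρS
  set x : Z → ℝ → (Fin (Module.finrank ℝ Z) ⊕ Unit) → ℝ := fun z s =>
    Sum.elim (fun i => b.repr z i) (fun _ => ρ * s) with hx
  have hBx : ∀ z s, ∑ i, x z s i • B i = (z, ρ * s) := by
    intro z s
    rw [Fintype.sum_sum_type]
    have e1 : ∑ i, b.repr z i • b i = z := b.sum_repr z
    simp only [hx, hB, Sum.elim_inl, Sum.elim_inr]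
    ext
    · simp [Module.Basis.prod_apply, Prod.fst_sum, e1]
    · simp [Module.Basis.prod_apply, Prod.snd_sum]
  have hsmall : ∀ᶠ z in 𝓝 (0 : Z), ‖a z‖ < min (min rH rh) ru ∧
      ∀ i, |b.repr z i| < min (min rH rh) ru := by
    refine ((haA 0).continuousAt.norm.eventually (gt_mem_nhds ha0)).and ?_
    refine eventually_all.2 fun i => ?_
    have : Continuous (fun z => |b.repr z i|) :=
      (LinearMap.toContinuousLinearMap (b.coord i)).continuous.abs
    refine (this.tendsto 0).eventually (gt_mem_nhds ?_)
    simpa using ⟨⟨hrH, hrh⟩, hru⟩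
  have hxs : ∀ z s, (∀ i, |b.repr z i| < min (min rH rh) ru) → |s| < 1 →
      ‖x z s‖ < min (min rH rh) ru := by
    intro z s hz hs
    refine (pi_norm_lt_iff (lt_min (lt_min hrH hrh) hru)).2 ?_
    rintro (i | i)
    · exact hz i
    · simp only [hx, Sum.elim_inr, Real.norm_eq_abs, abs_mul, abs_of_pos hρ0]
      nlinarith [abs_nonneg s]
  -- Composition with `powerSum s` is a simultaneous eigenfunctional: left multiplication by `ρ •
  -- right` becomes the scalar `ρ * s`. Hence `powerSum s` intertwines `H(z, ρ • right)` with
  -- multiplication by `H(z, ρ s)`.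
  set Φ : ℝ → (𝔅 →L[ℝ] 𝔅) →L[ℝ] (𝔅 →L[ℝ] ℝ) := fun s =>
    ContinuousLinearMap.compL ℝ 𝔅 𝔅 ℝ (M.powerSum s) with hΦ
  have hΦa : ∀ z s, |s| < 1 → ∀ i c, Φ s (a z i * c) = x z s i • Φ s c := by
    intro z s hs i c
    ext v
    rcases i with i | i
    · simp [hΦ, ha, hx]
    · simp [hΦ, ha, hx, M.powerSum_right hs, mul_assoc]
  have key : ∀ z s, (‖a z‖ < min (min rH rh) ru ∧ ∀ i, |b.repr z i| < min (min rH rh) ru) →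
      |s| < 1 → ∀ v, M.powerSum s (gH (a z) v) = H (z, ρ * s) * M.powerSum s v ∧
        M.powerSum s (gh (a z) v) = h (z, ρ * s) * M.powerSum s v := by
    intro z s hz hs v
    have hxz := hxs z s hz.2 hs
    have m1 : min (min rH rh) ru ≤ rH := (min_le_left _ _).trans (min_le_left _ _)
    have m2 : min (min rH rh) ru ≤ rh := (min_le_left _ _).trans (min_le_right _ _)
    have e1 := eH (a z) (x z s) (hz.1.trans_le m1) (hxz.trans_le m1) (Φ s) (hΦa z s hs)
    have e2 := eh (a z) (x z s) (hz.1.trans_le m2) (hxz.trans_le m2) (Φ s) (hΦa z s hs)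
    rw [hBx] at e1 e2
    constructor
    · simpa [hΦ] using congrArg (fun T : 𝔅 →L[ℝ] ℝ => T v) e1
    · simpa [hΦ] using congrArg (fun T : 𝔅 →L[ℝ] ℝ => T v) e2
  -- Both operators have the same power sums on every vector, and power sums determine a vector.
  have hMH0 : gH (a 0) = (ρ ^ d) • (M.right ^ d * U) := by
    ext1 v
    rw [← sub_eq_zero]
    apply M.eq_zero_of_powerSum_eq_zero
    have t1 : Tendsto (fun s : ℝ => ρ * s) (𝓝 0) (𝓝 0) := by
      have : Continuous fun s : ℝ => ρ * s := by fun_prop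
      simpa using this.tendsto 0
    filter_upwards [ShiftModel.eventually_abs_lt_one, t1.eventually hHu] with s hs hHs
    rw [map_sub, (key 0 s hsmall.self_of_nhds hs v).1, hHs]
    have e3 := eu (fun _ => ρ • M.right) (fun _ => ρ * s)
      ((pi_norm_lt_iff hru).2 fun _ => hρS.trans_le (min_le_right _ _))
      ((pi_norm_lt_iff hru).2 fun _ => by
        simp only [Real.norm_eq_abs, abs_mul, abs_of_pos hρ0]
        have := hρ1.trans_le (min_le_right _ _)
        nlinarith [abs_nonneg s]) (Φ s)
      (fun _ c => by ext v; simp [hΦ, M.powerSum_right hs, mul_assoc])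
    have e4 := congrArg (fun T : 𝔅 →L[ℝ] ℝ => T v) e3
    simp [hΦ] at e4
    simp only [smul_apply, mul_apply_eq_comp, map_smul, M.powerSum_pow_right hs,
      hU, e4, smul_eq_mul]
    ring
  set T : Z → (𝔅 × (Fin d → ℝ)) →L[ℝ] 𝔅 := fun z =>
    (gH (a z)) ∘L ContinuousLinearMap.fst ℝ 𝔅 (Fin d → ℝ) +
      (M.poly d) ∘L ContinuousLinearMap.snd ℝ 𝔅 (Fin d → ℝ) with hT
  have hgHa : AnalyticAt ℝ (fun z => gH (a z)) 0 :=
    AnalyticAt.fun_comp (hgH (a 0) (by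
      rw [Metric.mem_ball, dist_zero_right]
      exact ha0.trans_le ((min_le_left _ _).trans (min_le_left _ _)))) (haA 0)
  have hgha : AnalyticAt ℝ (fun z => gh (a z)) 0 :=
    AnalyticAt.fun_comp (hgh (a 0) (by
      rw [Metric.mem_ball, dist_zero_right]
      exact ha0.trans_le ((min_le_left _ _).trans (min_le_right _ _)))) (haA 0)
  have hTA : AnalyticAt ℝ T 0 := by
    refine AnalyticAt.add ?_ analyticAt_const
    exact (((ContinuousLinearMap.compL ℝ (𝔅 × (Fin d → ℝ)) 𝔅 𝔅).flip
      (ContinuousLinearMap.fst ℝ 𝔅 (Fin d → ℝ))).analyticAt _).fun_comp hgHa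
  obtain ⟨e, he⟩ : ∃ e : (𝔅 × (Fin d → ℝ)) ≃L[ℝ] 𝔅, (e : (𝔅 × (Fin d → ℝ)) →L[ℝ] 𝔅) = T 0 := by
    have hρd : ρ ^ d ≠ 0 := (pow_pos hρ0 d).ne'
    obtain ⟨V, hV1, hV2⟩ := isUnit_iff_exists.1 hρU
    have hT0 : ∀ p, T 0 p = (M.right ^ d) (ρ ^ d • U p.1) + M.poly d p.2 := by
      intro p; simp [hT, hMH0]
    have inj : Function.Injective (T 0) := by
      rw [injective_iff_map_eq_zero]
      intro p hp
      rw [hT0] at hp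
      obtain ⟨h1, h2⟩ := M.pow_add_poly_injective d _ _ hp
      have h3 : U p.1 = 0 := (smul_eq_zero.1 h1).resolve_left hρd
      have h4 : p.1 = V (U p.1) := by
        have := congrArg (fun T : 𝔅 →L[ℝ] 𝔅 => T p.1) hV2
        simpa using this.symm
      ext1
      · rw [h4, h3]; simp
      · exact h2
    have surj : Function.Surjective (T 0) := by
      intro c
      obtain ⟨c', r, hc⟩ := M.exists_pow_add_poly d c
      refine ⟨((ρ ^ d)⁻¹ • V c', r), ?_⟩
      rw [hT0, ← hc]
      have := congrArg (fun T : 𝔅 →L[ℝ] 𝔅 => T c') hV1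
      simp at this
      simp [this, hρd]
    refine ⟨ContinuousLinearEquiv.ofBijective (T 0) (LinearMap.ker_eq_bot.2 inj)
      (LinearMap.range_eq_top.2 surj), ?_⟩
    exact ContinuousLinearMap.ext fun p => rfl
  set sol : Z → 𝔅 × (Fin d → ℝ) := fun z => (T z).inverse (gh (a z) M.unit) with hsol
  have hsolA : AnalyticAt ℝ sol 0 := by
    have i1 : AnalyticAt ℝ (ContinuousLinearMap.inverse (R := ℝ)
        (M := 𝔅 × (Fin d → ℝ)) (M₂ := 𝔅)) (T 0) := by
      rw [← he]; exact (contDiffAt_map_inverse (n := ω) e).analyticAt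
    have i2 : AnalyticAt ℝ (fun z => (T z).inverse) 0 := AnalyticAt.fun_comp i1 hTA
    have i3 : AnalyticAt ℝ (fun z => gh (a z) M.unit) 0 :=
      ((ContinuousLinearMap.apply ℝ 𝔅 M.unit).analyticAt _).fun_comp hgha
    exact ((i2.contDiffAt (n := ω)).clm_apply i3.contDiffAt).analyticAt
  have hsolT : ∀ᶠ z in 𝓝 (0 : Z), T z (sol z) = gh (a z) M.unit := by
    have := hTA.continuousAt.eventually (he ▸ e.nhds)
    filter_upwards [this] with z ⟨e', he'⟩
    simp only [hsol]
    rw [← he', ContinuousLinearMap.inverse_equiv]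
    simp
  -- The operator stands for `y = ρ s`, so power sums are taken at `s = y / ρ` and the `i`-th
  -- remainder coefficient is divided by `ρ ^ i`.
  refine ⟨fun p => M.powerSum (p.2 / ρ) (sol p.1).1,
    fun i z => if hi : i < d then (sol z).2 ⟨i, hi⟩ / ρ ^ i else 0, ?_, ?_, ?_⟩
  · have j1 : AnalyticAt ℝ (fun p : Z × ℝ => M.powerSum (p.2 / ρ)) 0 := by
      refine AnalyticAt.fun_comp_of_eq (g := M.powerSum) M.analyticAt_powerSum
        (f := fun p : Z × ℝ => p.2 / ρ) ?_ (by simp)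
      exact analyticAt_snd.div_const
    have j2 : AnalyticAt ℝ (fun p : Z × ℝ => (sol p.1).1) 0 := by
      refine AnalyticAt.fun_comp (g := Prod.fst) analyticAt_fst ?_
      exact AnalyticAt.fun_comp_of_eq (g := sol) hsolA analyticAt_fst rfl
    exact ((j1.contDiffAt (n := ω)).clm_apply j2.contDiffAt).analyticAt
  · intro i
    by_cases hi : i < d
    · simp only [hi, dif_pos]
      refine AnalyticAt.div_const ?_
      exact ((ContinuousLinearMap.proj (R := ℝ) (φ := fun _ : Fin d => ℝ) ⟨i, hi⟩).analyticAt
        _).fun_comp (AnalyticAt.fun_comp (g := Prod.snd) analyticAt_snd hsolA)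
    · simp only [hi]
      exact analyticAt_const
  · have f1 : ∀ᶠ p : Z × ℝ in 𝓝 0, |p.2 / ρ| < 1 := by
      have : Continuous fun p : Z × ℝ => p.2 / ρ := by fun_prop
      have t := this.tendsto 0
      rw [Prod.snd_zero, zero_div] at t
      exact t.eventually ShiftModel.eventually_abs_lt_one
    have f2 : Tendsto (fun p : Z × ℝ => p.1) (𝓝 0) (𝓝 0) := continuous_fst.tendsto 0
    filter_upwards [f1, f2.eventually hsolT, f2.eventually hsmall] with p hp1 hp2 hp3
    obtain ⟨z, y⟩ := p
    dsimp only at hp1 hp2 hp3 ⊢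
    have hy : ρ * (y / ρ) = y := by field_simp
    have g1 := (key z (y / ρ) hp3 hp1 M.unit).2
    rw [M.powerSum_unit hp1, mul_one, hy, ← hp2] at g1
    simp only [hT, add_apply, ContinuousLinearMap.comp_apply,
      ContinuousLinearMap.coe_fst', ContinuousLinearMap.coe_snd', map_add,
      M.powerSum_poly hp1, (key z (y / ρ) hp3 hp1 _).1, hy] at g1
    rw [← g1, mul_comm, Finset.sum_range]
    congr 1
    refine Finset.sum_congr rfl fun i _ => ?_
    simp only [i.2, dif_pos, Fin.eta]
    rw [div_pow]; ring

/-- **Weierstrass division theorem** for real analytic germs. -/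
theorem weierstrass_division
    {Z : Type*} [NormedAddCommGroup Z] [NormedSpace ℝ Z] [FiniteDimensional ℝ Z]
    {H h : Z × ℝ → ℝ} (hH : AnalyticAt ℝ H 0) (hh : AnalyticAt ℝ h 0) {d : ℕ} {u : ℝ → ℝ}
    (hu : AnalyticAt ℝ u 0) (hu0 : u 0 ≠ 0) (hHu : ∀ᶠ y in 𝓝 (0 : ℝ), H (0, y) = y ^ d * u y) :
    ∃ (Q : Z × ℝ → ℝ) (r : ℕ → Z → ℝ), AnalyticAt ℝ Q 0 ∧ (∀ i, AnalyticAt ℝ (r i) 0) ∧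
      ∀ᶠ x in 𝓝 (0 : Z × ℝ), h x = Q x * H x + ∑ i ∈ Finset.range d, r i x.1 * x.2 ^ i :=
  weierstrass_division_aux boundedSeqShift hH hh hu hu0 hHu

/-- Division of an analytic germ by a power of the last variable. -/
theorem AnalyticAt.exists_taylor_division
    {Z : Type*} [NormedAddCommGroup Z] [NormedSpace ℝ Z] [FiniteDimensional ℝ Z]
    {h : Z × ℝ → ℝ} {z₀ : Z} (hh : AnalyticAt ℝ h (z₀, 0)) (n : ℕ) :
    ∃ (Q : Z × ℝ → ℝ) (r : ℕ → Z → ℝ), AnalyticAt ℝ Q (z₀, 0) ∧ (∀ i, AnalyticAt ℝ (r i) z₀) ∧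
      ∀ᶠ x in 𝓝 ((z₀, 0) : Z × ℝ),
        h x = x.2 ^ n * Q x + ∑ i ∈ Finset.range n, r i x.1 * x.2 ^ i := by
  have hH : AnalyticAt ℝ (fun x : Z × ℝ => x.2 ^ n) 0 := analyticAt_snd.pow n
  have hh' : AnalyticAt ℝ (fun x : Z × ℝ => h (x + (z₀, 0))) 0 :=
    AnalyticAt.fun_comp_of_eq (g := h) hh (analyticAt_id.add analyticAt_const) (by simp)
  obtain ⟨Q, r, hQ, hr, e⟩ := weierstrass_division hH hh' (d := n) (u := fun _ => 1)
    analyticAt_const one_ne_zero (by simp)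
  refine ⟨fun x => Q (x - (z₀, 0)), fun i z => r i (z - z₀), ?_, fun i => ?_, ?_⟩
  · exact AnalyticAt.fun_comp_of_eq (g := Q) hQ (analyticAt_id.sub analyticAt_const) (by simp)
  · exact AnalyticAt.fun_comp_of_eq (g := r i) (hr i) (analyticAt_id.sub analyticAt_const)
      (by simp)
  · have t : Tendsto (fun x : Z × ℝ => x - (z₀, 0)) (𝓝 (z₀, 0)) (𝓝 0) := by
      have : Continuous fun x : Z × ℝ => x - (z₀, 0) := by fun_prop
      simpa using this.tendsto (z₀, 0)
    filter_upwards [t.eventually e] with x hx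
    simp only [sub_add_cancel] at hx
    rw [hx]
    simp [mul_comm]

/-! ### Vanishing criteria for analytic germs and for flat solutions of one equation. -/

/-- A family of analytic germs closed under directional derivatives, all of which vanish at the
base point, consists of the zero germ. -/
theorem eventuallyEq_zero_of_fderiv_mem {E : Type*} [NormedAddCommGroup E] [NormedSpace ℝ E]
    {o : E} {𝒩 : Set (E → ℝ)} (h1 : ∀ η ∈ 𝒩, AnalyticAt ℝ η o)
    (h2 : ∀ η ∈ 𝒩, ∀ w, (fun x => fderiv ℝ η x w) ∈ 𝒩) (h3 : ∀ η ∈ 𝒩, η o = 0)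
    {η : E → ℝ} (hη : η ∈ 𝒩) : ∀ᶠ x in 𝓝 o, η x = 0 := by
  -- A derivative of order `n + 1` of `η` is one of order `n` of a directional derivative, which is
  -- again in `𝒩`. Hence all Taylor coefficients at `o` vanish.
  have key : ∀ n, ∀ η ∈ 𝒩, ∀ v, iteratedFDeriv ℝ n η o v = 0 := by
    intro n
    induction n with
    | zero => intro η hη v; rw [iteratedFDeriv_zero_apply]; exact h3 η hη
    | succ n ih =>
      intro η hη v
      rw [iteratedFDeriv_succ_apply_right]
      have hc : ContDiffAt ℝ n (fderiv ℝ η) o := (h1 η hη).fderiv.contDiffAt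
      have := (ContinuousLinearMap.apply ℝ ℝ (v (Fin.last n))).iteratedFDeriv_comp_left hc
        (i := n) le_rfl
      have e := ih _ (h2 η hη (v (Fin.last n))) (Fin.init v)
      have e' := congrArg (fun T => T (Fin.init v)) this
      change iteratedFDeriv ℝ n (fun x => fderiv ℝ η x (v (Fin.last n))) o (Fin.init v) = _ at e'
      rw [e] at e'
      exact e'.symm
  obtain ⟨p, r, hp⟩ := h1 η hη
  have hball := Metric.eball_mem_nhds o hp.r_pos
  filter_upwards [hball] with x hx
  have hs := hp.hasSum_sub hx
  refine hs.unique ?_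
  convert hasSum_zero with n
  have := hp.factorial_smul (x - o) n
  rw [key n η hη] at this
  exact (smul_eq_zero.1 this).resolve_left (Nat.factorial_ne_zero n)

theorem AnalyticAt.exists_eq_pow_mul {f : ℝ → ℝ} (hf : AnalyticAt ℝ f 0)
    (hne : ¬ ∀ᶠ s in 𝓝 (0 : ℝ), f s = 0) :
    ∃ (d : ℕ) (u : ℝ → ℝ), AnalyticAt ℝ u 0 ∧ u 0 ≠ 0 ∧ ∀ᶠ s in 𝓝 (0 : ℝ), f s = s ^ d * u s := by
  obtain ⟨n, g, hg, hg0, e⟩ := hf.exists_eventuallyEq_pow_smul_nonzero_iff.2 hne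
  exact ⟨n, g, hg, hg0, by simpa using e⟩

/-- An analytic equation in two variables which is nontrivial on the axis `τ = 0` has no nonzero
solutions which are flat with respect to `τ`. -/
theorem eventually_eq_zero_of_flat_solution {T : Type*} {𝒰 : Ultrafilter T} {τ s : T → ℝ}
    (hτ : Tendsto τ 𝒰 (𝓝 0)) (hτ0 : ∀ᶠ t in 𝒰, τ t ≠ 0)
    (hs : ∀ n : ℕ, ∀ᶠ t in 𝒰, |s t| ≤ |τ t| ^ n)
    {h : ℝ × ℝ → ℝ} (hh : AnalyticAt ℝ h 0) (hne : ¬ ∀ᶠ s in 𝓝 (0 : ℝ), h (0, s) = 0)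
    (hz : ∀ᶠ t in 𝒰, h (τ t, s t) = 0) : ∀ᶠ t in 𝒰, s t = 0 := by
  have hs0 : Tendsto s 𝒰 (𝓝 0) := by
    rw [tendsto_zero_iff_abs_tendsto_zero]
    refine squeeze_zero' (Eventually.of_forall fun _ => abs_nonneg _) (hs 1) ?_
    simpa using hτ.abs
  have hτs : Tendsto (fun t => (τ t, s t)) 𝒰 (𝓝 0) := hτ.prodMk_nhds hs0
  have hh0 : AnalyticAt ℝ (fun s : ℝ => h (0, s)) 0 :=
    AnalyticAt.fun_comp_of_eq (g := h) hh (analyticAt_const.prod analyticAt_id) rfl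
  obtain ⟨d, u, hu, hu0, e⟩ := hh0.exists_eq_pow_mul hne
  clear hne hh0
  -- Along an ultrafilter the negation gives `s ≠ 0` eventually, so that `s` may be cancelled. The
  -- induction is on the order `d` of `h (0, ·)` at `0`.
  by_contra hcon
  rw [Ultrafilter.eventually_not.symm] at hcon
  induction d generalizing h with
  | zero =>
    have h0 : h 0 ≠ 0 := by
      have := e.self_of_nhds
      simp only [pow_zero, one_mul] at this
      rw [Prod.zero_eq_mk, this]; exact hu0
    have := (hh.continuousAt.tendsto.comp hτs).eventually (isOpen_ne.mem_nhds h0)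
    obtain ⟨t, h1, h2⟩ := (this.and hz).exists
    exact h1 h2
  | succ d ih =>
    obtain ⟨Q, r, hQ, hr, eQ⟩ := AnalyticAt.exists_taylor_division (z₀ := (0 : ℝ)) hh 1
    simp only [pow_one, Finset.range_one, Finset.sum_singleton, pow_zero, mul_one] at eQ
    by_cases hr0 : ∀ᶠ t in 𝓝 (0 : ℝ), r 0 t = 0
    · refine ih hQ ?_ ?_
      · filter_upwards [hτs.eventually eQ, hz, hτ.eventually hr0, hcon] with t h1 h2 h3 h4
        rw [h2, h3, add_zero] at h1
        exact (mul_eq_zero.1 h1.symm).resolve_left h4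
      · have t0 : Tendsto (fun s : ℝ => ((0, s) : ℝ × ℝ)) (𝓝 0) (𝓝 0) := by
          have : Continuous fun s : ℝ => ((0, s) : ℝ × ℝ) := by fun_prop
          exact this.tendsto 0
        have h1 : ∀ᶠ s in 𝓝[≠] (0 : ℝ), Q (0, s) = s ^ d * u s := by
          filter_upwards [nhdsWithin_le_nhds e, nhdsWithin_le_nhds (t0.eventually eQ),
            self_mem_nhdsWithin] with s h1 h2 h3
          rw [hr0.self_of_nhds, add_zero, h1] at h2
          have h3' : s ≠ 0 := h3
          refine mul_left_cancel₀ h3' ?_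
          rw [← h2]; ring
        have h2 : Q (0, 0) = 0 ^ d * u 0 := by
          have c1 : Tendsto (fun s : ℝ => Q (0, s)) (𝓝[≠] 0) (𝓝 (Q (0, 0))) :=
            (hQ.continuousAt.tendsto.comp t0).mono_left nhdsWithin_le_nhds
          have c2 : Tendsto (fun s : ℝ => s ^ d * u s) (𝓝[≠] 0) (𝓝 (0 ^ d * u 0)) :=
            ((continuousAt_id.pow d).mul hu.continuousAt).tendsto.mono_left nhdsWithin_le_nhds
          exact tendsto_nhds_unique (c1.congr' h1) c2
        filter_upwards [eventually_nhdsWithin_iff.1 h1] with s hs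
        by_cases h : s = 0
        · rw [h, h2]
        · exact hs h
    -- Here `h = s Q + r` with `r` of exact order `a` in `τ`. The equation gives `|τ| ^ a |v| = |s|
    -- |Q|`, which is incompatible with `|s| ≤ |τ| ^ (a + 1)` for small `τ`.
    · obtain ⟨a, v, hv, hv0, ev⟩ := (hr 0).exists_eq_pow_mul hr0
      have b1 : ∀ᶠ t in 𝒰, |Q (τ t, s t)| < |Q 0| + 1 :=
        ((hQ.continuousAt.tendsto.comp hτs).abs).eventually (gt_mem_nhds (lt_add_one _))
      have b2 : ∀ᶠ t in 𝒰, |v 0| / 2 < |v (τ t)| :=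
        ((hv.continuousAt.tendsto.comp hτ).abs).eventually
          (lt_mem_nhds (half_lt_self (abs_pos.2 hv0)))
      have b3 : ∀ᶠ t in 𝒰, |τ t| * (|Q 0| + 1) < |v 0| / 2 := by
        have : Tendsto (fun t => |τ t| * (|Q 0| + 1)) 𝒰 (𝓝 0) := by
          simpa using (hτ.abs).mul_const (|Q 0| + 1)
        exact this.eventually (gt_mem_nhds (half_pos (abs_pos.2 hv0)))
      obtain ⟨t, c1, c2, c3, c4, c5, c6, c7, c8⟩ := (b1.and (b2.and (b3.and (hτ0.and
        ((hs (a + 1)).and (hz.and ((hτs.eventually eQ).and (hτ.eventually ev)))))))).exists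
      rw [c6, c8] at c7
      have d1 : |τ t| ^ a * |v (τ t)| = |s t| * |Q (τ t, s t)| := by
        rw [← abs_pow, ← abs_mul, ← abs_mul, ← abs_neg (s t * _)]
        congr 1
        simp only at c7
        linarith
      have d2 : 0 < |τ t| ^ a := pow_pos (abs_pos.2 c4) a
      have d3 : |s t| * |Q (τ t, s t)| ≤ |τ t| ^ (a + 1) * (|Q 0| + 1) := by
        gcongr
      rw [← d1, pow_succ, mul_assoc] at d3
      have := le_of_mul_le_mul_left d3 d2
      linarith

/-! ### Vanishing germs along a curve and their differentials over the ultrapower of the reals. -/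

section Elimination

variable {T : Type} {𝒰 : Ultrafilter T}

/-- `y` is smaller than every power of `τ` along the ultrafilter `𝒰`. -/
def FlatAlong {E : Type*} [Norm E] (𝒰 : Ultrafilter T) (τ : T → ℝ) (y : T → E) : Prop :=
  ∀ n : ℕ, ∀ᶠ t in 𝒰, ‖y t‖ ≤ |τ t| ^ n

/-- The analytic germs at `0` which vanish along `x`. -/
def vanishingGerms {E : Type} [NormedAddCommGroup E] [NormedSpace ℝ E] (𝒰 : Ultrafilter T)
    (x : T → E) : Set (E → ℝ) :=
  {h | AnalyticAt ℝ h 0 ∧ ∀ᶠ t in 𝒰, h (x t) = 0}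

/-- The differential of `h` along `x`, with values in the ultrapower of `ℝ`. -/
noncomputable def germDeriv {E : Type} [NormedAddCommGroup E] [NormedSpace ℝ E]
    (𝒰 : Ultrafilter T) (x : T → E) (h : E → ℝ) : E → (𝒰 : Filter T).Germ ℝ :=
  fun e => ((fun t => fderiv ℝ h (x t) e : T → ℝ) : (𝒰 : Filter T).Germ ℝ)

/-- The constant `‖L‖` is absorbed by one spare power of `τ`. -/
theorem FlatAlong.clm {E F : Type*} [NormedAddCommGroup E] [NormedSpace ℝ E]
    [NormedAddCommGroup F] [NormedSpace ℝ F] {τ : T → ℝ} {y : T → E} (hy : FlatAlong 𝒰 τ y)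
    (hτ : Tendsto τ 𝒰 (𝓝 0)) (L : E →L[ℝ] F) : FlatAlong 𝒰 τ fun t => L (y t) := by
  intro n
  have h1 : ∀ᶠ t in 𝒰, ‖L‖ * |τ t| < 1 := by
    have : Tendsto (fun t => ‖L‖ * |τ t|) 𝒰 (𝓝 0) := by simpa using hτ.abs.const_mul ‖L‖
    exact this.eventually (gt_mem_nhds one_pos)
  filter_upwards [hy (n + 1), h1] with t h2 h3
  calc ‖L (y t)‖ ≤ ‖L‖ * ‖y t‖ := L.le_opNorm _
    _ ≤ ‖L‖ * |τ t| ^ (n + 1) := by gcongr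
    _ = (‖L‖ * |τ t|) * |τ t| ^ n := by ring
    _ ≤ 1 * |τ t| ^ n := by gcongr
    _ = _ := one_mul _

theorem FlatAlong.tendsto {E : Type*} [NormedAddCommGroup E] {τ : T → ℝ} {y : T → E}
    (hy : FlatAlong 𝒰 τ y) (hτ : Tendsto τ 𝒰 (𝓝 0)) : Tendsto y 𝒰 (𝓝 0) := by
  rw [tendsto_zero_iff_norm_tendsto_zero]
  refine squeeze_zero' (Eventually.of_forall fun _ => norm_nonneg _) (hy 1) ?_
  simpa using hτ.abs

section germDeriv

variable {E : Type} [NormedAddCommGroup E] [NormedSpace ℝ E] {x : T → E}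

theorem germDeriv_congr {f g : E → ℝ} (hx : Tendsto x 𝒰 (𝓝 0)) (h : f =ᶠ[𝓝 0] g) :
    germDeriv 𝒰 x f = germDeriv 𝒰 x g := by
  ext1 e
  refine Germ.coe_eq.2 ?_
  filter_upwards [hx.eventually h.eventuallyEq_nhds] with t ht
  rw [ht.fderiv_eq]

theorem germDeriv_add {f g : E → ℝ} (hx : Tendsto x 𝒰 (𝓝 0)) (hf : AnalyticAt ℝ f 0)
    (hg : AnalyticAt ℝ g 0) :
    germDeriv 𝒰 x (fun p => f p + g p) = germDeriv 𝒰 x f + germDeriv 𝒰 x g := by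
  ext1 e
  refine Germ.coe_eq.2 ?_
  filter_upwards [hx.eventually hf.eventually_analyticAt,
    hx.eventually hg.eventually_analyticAt] with t h1 h2
  rw [fderiv_fun_add h1.differentiableAt h2.differentiableAt]
  rfl

theorem germDeriv_mul {f g : E → ℝ} (hx : Tendsto x 𝒰 (𝓝 0)) (hf : AnalyticAt ℝ f 0)
    (hg : AnalyticAt ℝ g 0) :
    germDeriv 𝒰 x (fun p => f p * g p) =
      ((fun t => f (x t) : T → ℝ) : (𝒰 : Filter T).Germ ℝ) • germDeriv 𝒰 x g +
      ((fun t => g (x t) : T → ℝ) : (𝒰 : Filter T).Germ ℝ) • germDeriv 𝒰 x f := by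
  ext1 e
  refine Germ.coe_eq.2 ?_
  filter_upwards [hx.eventually hf.eventually_analyticAt,
    hx.eventually hg.eventually_analyticAt] with t h1 h2
  rw [fderiv_fun_mul h1.differentiableAt h2.differentiableAt]
  rfl

theorem germDeriv_mul_of_vanishing {f g : E → ℝ} (hx : Tendsto x 𝒰 (𝓝 0))
    (hf : AnalyticAt ℝ f 0) (hg : g ∈ vanishingGerms 𝒰 x) :
    germDeriv 𝒰 x (fun p => f p * g p) =
      ((fun t => f (x t) : T → ℝ) : (𝒰 : Filter T).Germ ℝ) • germDeriv 𝒰 x g := by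
  rw [germDeriv_mul hx hf hg.1]
  have : ((fun t => g (x t) : T → ℝ) : (𝒰 : Filter T).Germ ℝ) = 0 := Germ.coe_eq.2 hg.2
  rw [this, zero_smul, add_zero]

theorem vanishingGerms.mul_mem {f g : E → ℝ}
    (hf : AnalyticAt ℝ f 0) (hg : g ∈ vanishingGerms 𝒰 x) :
    (fun p => f p * g p) ∈ vanishingGerms 𝒰 x :=
  ⟨hf.mul hg.1, hg.2.mono fun t ht => by simp only [ht, mul_zero]⟩

theorem vanishingGerms.add_mem {f g : E → ℝ}
    (hf : f ∈ vanishingGerms 𝒰 x) (hg : g ∈ vanishingGerms 𝒰 x) :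
    (fun p => f p + g p) ∈ vanishingGerms 𝒰 x :=
  ⟨hf.1.add hg.1, by filter_upwards [hf.2, hg.2] with t h1 h2; rw [h1, h2, add_zero]⟩

theorem vanishingGerms.congr_mem {f g : E → ℝ} (hx : Tendsto x 𝒰 (𝓝 0))
    (hf : f ∈ vanishingGerms 𝒰 x) (hfg : f =ᶠ[𝓝 0] g) : g ∈ vanishingGerms 𝒰 x :=
  ⟨hf.1.congr hfg, by filter_upwards [hf.2, hx.eventually hfg] with t h1 h2; rw [← h2, h1]⟩

end germDeriv

section Polynomials

variable {E : Type} [NormedAddCommGroup E] [NormedSpace ℝ E]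

/-- The polynomial `∑_{i < d} a i (z) s ^ i`. -/
def fiberPoly (a : ℕ → E → ℝ) (d : ℕ) : E × ℝ → ℝ :=
  fun p => ∑ i ∈ Finset.range d, a i p.1 * p.2 ^ i

theorem fiberPoly_zero (a : ℕ → E → ℝ) : fiberPoly a 0 = fun _ => 0 := by
  ext p; simp [fiberPoly]

theorem fiberPoly_succ (a : ℕ → E → ℝ) (d : ℕ) :
    fiberPoly a (d + 1) = fun p => fiberPoly a d p + a d p.1 * p.2 ^ d := by
  ext p; simp [fiberPoly, Finset.sum_range_succ]

theorem analyticAt_fiberPoly {a : ℕ → E → ℝ} (ha : ∀ i, AnalyticAt ℝ (a i) 0) (d : ℕ) :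
    AnalyticAt ℝ (fiberPoly a d) 0 := by
  induction d with
  | zero => rw [fiberPoly_zero]; exact analyticAt_const
  | succ d ih =>
    rw [fiberPoly_succ]
    exact ih.add ((AnalyticAt.fun_comp_of_eq (g := a d) (ha d) analyticAt_fst rfl).mul
      (analyticAt_snd.pow d))

variable {x : T → E × ℝ}

theorem mem_vanishingGerms_fst {a : E → ℝ} (ha : a ∈ vanishingGerms 𝒰 fun t => (x t).1) :
    (fun p : E × ℝ => a p.1) ∈ vanishingGerms 𝒰 x :=
  ⟨AnalyticAt.fun_comp_of_eq (g := a) ha.1 analyticAt_fst rfl, ha.2⟩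

theorem germDeriv_fst (hx : Tendsto x 𝒰 (𝓝 0)) {a : E → ℝ} (ha : AnalyticAt ℝ a 0) :
    germDeriv 𝒰 x (fun p : E × ℝ => a p.1) =
      LinearMap.funLeft ((𝒰 : Filter T).Germ ℝ) ((𝒰 : Filter T).Germ ℝ) Prod.fst
        (germDeriv 𝒰 (fun t => (x t).1) a) := by
  ext1 e
  refine Germ.coe_eq.2 ?_
  have hx1 : Tendsto (fun t => (x t).1) 𝒰 (𝓝 0) := (continuous_fst.tendsto (0 : E × ℝ)).comp hx
  filter_upwards [hx1.eventually ha.eventually_analyticAt] with t h1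
  have := h1.differentiableAt.hasFDerivAt.comp (x t)
    ((ContinuousLinearMap.fst ℝ E ℝ).hasFDerivAt)
  have e1 := this.fderiv
  have : fderiv ℝ (fun p : E × ℝ => a p.1) (x t) = _ := e1
  rw [this]
  rfl

/-- The derivatives of the functions of `z` alone which vanish along `x`. -/
noncomputable def baseDerivs (𝒰 : Ultrafilter T) (x : T → E × ℝ) :
    Submodule ((𝒰 : Filter T).Germ ℝ) (E × ℝ → (𝒰 : Filter T).Germ ℝ) :=
  (Submodule.span ((𝒰 : Filter T).Germ ℝ)
    (germDeriv 𝒰 (fun t => (x t).1) '' vanishingGerms 𝒰 fun t => (x t).1)).map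
      (LinearMap.funLeft ((𝒰 : Filter T).Germ ℝ) ((𝒰 : Filter T).Germ ℝ) Prod.fst)

theorem germDeriv_fiberPoly_mem_baseDerivs (hx : Tendsto x 𝒰 (𝓝 0)) {a : ℕ → E → ℝ} {d : ℕ}
    (ha : ∀ i, AnalyticAt ℝ (a i) 0)
    (ha' : ∀ i < d, a i ∈ vanishingGerms 𝒰 fun t => (x t).1) :
    germDeriv 𝒰 x (fiberPoly a d) ∈ baseDerivs 𝒰 x := by
  induction d with
  | zero =>
    rw [fiberPoly_zero]
    convert (baseDerivs 𝒰 x).zero_mem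
    ext1 e
    exact Germ.coe_eq.2 (Eventually.of_forall fun t => by simp)
  | succ d ih =>
    have had := ha' d (Nat.lt_succ_self d)
    have hm := mem_vanishingGerms_fst had
    rw [fiberPoly_succ, germDeriv_add hx (analyticAt_fiberPoly ha d)
      (show AnalyticAt ℝ (fun p : E × ℝ => a d p.1 * p.2 ^ d) 0 from
        hm.1.mul (analyticAt_snd.pow d))]
    refine Submodule.add_mem _ (ih fun i hi => ha' i (hi.trans (Nat.lt_succ_self d))) ?_
    have : (fun p : E × ℝ => a d p.1 * p.2 ^ d) = fun p => p.2 ^ d * a d p.1 := by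
      ext p; ring
    rw [this, germDeriv_mul_of_vanishing (f := fun p : E × ℝ => p.2 ^ d) hx
      (analyticAt_snd.pow d) hm]
    refine Submodule.smul_mem _ _ ?_
    rw [germDeriv_fst hx had.1]
    exact Submodule.mem_map_of_mem (Submodule.subset_span ⟨_, had, rfl⟩)

/-- Modulo the derivatives of functions of the base variable, the derivatives of the polynomials
vanishing along `x` are multiples of a single one. -/
theorem exists_germDeriv_fiberPoly_mem (hx : Tendsto x 𝒰 (𝓝 0)) :
    ∃ θ : E × ℝ → (𝒰 : Filter T).Germ ℝ, ∀ (a : ℕ → E → ℝ) (d : ℕ),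
      (∀ i, AnalyticAt ℝ (a i) 0) → fiberPoly a d ∈ vanishingGerms 𝒰 x →
      germDeriv 𝒰 x (fiberPoly a d) ∈
        baseDerivs 𝒰 x ⊔ Submodule.span ((𝒰 : Filter T).Germ ℝ) {θ} := by
  classical
  -- `P k` asks for a vanishing polynomial of formal degree `k` whose top coefficient does not
  -- vanish along the curve. The least such `k` is the degree of a minimal polynomial of the last
  -- coordinate over functions of the base.
  set P : ℕ → Prop := fun k => ∃ b : ℕ → E → ℝ, (∀ i, AnalyticAt ℝ (b i) 0) ∧
    fiberPoly b (k + 1) ∈ vanishingGerms 𝒰 x ∧ ¬ ∀ᶠ t in 𝒰, b k (x t).1 = 0 with hP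
  -- Below the minimal degree the top coefficient always vanishes along the curve and can be
  -- dropped; repeating this, all coefficients vanish.
  have low : ∀ (k : ℕ), (∀ j < k, ¬ P j) → ∀ (a : ℕ → E → ℝ) (d : ℕ), d ≤ k →
      (∀ i, AnalyticAt ℝ (a i) 0) → fiberPoly a d ∈ vanishingGerms 𝒰 x →
      ∀ i < d, a i ∈ vanishingGerms 𝒰 fun t => (x t).1 := by
    intro k hk a d
    induction d with
    | zero => intro _ _ _ i hi; exact absurd hi (Nat.not_lt_zero i)
    | succ d ih =>
      intro hd ha hm
      have h1 : ∀ᶠ t in 𝒰, a d (x t).1 = 0 := by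
        by_contra hcon
        exact hk d hd ⟨a, ha, hm, hcon⟩
      have h2 : fiberPoly a d ∈ vanishingGerms 𝒰 x := by
        refine ⟨analyticAt_fiberPoly ha d, ?_⟩
        filter_upwards [h1, hm.2] with t h3 h4
        rw [fiberPoly_succ] at h4
        simpa [h3] using h4
      intro i hi
      rcases Nat.lt_succ_iff_lt_or_eq.1 hi with hi | rfl
      · exact ih (by omega) ha h2 i hi
      · exact ⟨ha _, h1⟩
  by_cases hex : ∃ k, P k
  · obtain ⟨b, hb, hbm, hbk⟩ := Nat.find_spec hex
    set k := Nat.find hex with hk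
    have hmin : ∀ j < k, ¬ P j := fun j hj => Nat.find_min hex hj
    refine ⟨germDeriv 𝒰 x (fiberPoly b (k + 1)), fun a d => ?_⟩
    have hbx : AnalyticAt ℝ (fun p : E × ℝ => b k p.1) 0 :=
      AnalyticAt.fun_comp_of_eq (g := b k) (hb k) analyticAt_fst rfl
    induction d generalizing a with
    | zero =>
      intro ha hm
      exact Submodule.mem_sup_left (germDeriv_fiberPoly_mem_baseDerivs hx ha
        (fun i hi => absurd hi (Nat.not_lt_zero i)))
    | succ N ih =>
      intro ha hm
      by_cases hN : N + 1 ≤ k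
      · exact Submodule.mem_sup_left (germDeriv_fiberPoly_mem_baseDerivs hx ha
          (low k hmin a (N + 1) hN ha hm))
      · have hax : AnalyticAt ℝ (fun p : E × ℝ => -(a N p.1 * p.2 ^ (N - k))) 0 :=
          ((AnalyticAt.fun_comp_of_eq (g := a N) (ha N) analyticAt_fst rfl).mul
            (analyticAt_snd.pow _)).neg
        -- Pseudo-division: multiply by the leading coefficient `b k` and subtract a multiple of the
        -- minimal polynomial to lower the degree.
        set a' : ℕ → E → ℝ := fun i z =>
          b k z * a i z - if N - k ≤ i then a N z * b (i - (N - k)) z else 0 with ha'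
        have ha'A : ∀ i, AnalyticAt ℝ (a' i) 0 := by
          intro i
          by_cases hi : N - k ≤ i
          · simp only [ha', hi, if_true]
            exact ((hb k).mul (ha i)).sub ((ha N).mul (hb _))
          · simp only [ha', hi, if_false]
            exact ((hb k).mul (ha i)).sub analyticAt_const
        have heq : fiberPoly a' N = fun p => b k p.1 * fiberPoly a (N + 1) p +
            -(a N p.1 * p.2 ^ (N - k)) * fiberPoly b (k + 1) p := by
          ext p
          have e1 : fiberPoly a' N p = fiberPoly a' (N + 1) p := by
            rw [fiberPoly_succ]
            have : a' N p.1 = 0 := by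
              simp only [ha', Nat.sub_le, if_true, Nat.sub_sub_self (show k ≤ N by omega)]
              ring
            simp [this]
          have e2 : ∑ i ∈ Finset.range (N + 1),
              (if N - k ≤ i then a N p.1 * b (i - (N - k)) p.1 else 0) * p.2 ^ i =
              a N p.1 * p.2 ^ (N - k) * fiberPoly b (k + 1) p := by
            have : N + 1 = (N - k) + (k + 1) := by omega
            rw [this, Finset.sum_range_add]
            have z : ∑ i ∈ Finset.range (N - k),
                (if N - k ≤ i then a N p.1 * b (i - (N - k)) p.1 else 0) * p.2 ^ i = 0 := by
              refine Finset.sum_eq_zero fun i hi => ?_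
              rw [if_neg (by rw [Finset.mem_range] at hi; omega), zero_mul]
            rw [z, zero_add, fiberPoly, Finset.mul_sum]
            refine Finset.sum_congr rfl fun i _ => ?_
            rw [if_pos (Nat.le_add_right _ _), Nat.add_sub_cancel_left, pow_add]
            ring
          rw [e1, neg_mul, ← e2, ← sub_eq_add_neg, fiberPoly, fiberPoly, Finset.mul_sum,
            ← Finset.sum_sub_distrib]
          refine Finset.sum_congr rfl fun i _ => ?_
          simp only [ha']
          ring
        have hm' : fiberPoly a' N ∈ vanishingGerms 𝒰 x := by
          rw [heq]
          exact vanishingGerms.add_mem (vanishingGerms.mul_mem hbx hm)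
            (vanishingGerms.mul_mem hax hbm)
        have hG := ih a' ha'A hm'
        rw [heq, germDeriv_add hx (vanishingGerms.mul_mem hbx hm).1
          (vanishingGerms.mul_mem hax hbm).1, germDeriv_mul_of_vanishing hx hbx hm,
          germDeriv_mul_of_vanishing hx hax hbm] at hG
        have hθ : germDeriv 𝒰 x (fiberPoly b (k + 1)) ∈ baseDerivs 𝒰 x ⊔
            Submodule.span ((𝒰 : Filter T).Germ ℝ) {germDeriv 𝒰 x (fiberPoly b (k + 1))} :=
          Submodule.mem_sup_right (Submodule.mem_span_singleton_self _)
        have h2 := (Submodule.add_mem_iff_left _ (Submodule.smul_mem _ _ hθ)).1 hG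
        -- Germs along an ultrafilter form a field, so the factor `b k` introduced by
        -- pseudo-division can be removed.
        have hne : ((fun t => b k (x t).1 : T → ℝ) : (𝒰 : Filter T).Germ ℝ) ≠ 0 :=
          fun h => hbk (Germ.coe_eq.1 h)
        exact (Submodule.smul_mem_iff _ hne).1 h2
  · refine ⟨0, fun a d ha hm => Submodule.mem_sup_left ?_⟩
    exact germDeriv_fiberPoly_mem_baseDerivs hx ha
      (low d (fun j _ h => hex ⟨j, h⟩) a d le_rfl ha hm)

end Polynomials

end Elimination

/-! ### Elimination of one variable at a time. -/

section Elimination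

variable {T : Type} {𝒰 : Ultrafilter T}

/-- The germ `H` divides the vanishing germs up to polynomials. -/
theorem exists_germDeriv_mem {E : Type} [NormedAddCommGroup E] [NormedSpace ℝ E]
    [FiniteDimensional ℝ E] {x : T → E × ℝ} (hx : Tendsto x 𝒰 (𝓝 0)) {H : E × ℝ → ℝ}
    (hH : H ∈ vanishingGerms 𝒰 x) (hne : ¬ ∀ᶠ s in 𝓝 (0 : ℝ), H (0, s) = 0) :
    ∃ θ : E × ℝ → (𝒰 : Filter T).Germ ℝ, ∀ h ∈ vanishingGerms 𝒰 x,
      germDeriv 𝒰 x h ∈ baseDerivs 𝒰 x ⊔ Submodule.span ((𝒰 : Filter T).Germ ℝ) {θ} := by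
  -- a monic polynomial among the vanishing germs
  obtain ⟨W, d, a, hW, hWne, ha, hWa⟩ : ∃ (W : E × ℝ → ℝ) (d : ℕ) (a : ℕ → E → ℝ),
      W ∈ vanishingGerms 𝒰 x ∧ (¬ ∀ᶠ s in 𝓝 (0 : ℝ), W (0, s) = 0) ∧
      (∀ i, AnalyticAt ℝ (a i) 0) ∧ W = fiberPoly a d := by
    have hH0 : AnalyticAt ℝ (fun s : ℝ => H (0, s)) 0 :=
      AnalyticAt.fun_comp_of_eq (g := H) hH.1 (analyticAt_const.prod analyticAt_id) rfl
    obtain ⟨d, u, hu, hu0, e⟩ := hH0.exists_eq_pow_mul hne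
    obtain ⟨Q, r, hQ, hr, eQ⟩ := weierstrass_division hH.1
      (h := fun p : E × ℝ => p.2 ^ d) (analyticAt_snd.pow d) hu hu0 e
    set a : ℕ → E → ℝ := fun i => if i = d then fun _ => 1 else fun z => - r i z with ha
    have haA : ∀ i, AnalyticAt ℝ (a i) 0 := by
      intro i
      by_cases hi : i = d
      · simp only [ha, hi, if_true]; exact analyticAt_const
      · simp only [ha, hi, if_false]; exact (hr i).neg
    have heq : ∀ p, fiberPoly a (d + 1) p = p.2 ^ d - ∑ i ∈ Finset.range d, r i p.1 * p.2 ^ i := by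
      intro p
      rw [fiberPoly_succ]
      have : fiberPoly a d p = - ∑ i ∈ Finset.range d, r i p.1 * p.2 ^ i := by
        rw [fiberPoly, ← Finset.sum_neg_distrib]
        refine Finset.sum_congr rfl fun i hi => ?_
        rw [Finset.mem_range] at hi
        simp [ha, hi.ne]
      have had : a d p.1 = 1 := by simp [ha]
      simp only [this, had]
      ring
    refine ⟨_, d + 1, a, ?_, ?_, haA, rfl⟩
    · refine vanishingGerms.congr_mem hx (vanishingGerms.mul_mem hQ hH) ?_
      filter_upwards [eQ] with p hp
      rw [heq, hp]; ring
    -- At the base point `W` restricts to a monic polynomial in `s`, which cannot vanish on an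
    -- interval.
    · intro hcon
      set p : Polynomial ℝ := Polynomial.X ^ d -
        ∑ i ∈ Finset.range d, Polynomial.C (r i 0) * Polynomial.X ^ i with hp
      have hp0 : p ≠ 0 := by
        intro h0
        have h1 := congrArg (fun q => Polynomial.coeff q d) h0
        simp only [hp, Polynomial.coeff_sub, Polynomial.finsetSum_coeff,
          Polynomial.coeff_C_mul_X_pow, Polynomial.coeff_X_pow, if_true,
          Polynomial.coeff_zero] at h1
        rw [Finset.sum_eq_zero] at h1
        · norm_num at h1
        · intro i hi
          rw [Finset.mem_range] at hi
          rw [if_neg hi.ne']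
      refine hp0 (Polynomial.eq_zero_of_infinite_isRoot p ?_)
      obtain ⟨ε, hε, hball⟩ := Metric.eventually_nhds_iff_ball.1 hcon
      refine Set.Infinite.mono (s := Set.Ioo 0 ε) ?_ (Set.Ioo_infinite hε)
      intro s hs
      have h2 := hball s (by
        rw [Metric.mem_ball, dist_zero_right, Real.norm_eq_abs, abs_of_pos hs.1]; exact hs.2)
      rw [heq] at h2
      simpa [Polynomial.IsRoot, hp, Polynomial.eval_finsetSum] using h2
  obtain ⟨θ, hθ⟩ := exists_germDeriv_fiberPoly_mem (𝒰 := 𝒰) hx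
  refine ⟨θ, fun h hh => ?_⟩
  have hW0 : AnalyticAt ℝ (fun s : ℝ => W (0, s)) 0 :=
    AnalyticAt.fun_comp_of_eq (g := W) hW.1 (analyticAt_const.prod analyticAt_id) rfl
  obtain ⟨k, u, hu, hu0, e⟩ := hW0.exists_eq_pow_mul hWne
  obtain ⟨Q, r, hQ, hr, eQ⟩ := weierstrass_division hW.1 hh.1 hu hu0 e
  have hr' : fiberPoly r k ∈ vanishingGerms 𝒰 x := by
    refine vanishingGerms.congr_mem hx (vanishingGerms.add_mem hh
      (vanishingGerms.mul_mem hQ.neg hW)) ?_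
    filter_upwards [eQ] with p hp
    rw [hp, fiberPoly]
    simp
  have hQW := vanishingGerms.mul_mem hQ hW
  -- Division is by the polynomial `W` rather than by `H`: the differentials of both `W` and the
  -- remainder are then controlled by the same `θ`.
  have e1 : germDeriv 𝒰 x h = germDeriv 𝒰 x fun p => Q p * W p + fiberPoly r k p :=
    germDeriv_congr hx eQ
  rw [e1, germDeriv_add hx hQW.1 hr'.1, germDeriv_mul_of_vanishing hx hQ hW]
  refine Submodule.add_mem _ (Submodule.smul_mem _ _ ?_) (hθ r k hr hr')
  rw [hWa]
  exact hθ a d ha (hWa ▸ hW)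

/-- There are `n` vanishing germs with independent derivatives. -/
def HasVanishingRank {E : Type} [NormedAddCommGroup E] [NormedSpace ℝ E] (𝒰 : Ultrafilter T)
    (x : T → E) (n : ℕ) : Prop :=
  ∃ h : Fin n → E → ℝ, (∀ i, h i ∈ vanishingGerms 𝒰 x) ∧
    LinearIndependent ((𝒰 : Filter T).Germ ℝ) fun i => germDeriv 𝒰 x (h i)

/-- Modulo differentials of functions of the base, the differentials of vanishing germs span at most
a line. Eliminating the last variable therefore loses at most one equation. -/
theorem HasVanishingRank.fst {E : Type} [NormedAddCommGroup E] [NormedSpace ℝ E]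
    [FiniteDimensional ℝ E] {x : T → E × ℝ} (hx : Tendsto x 𝒰 (𝓝 0)) {H : E × ℝ → ℝ}
    (hH : H ∈ vanishingGerms 𝒰 x) (hne : ¬ ∀ᶠ s in 𝓝 (0 : ℝ), H (0, s) = 0) {n : ℕ}
    (hr : HasVanishingRank 𝒰 x (n + 1)) : HasVanishingRank 𝒰 (fun t => (x t).1) n := by
  let K := (𝒰 : Filter T).Germ ℝ
  obtain ⟨θ, hθ⟩ := exists_germDeriv_mem hx hH hne
  obtain ⟨h, hh, hli⟩ := hr
  set S := germDeriv 𝒰 (fun t => (x t).1) '' vanishingGerms 𝒰 fun t => (x t).1 with hS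
  have h1 : ((n + 1 : ℕ) : Cardinal) ≤ Module.rank K (Submodule.span K S) + 1 := by
    have e1 : ((n + 1 : ℕ) : Cardinal) =
        Module.rank K (Submodule.span K (range fun i => germDeriv 𝒰 x (h i))) := by
      rw [rank_span hli, Cardinal.mk_range_eq _ hli.injective, Cardinal.mk_fin]
    rw [e1]
    refine (Submodule.rank_mono (t := baseDerivs 𝒰 x ⊔ Submodule.span K {θ}) ?_).trans ?_
    · rw [Submodule.span_le]
      rintro _ ⟨i, rfl⟩
      exact hθ _ (hh i)
    · refine (Submodule.rank_add_le_rank_add_rank _ _).trans ?_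
      refine add_le_add (rank_map_le _ _) ((rank_span_le _).trans ?_)
      rw [Cardinal.mk_singleton]
  have h2 : (n : Cardinal) ≤ Module.rank K (Submodule.span K S) := by
    rw [Nat.cast_add, Nat.cast_one] at h1
    exact (Cardinal.add_le_add_iff_of_lt_aleph0 Cardinal.one_lt_aleph0).1 h1
  obtain ⟨b, hbS, hbspan, hbli⟩ := exists_linearIndependent K S
  rw [← hbspan, rank_span_set hbli, ← Cardinal.mk_fin, Cardinal.le_def] at h2
  obtain ⟨f⟩ := h2
  choose g hg hgb using fun i => hbS (f i).2
  refine ⟨g, hg, ?_⟩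
  simp only [hgb]
  exact hbli.comp f f.injective

theorem HasVanishingRank.equiv {E E' : Type} [NormedAddCommGroup E] [NormedSpace ℝ E]
    [NormedAddCommGroup E'] [NormedSpace ℝ E'] {x : T → E} (Φ : E ≃L[ℝ] E') {n : ℕ}
    (hr : HasVanishingRank 𝒰 x n) : HasVanishingRank 𝒰 (fun t => Φ (x t)) n := by
  obtain ⟨h, hh, hli⟩ := hr
  refine ⟨fun i y => h i (Φ.symm y), fun i => ⟨?_, ?_⟩, ?_⟩
  · exact AnalyticAt.fun_comp_of_eq (g := h i) (hh i).1
      ((Φ.symm : E' →L[ℝ] E).analyticAt 0) (by simp)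
  · filter_upwards [(hh i).2] with t ht
    simpa using ht
  · have e1 : (fun i => germDeriv 𝒰 (fun t => Φ (x t)) fun y => h i (Φ.symm y)) = fun i =>
        LinearMap.funLeft ((𝒰 : Filter T).Germ ℝ) ((𝒰 : Filter T).Germ ℝ) Φ.symm
          (germDeriv 𝒰 x (h i)) := by
      ext i e
      refine Germ.coe_eq.2 (Eventually.of_forall fun t => ?_)
      have h2 : fderiv ℝ (fun y => h i (Φ.symm y)) (Φ (x t)) =
          (fderiv ℝ (h i) (Φ.symm (Φ (x t)))).comp (Φ.symm : E' →L[ℝ] E) :=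
        Φ.symm.comp_right_fderiv
      simp [h2]
    rw [e1]
    refine hli.map' _ (LinearMap.ker_eq_bot.2 ?_)
    exact LinearMap.funLeft_injective_of_surjective _ _ _ Φ.symm.surjective

/-- If `H` vanished near `0` on every line other than the one through `e₀`, it would vanish on the
part of a ball off that line, and by continuity on the whole ball. -/
theorem exists_transversal_line {E : Type} [NormedAddCommGroup E] [NormedSpace ℝ E]
    {H : E → ℝ} (hH : AnalyticAt ℝ H 0) (hne : ¬ ∀ᶠ y in 𝓝 (0 : E), H y = 0) {e₀ v₀ : E}
    (hv₀ : v₀ ∉ Submodule.span ℝ {e₀}) :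
    ∃ v, v ∉ Submodule.span ℝ {e₀} ∧ ¬ ∀ᶠ s in 𝓝 (0 : ℝ), H (s • v) = 0 := by
  by_contra! hcon
  apply hne
  obtain ⟨ε, hε, hball⟩ := Metric.eventually_nhds_iff_ball.1 hH.eventually_analyticAt
  have h1 : ∀ v, ‖v‖ < ε → v ∉ Submodule.span ℝ {e₀} → H v = 0 := by
    intro v hv hve
    have key : EqOn (fun s : ℝ => H (s • v)) 0 (Set.Icc 0 1) := by
      refine AnalyticOnNhd.eqOn_zero_of_preconnected_of_eventuallyEq_zero (𝕜 := ℝ) (z₀ := (0 : ℝ))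
        ?_ isPreconnected_Icc (by simp) (hcon v hve)
      intro s hs
      have : AnalyticAt ℝ H (s • v) := hball _ (by
        rw [Metric.mem_ball, dist_zero_right, norm_smul, Real.norm_eq_abs, abs_of_nonneg hs.1]
        nlinarith [norm_nonneg v, hs.2])
      exact AnalyticAt.fun_comp (g := H) this (f := fun s : ℝ => s • v)
        (analyticAt_id.smul analyticAt_const)
    have := key (show (1 : ℝ) ∈ Set.Icc (0 : ℝ) 1 by simp)
    simpa using this
  filter_upwards [Metric.ball_mem_nhds (0 : E) hε] with w hw
  by_cases hwe : w ∈ Submodule.span ℝ {e₀}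
  · have c1 : Tendsto (fun s : ℝ => w + s • v₀) (𝓝[≠] 0) (𝓝 w) := by
      have : Continuous fun s : ℝ => w + s • v₀ := by fun_prop
      simpa using (this.tendsto 0).mono_left nhdsWithin_le_nhds
    have c2 : Tendsto (fun s : ℝ => H (w + s • v₀)) (𝓝[≠] 0) (𝓝 (H w)) :=
      (hball w hw).continuousAt.tendsto.comp c1
    have c3 : ∀ᶠ s in 𝓝[≠] (0 : ℝ), H (w + s • v₀) = 0 := by
      filter_upwards [c1.eventually (Metric.isOpen_ball.mem_nhds hw), self_mem_nhdsWithin]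
        with s h2 h3
      refine h1 _ (by simpa using h2) fun hmem => hv₀ ?_
      have h4 := (Submodule.add_mem_iff_right _ hwe).1 hmem
      exact (Submodule.smul_mem_iff _ h3).1 h4
    exact tendsto_nhds_unique (c2.congr' c3) tendsto_const_nhds
  · exact h1 w (by simpa using hw) hwe

theorem FlatAlong.of_sq_le {E : Type*} [Norm E] {τ τ' : T → ℝ} {y : T → E}
    (hy : FlatAlong 𝒰 τ y) (h : ∀ᶠ t in 𝒰, |τ t| ^ 2 ≤ |τ' t|) : FlatAlong 𝒰 τ' y := by
  intro n
  filter_upwards [hy (2 * n), h] with t h1 h2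
  refine h1.trans ?_
  rw [pow_mul]
  gcongr

/-- The elimination theorem: a curve `τ e₀ + y` with `y` flat with respect to `τ`, which satisfies
sufficiently many independent analytic equations, lies on the line spanned by `e₀`. -/
theorem eventually_mem_span_of_hasVanishingRank (n : ℕ) :
    ∀ (E : Type) [NormedAddCommGroup E] [NormedSpace ℝ E] [FiniteDimensional ℝ E],
      Module.finrank ℝ E = n + 1 → ∀ (e₀ : E) (τ : T → ℝ) (y : T → E), e₀ ≠ 0 →
      Tendsto τ 𝒰 (𝓝 0) → (∀ᶠ t in 𝒰, τ t ≠ 0) → FlatAlong 𝒰 τ y →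
      HasVanishingRank 𝒰 (fun t => τ t • e₀ + y t) n →
      ∀ᶠ t in 𝒰, y t ∈ Submodule.span ℝ {e₀} := by
  induction n with
  | zero =>
    intro E _ _ _ hE e₀ τ y he₀ _ _ _ _
    refine Eventually.of_forall fun t => ?_
    obtain ⟨c, hc⟩ := (finrank_eq_one_iff_of_nonzero' e₀ he₀).1 hE (y t)
    exact Submodule.mem_span_singleton.2 ⟨c, hc⟩
  | succ n ih =>
    intro E _ _ _ hE e₀ τ y he₀ hτ hτ0 hy hrank
    have hx : Tendsto (fun t => τ t • e₀ + y t) 𝒰 (𝓝 0) := by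
      simpa using (hτ.smul_const e₀).add (hy.tendsto hτ)
    obtain ⟨H, hH, hHne⟩ : ∃ H ∈ vanishingGerms 𝒰 (fun t => τ t • e₀ + y t),
        ¬ ∀ᶠ y in 𝓝 (0 : E), H y = 0 := by
      obtain ⟨h, hh, hli⟩ := hrank
      refine ⟨h 0, hh 0, fun hcon => hli.ne_zero 0 ?_⟩
      rw [germDeriv_congr hx (g := fun _ => 0) hcon]
      ext1 e
      exact Germ.coe_eq.2 (Eventually.of_forall fun t => by simp)
    obtain ⟨v₀, hv₀⟩ : ∃ v₀, v₀ ∉ Submodule.span ℝ {e₀} := by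
      by_contra! hcon
      have : Module.finrank ℝ E ≤ 1 := finrank_le_one e₀ fun w =>
        Submodule.mem_span_singleton.1 (hcon w)
      omega
    -- The variable to eliminate is the one along `v`: `H` is nontrivial on this axis, and `e₀`
    -- survives the projection along it.
    obtain ⟨v, hv, hHv⟩ := exists_transversal_line hH.1 hHne hv₀
    have hv0 : v ≠ 0 := fun h => hv (h ▸ Submodule.zero_mem _)
    let E' := Fin (n + 1) → ℝ
    obtain ⟨Φ, hΦ⟩ : ∃ Φ : E ≃L[ℝ] E' × ℝ, Φ v = (0, 1) := by
      have e1 : E ≃L[ℝ] E' × ℝ := ContinuousLinearEquiv.ofFinrankEq (by simp [E', hE])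
      obtain ⟨A, hA⟩ := SeparatingDual.exists_continuousLinearEquiv_apply_eq (R := ℝ)
        (x := e1 v) (y := ((0, 1) : E' × ℝ)) (by simpa using hv0) (by simp)
      exact ⟨e1.trans A, hA⟩
    set x' : T → E' × ℝ := fun t => Φ (τ t • e₀ + y t) with hx'
    have hx't : Tendsto x' 𝒰 (𝓝 0) := by
      have := (Φ.continuous.tendsto 0).comp hx
      rwa [map_zero] at this
    have hH' : (fun p => H (Φ.symm p)) ∈ vanishingGerms 𝒰 x' := by
      refine ⟨AnalyticAt.fun_comp_of_eq (g := H) hH.1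
        ((Φ.symm : E' × ℝ →L[ℝ] E).analyticAt 0) (by simp), ?_⟩
      filter_upwards [hH.2] with t ht
      simpa [hx'] using ht
    have hΦs : ∀ s : ℝ, Φ.symm ((0, s) : E' × ℝ) = s • v := by
      intro s
      rw [Φ.symm_apply_eq, map_smul, hΦ]
      simp
    have hrank' := HasVanishingRank.fst hx't hH' (by simpa only [hΦs] using hHv) (hrank.equiv Φ)
    set π : E →L[ℝ] E' := (ContinuousLinearMap.fst ℝ E' ℝ) ∘L (Φ : E →L[ℝ] E' × ℝ) with hπ
    have hπe : π e₀ ≠ 0 := by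
      intro h0
      apply hv
      have h1 : Φ e₀ = (0, (Φ e₀).2) := Prod.ext h0 rfl
      have h2 : e₀ = (Φ e₀).2 • v := by rw [← hΦs, ← h1, Φ.symm_apply_apply]
      have h3 : (Φ e₀).2 ≠ 0 := fun h => he₀ (by rw [h2, h, zero_smul])
      refine Submodule.mem_span_singleton.2 ⟨((Φ e₀).2)⁻¹, ?_⟩
      nth_rewrite 2 [h2]
      rw [smul_smul, inv_mul_cancel₀ h3, one_smul]
    have hπy := hy.clm hτ π
    have hind := ih E' (by simp [E']) (π e₀) τ (fun t => π (y t)) hπe hτ hτ0 hπy (by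
      convert hrank' using 2 with t
      simp [hx', hπ])
    obtain ⟨g, hg⟩ := SeparatingDual.exists_eq_one (R := ℝ) hπe
    -- By induction the projected `y` lies on the line of `π e₀`, so `y = C y • e₀ + L y • v`. It
    -- remains to kill the coefficient `L y`.
    set C : E →L[ℝ] ℝ := g ∘L π with hC
    set L : E →L[ℝ] ℝ := (ContinuousLinearMap.snd ℝ E' ℝ) ∘L (Φ : E →L[ℝ] E' × ℝ) -
      (Φ e₀).2 • C with hL
    have hCf := hy.clm hτ C
    have hLf := hy.clm hτ L
    have hdec : ∀ᶠ t in 𝒰, y t = C (y t) • e₀ + L (y t) • v := by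
      filter_upwards [hind] with t ht
      obtain ⟨c, hc⟩ := Submodule.mem_span_singleton.1 ht
      have h1 : C (y t) = c := by
        simp only [hC, ContinuousLinearMap.comp_apply, ← hc, map_smul, hg, smul_eq_mul, mul_one]
      apply Φ.injective
      rw [map_add, map_smul, map_smul, hΦ, h1]
      refine Prod.ext ?_ ?_
      · simpa [hπ] using hc.symm
      · simp [hL, h1]; ring
    have hcsmall : ∀ᶠ t in 𝒰, |C (y t)| ≤ |τ t| ^ 2 := hCf 2
    have hτsmall : ∀ᶠ t in 𝒰, |τ t| < 1 / 2 := by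
      have := hτ.abs
      rw [abs_zero] at this
      exact this.eventually (gt_mem_nhds (by norm_num))
    -- The curve now lies in the plane of `e₀` and `v`, with coordinates `τ'` and `L y`. Since `|C
    -- y| ≤ |τ| ^ 2` and `|τ| < 1 / 2`, one has `|τ| ^ 2 ≤ |τ'|`, so flatness in `τ` implies
    -- flatness in `τ'` and the case of one equation applies.
    set τ' : T → ℝ := fun t => τ t + C (y t) with hτ'
    have hle : ∀ᶠ t in 𝒰, |τ t| ^ 2 ≤ |τ' t| := by
      filter_upwards [hcsmall, hτsmall] with t h1 h2
      have h3 : |τ t| ≤ |τ' t| + |C (y t)| := by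
        have := abs_sub (τ' t) (C (y t))
        simpa [hτ'] using this
      nlinarith [abs_nonneg (τ t)]
    have hτ't : Tendsto τ' 𝒰 (𝓝 0) := by
      simpa using hτ.add (hCf.tendsto hτ)
    have hτ'0 : ∀ᶠ t in 𝒰, τ' t ≠ 0 := by
      filter_upwards [hle, hτ0] with t h1 h2 h3
      rw [h3, abs_zero] at h1
      have : 0 < |τ t| ^ 2 := by positivity
      linarith
    have hfin := eventually_eq_zero_of_flat_solution hτ't hτ'0
      (s := fun t => L (y t)) (by simpa [FlatAlong] using hLf.of_sq_le hle)
      (h := fun p : ℝ × ℝ => H (p.1 • e₀ + p.2 • v))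
      (AnalyticAt.fun_comp_of_eq (g := H) hH.1 ((analyticAt_fst.smul analyticAt_const).add
        (analyticAt_snd.smul analyticAt_const)) (by simp))
      (by simpa using hHv) (by
        filter_upwards [hdec, hH.2] with t h1 h2
        simp only [hτ']
        rw [h1] at h2
        rw [← h2, add_smul, add_assoc])
    filter_upwards [hdec, hfin] with t h1 h2
    rw [h1, h2, zero_smul, add_zero]
    exact Submodule.smul_mem _ _ (Submodule.mem_span_singleton_self _)

end Elimination

/-! ### Polarization and norm bounds for symmetrized multilinear maps. -/

section Polarization

open scoped Nat

variable {X F : Type*} [NormedAddCommGroup X] [NormedSpace ℝ X]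
  [NormedAddCommGroup F] [NormedSpace ℝ F]

/-- The polarization formula, with an arbitrary base point. -/
theorem MultilinearMap.polarization {n : ℕ} (B : MultilinearMap ℝ (fun _ : Fin n => X) F) (x : X)
    (v : Fin n → X) :
    ∑ S : Finset (Fin n), (-1 : ℝ) ^ Sᶜ.card • B (fun _ => x + ∑ i ∈ S, v i) =
      ∑ σ : Equiv.Perm (Fin n), B (fun i => v (σ i)) := by
  classical
  -- The base point is treated as one more vector, indexed by `none`, that belongs to every partial
  -- sum.
  set u : Option (Fin n) → X := fun a => a.elim x v with hu
  set c : Finset (Fin n) → Option (Fin n) → ℝ := fun S a =>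
    a.elim 1 fun i => if i ∈ S then 1 else 0 with hc
  have h1 : ∀ S : Finset (Fin n), B (fun _ => x + ∑ i ∈ S, v i) =
      ∑ f : Fin n → Option (Fin n), (∏ j, c S (f j)) • B (fun j => u (f j)) := by
    intro S
    have e : x + ∑ i ∈ S, v i = ∑ a : Option (Fin n), c S a • u a := by
      rw [Fintype.sum_option]
      simp [hc, hu, Finset.sum_ite_mem]
    rw [e]
    have := B.map_sum (fun (_ : Fin n) (a : Option (Fin n)) => c S a • u a)
    refine this.trans (Finset.sum_congr rfl fun f _ => ?_)
    exact B.map_smul_univ (fun j => c S (f j)) (fun j => u (f j))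
  simp_rw [h1, Finset.smul_sum]
  rw [Finset.sum_comm]
  simp_rw [smul_smul, ← Finset.sum_smul]
  -- the coefficient of `f`
  have h2 : ∀ f : Fin n → Option (Fin n), (∃ i, ∀ j, f j ≠ some i) →
      ∑ S : Finset (Fin n), (-1 : ℝ) ^ Sᶜ.card * ∏ j, c S (f j) = 0 := by
    rintro f ⟨i, hi⟩
    have hprod : ∀ S : Finset (Fin n), ∏ j, c (insert i S) (f j) = ∏ j, c (S.erase i) (f j) := by
      intro S
      refine Finset.prod_congr rfl fun j _ => ?_
      rcases hj : f j with _ | k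
      · rfl
      · have : k ≠ i := fun h => hi j (by rw [hj, h])
        simp [hc, this]
    -- Toggling the missing index `i` in `S` changes the sign and nothing else.
    refine Finset.sum_involution (fun S _ => if i ∈ S then S.erase i else insert i S) ?_ ?_ ?_ ?_
    · intro S _
      by_cases hS : i ∈ S
      · simp only [hS, if_true]
        have e1 : (S.erase i)ᶜ.card = Sᶜ.card + 1 := by
          rw [Finset.compl_erase, Finset.card_insert_of_notMem (by simpa using hS)]
        have e2 := hprod S
        rw [Finset.insert_eq_of_mem hS] at e2
        rw [e1, e2, pow_succ]; ring
      · simp only [hS, if_false]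
        have e1 : Sᶜ.card = (insert i S)ᶜ.card + 1 := by
          rw [Finset.compl_insert, Finset.card_erase_add_one (by simpa using hS)]
        have e2 := hprod S
        rw [Finset.erase_eq_of_notMem hS] at e2
        rw [e1, e2, pow_succ]; ring
    · intro S _ _
      by_cases hS : i ∈ S
      · simp only [hS, if_true]
        intro h
        have := Finset.notMem_erase i S
        rw [h] at this
        exact this hS
      · simp only [hS, if_false]
        intro h
        have := Finset.mem_insert_self i S
        rw [h] at this
        exact hS this
    · intro S _; exact Finset.mem_univ _
    · intro S _
      by_cases hS : i ∈ S
      · simp [hS]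
      · simp [hS]
  have h3 : ∀ σ : Equiv.Perm (Fin n),
      ∑ S : Finset (Fin n), (-1 : ℝ) ^ Sᶜ.card * ∏ j, c S (some (σ j)) = 1 := by
    intro σ
    rw [Finset.sum_eq_single Finset.univ]
    · simp [hc]
    · intro S _ hS
      obtain ⟨i, hi⟩ : ∃ i, i ∉ S := by
        by_contra! h
        exact hS (Finset.eq_univ_iff_forall.2 h)
      have : ∏ j, c S (some (σ j)) = 0 :=
        Finset.prod_eq_zero (Finset.mem_univ (σ.symm i)) (by simp [hc, hi])
      rw [this, mul_zero]
    · intro h; exact absurd (Finset.mem_univ _) h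
  symm
  -- The tuples that miss no index fill their `n` slots with all `n` indices, so they are exactly
  -- the permutations.
  refine Finset.sum_of_injOn (fun (σ : Equiv.Perm (Fin n)) j => some (σ j)) ?_ ?_ ?_ ?_
  · intro σ _ τ _ h
    refine Equiv.ext fun j => ?_
    have := congrFun h j
    simpa using this
  · intro σ _; exact Finset.mem_coe.2 (Finset.mem_univ _)
  · intro f _ hf
    by_cases hex : ∃ i, ∀ j, f j ≠ some i
    · rw [h2 f hex, zero_smul]
    · push Not at hex
      choose e he using hex
      exfalso
      apply hf
      have hinj : Function.Injective e := fun a b hab => by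
        have := he a
        rw [hab, he b] at this
        exact (Option.some.inj this).symm
      set ε := Equiv.ofBijective e (Finite.injective_iff_bijective.1 hinj) with hε
      refine ⟨ε.symm, by simp, ?_⟩
      ext1 j
      have := he (ε.symm j)
      have e1 : e (ε.symm j) = j := ε.apply_symm_apply j
      rw [e1] at this
      exact this.symm
  · intro σ _
    rw [h3 σ, one_smul]
    rfl

/-- The sum of all permutations of a multilinear map. -/
noncomputable def ContinuousMultilinearMap.symmSum {n : ℕ}
    (B : ContinuousMultilinearMap ℝ (fun _ : Fin n => X) F) :
    ContinuousMultilinearMap ℝ (fun _ : Fin n => X) F :=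
  ∑ σ : Equiv.Perm (Fin n), B.domDomCongr σ

theorem ContinuousMultilinearMap.symmSum_apply {n : ℕ}
    (B : ContinuousMultilinearMap ℝ (fun _ : Fin n => X) F) (v : Fin n → X) :
    B.symmSum v = ∑ σ : Equiv.Perm (Fin n), B (fun i => v (σ i)) := by
  rw [symmSum, _root_.sum_apply]; rfl

theorem ContinuousMultilinearMap.symmSum_diag {n : ℕ}
    (B : ContinuousMultilinearMap ℝ (fun _ : Fin n => X) F) (x : X) :
    B.symmSum (fun _ => x) = (n ! : ℝ) • B (fun _ => x) := by
  rw [symmSum_apply, Finset.sum_const, Finset.card_univ, Fintype.card_perm, Fintype.card_fin,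
    Nat.cast_smul_eq_nsmul]

/-- Rescale every argument to length at most `ρ / n`, so that all points `x + ∑ i ∈ S, u i` stay in
the ball where `B` is bounded. The polarization sum has `2 ^ n` terms, undoing the rescaling costs
`(n / ρ) ^ n`, and `n ^ n / n ! ≤ e ^ n`. -/
theorem ContinuousMultilinearMap.norm_symmSum_le {n : ℕ}
    (B : ContinuousMultilinearMap ℝ (fun _ : Fin n => X) F) {x : X} {ρ K : ℝ} (hρ : 0 < ρ)
    (hK0 : 0 ≤ K) (hB : ∀ y, ‖y - x‖ ≤ ρ → ‖B (fun _ => y)‖ ≤ K) :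
    ‖(n ! : ℝ)⁻¹ • B.symmSum‖ ≤ K * (2 * Real.exp 1 / ρ) ^ n := by
  refine ContinuousMultilinearMap.opNorm_le_bound (by positivity) fun v => ?_
  set u : Fin n → X := fun i => (ρ / n * ‖v i‖⁻¹) • v i with hu
  have hu1 : ∀ i, ‖u i‖ ≤ ρ / n := by
    intro i
    rw [hu, norm_smul, Real.norm_eq_abs, abs_of_nonneg (by positivity), mul_assoc]
    by_cases h : v i = 0
    · simp [h]; positivity
    · rw [inv_mul_cancel₀ (norm_ne_zero_iff.2 h), mul_one]
  have hn : ∀ i : Fin n, (n : ℝ) ≠ 0 := fun i => Nat.cast_ne_zero.2 (by have := i.2; omega)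
  have huv : v = fun i => (n / ρ * ‖v i‖) • u i := by
    ext1 i
    simp only [hu]
    by_cases h : v i = 0
    · simp [h]
    · have h1 := norm_ne_zero_iff.2 h
      rw [smul_smul]
      have := hn i
      have e : (n / ρ * ‖v i‖) * (ρ / n * ‖v i‖⁻¹) = 1 := by field_simp
      rw [e, one_smul]
  have h1 : ‖B.symmSum u‖ ≤ 2 ^ n * K := by
    rw [symmSum_apply]
    have := B.toMultilinearMap.polarization x u
    simp only [ContinuousMultilinearMap.coe_coe] at this
    rw [← this]
    refine (norm_sum_le _ _).trans ?_
    have : ∀ S : Finset (Fin n), ‖(-1 : ℝ) ^ Sᶜ.card • B (fun _ => x + ∑ i ∈ S, u i)‖ ≤ K := by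
      intro S
      rw [norm_smul, norm_pow, norm_neg, norm_one, one_pow, one_mul]
      apply hB
      rw [add_sub_cancel_left]
      refine (norm_sum_le _ _).trans ?_
      refine (Finset.sum_le_sum fun i _ => hu1 i).trans ?_
      rw [Finset.sum_const, nsmul_eq_mul]
      have h2 : (S.card : ℝ) ≤ n := by exact_mod_cast card_finset_fin_le S
      by_cases h0 : (n : ℝ) = 0
      · rw [h0] at h2 ⊢; simp; exact hρ.le
      · calc (S.card : ℝ) * (ρ / n) ≤ n * (ρ / n) := by gcongr
          _ = ρ := by field_simp
    refine (Finset.sum_le_sum fun S _ => this S).trans ?_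
    simp
  have h2 : B.symmSum v = (∏ i, (n / ρ * ‖v i‖)) • B.symmSum u := by
    conv_lhs => rw [huv]
    exact B.symmSum.toMultilinearMap.map_smul_univ _ _
  have h3 : ((n : ℝ) ^ n) / n ! ≤ Real.exp 1 ^ n := by
    rw [← Real.exp_nat_mul, mul_one]
    exact Real.pow_div_factorial_le_exp _ n.cast_nonneg n
  rw [_root_.smul_apply, norm_smul, h2, norm_smul, Finset.prod_mul_distrib, Finset.prod_const,
    Finset.card_univ, Fintype.card_fin]
  have h4 : 0 ≤ ∏ i, ‖v i‖ := Finset.prod_nonneg fun i _ => norm_nonneg _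
  rw [Real.norm_eq_abs, Real.norm_eq_abs, abs_of_nonneg (by positivity),
    abs_of_nonneg (by positivity)]
  calc (n ! : ℝ)⁻¹ * ((n / ρ) ^ n * (∏ i, ‖v i‖) * ‖B.symmSum u‖)
      ≤ (n ! : ℝ)⁻¹ * ((n / ρ) ^ n * (∏ i, ‖v i‖) * (2 ^ n * K)) := by gcongr
    _ = ((n : ℝ) ^ n / n !) * (K * (2 / ρ) ^ n * ∏ i, ‖v i‖) := by
      rw [div_pow, div_pow]; ring
    _ ≤ Real.exp 1 ^ n * (K * (2 / ρ) ^ n * ∏ i, ‖v i‖) := by gcongr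
    _ = _ := by rw [div_pow, div_pow, mul_pow]; ring

end Polarization

/-! ### Taylor series, geometric bounds and analyticity. -/

section TaylorSeries

open scoped Nat

variable {X F : Type*} [NormedAddCommGroup X] [NormedSpace ℝ X]
  [NormedAddCommGroup F] [NormedSpace ℝ F]

/-- The (symmetrized) Taylor series of `f` at `q`. -/
noncomputable def taylorSeries (f : X → F) (q : X) : FormalMultilinearSeries ℝ X F := fun n =>
  -- The inner factorial is that of Taylor's formula; the outer one averages over permutations.
  (n ! : ℝ)⁻¹ • ContinuousMultilinearMap.symmSum ((n ! : ℝ)⁻¹ • iteratedFDeriv ℝ n f q)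

theorem taylorSeries_diag (f : X → F) (q : X) (n : ℕ) (y : X) :
    taylorSeries f q n (fun _ => y) = (n ! : ℝ)⁻¹ • iteratedFDeriv ℝ n f q (fun _ => y) := by
  rw [taylorSeries, _root_.smul_apply, ContinuousMultilinearMap.symmSum_diag, smul_smul,
    inv_mul_cancel₀ (by positivity), one_smul]
  rfl

/-- The ball of directions `y` may be centred away from the origin: this is how an open set of rays
controls a whole Taylor coefficient. -/
theorem norm_taylorSeries_le {f : X → F} {q x : X} {n : ℕ} {ρ K : ℝ} (hρ : 0 < ρ) (hK : 0 ≤ K)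
    (h : ∀ y, ‖y - x‖ ≤ ρ → ‖iteratedFDeriv ℝ n f q (fun _ => y)‖ ≤ n ! * K) :
    ‖taylorSeries f q n‖ ≤ K * (2 * Real.exp 1 / ρ) ^ n := by
  refine ContinuousMultilinearMap.norm_symmSum_le (x := x) _ hρ hK fun y hy => ?_
  rw [_root_.smul_apply, norm_smul, norm_inv, Real.norm_natCast, inv_mul_le_iff₀ (by positivity)]
  exact h y hy

/-- Bounds of analytic type for the Taylor coefficients of `f` at `x`. -/
def TaylorBound (f : X → F) (x : X) (A M : ℝ) : Prop :=
  ∀ n y, ‖iteratedFDeriv ℝ n f x (fun _ => y)‖ ≤ n ! * (A * M ^ n) * ‖y‖ ^ n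

theorem TaylorBound.norm_taylorSeries_le {f : X → F} {x : X} {A M : ℝ} (hA : 0 ≤ A) (hM : 0 ≤ M)
    (h : TaylorBound f x A M) (n : ℕ) :
    ‖taylorSeries f x n‖ ≤ A * (2 * Real.exp 1 * M) ^ n := by
  have := _root_.norm_taylorSeries_le (f := f) (q := x) (x := 0) (n := n) (K := A * M ^ n)
    one_pos (by positivity) (fun y hy => by
      rw [sub_zero] at hy
      refine (h n y).trans ?_
      refine mul_le_of_le_one_right (by positivity) ?_
      exact pow_le_one₀ (norm_nonneg _) hy)
  refine this.trans_eq ?_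
  rw [div_one, mul_pow (2 * Real.exp 1)]; ring

theorem FormalMultilinearSeries.le_radius_of_norm_le {p : FormalMultilinearSeries ℝ X F}
    {A M : ℝ} (hM : 0 < M) (h : ∀ n, ‖p n‖ ≤ A * M ^ n) :
    ENNReal.ofReal M⁻¹ ≤ p.radius := by
  refine p.le_radius_of_bound A fun n => ?_
  rw [Real.coe_toNNReal _ (by positivity), inv_pow]
  calc ‖p n‖ * (M ^ n)⁻¹ ≤ A * M ^ n * (M ^ n)⁻¹ := by gcongr; exact h n
    _ = A := by field_simp

theorem HasFPowerSeriesOnBall.taylorBound [CompleteSpace F] {f : X → F}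
    {p : FormalMultilinearSeries ℝ X F} {x : X} {r : ENNReal} (hp : HasFPowerSeriesOnBall f p x r)
    {A M : ℝ} (h : ∀ n, ‖p n‖ ≤ A * M ^ n) : TaylorBound f x A M := by
  intro n y
  rw [← hp.factorial_smul y n, ← Nat.cast_smul_eq_nsmul ℝ, norm_smul, Real.norm_natCast, mul_assoc]
  gcongr
  refine ((p n).le_opNorm _).trans ?_
  rw [Finset.prod_const, Finset.card_univ, Fintype.card_fin]
  gcongr
  exact h n

/-- Bounds for a power series around its center give bounds for its expansions around nearby
points. -/
theorem HasFPowerSeriesOnBall.taylorBound_of_mem [CompleteSpace F] {f : X → F}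
    {p : FormalMultilinearSeries ℝ X F} {x : X} {A M : ℝ} (hM : 0 < M) (h : ∀ n, ‖p n‖ ≤ A * M ^ n)
    {r : ENNReal} (hp : HasFPowerSeriesOnBall f p x r) {y : X}
    (hy : ‖y‖ ≤ (4 * M)⁻¹) (hyr : (‖y‖₊ : ENNReal) < r) :
    TaylorBound f (x + y) (2 * A) (4 * M) := by
  have hA : 0 ≤ A := by simpa using (norm_nonneg _).trans (h 0)
  refine (hp.changeOrigin hyr).taylorBound fun k => ?_
  -- With this radius `M * (s + s) = 1 / 2`, so the double series of the re-expansion is bounded by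
  -- `A * ∑ (1 / 2) ^ n = 2 * A`.
  set s : NNReal := (4 * M)⁻¹.toNNReal with hs
  have hs' : (s : ℝ) = (4 * M)⁻¹ := Real.coe_toNNReal _ (by positivity)
  have hrad : ((s + s : NNReal) : ENNReal) < p.radius := by
    refine lt_of_lt_of_le ?_ (FormalMultilinearSeries.le_radius_of_norm_le hM h)
    rw [ENNReal.ofReal, ENNReal.coe_lt_coe, ← NNReal.coe_lt_coe, NNReal.coe_add, hs',
      Real.coe_toNNReal _ (by positivity)]
    rw [← two_mul, mul_inv]
    have : 0 < M⁻¹ := by positivity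
    linarith
  have hsum := p.changeOriginSeries_summable_aux₁ (r := s) (r' := s) (by exact_mod_cast hrad)
  have htot : ∑' t : Σ k l : ℕ, { s : Finset (Fin (k + l)) // s.card = l },
      ‖p (t.1 + t.2.1)‖₊ * s ^ t.2.1 * s ^ t.1 ≤ (2 * A).toNNReal := by
    rw [← FormalMultilinearSeries.changeOriginIndexEquiv.symm.tsum_eq]
    rw [← FormalMultilinearSeries.changeOriginIndexEquiv.symm.summable_iff] at hsum
    have hfib : ∀ n : ℕ, HasSum (fun t : Finset (Fin n) =>
        ‖p (n - t.card + t.card)‖₊ * s ^ t.card * s ^ (n - t.card)) (‖p n‖₊ * (s + s) ^ n) := by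
      intro n
      convert_to HasSum (fun t : Finset (Fin n) => ‖p n‖₊ * (s ^ t.card * s ^ (n - t.card))) _
      · ext1 t
        rw [tsub_add_cancel_of_le (card_finset_fin_le _), mul_assoc]
      rw [← Fin.sum_pow_mul_eq_add_pow]
      exact (hasSum_fintype _).mul_left _
    have h3 := (hsum.hasSum.sigma hfib)
    rw [← NNReal.coe_le_coe, Real.coe_toNNReal _ (by positivity)]
    have h4 : HasSum (fun n => ((‖p n‖₊ * (s + s) ^ n : NNReal) : ℝ)) _ := NNReal.hasSum_coe.2 h3
    have h5 := hasSum_geometric_two.mul_left A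
    rw [mul_comm A 2] at h5
    refine hasSum_le (fun n => ?_) h4 h5
    push_cast
    rw [hs']
    calc ‖p n‖ * ((4 * M)⁻¹ + (4 * M)⁻¹) ^ n ≤ A * M ^ n * ((4 * M)⁻¹ + (4 * M)⁻¹) ^ n := by
          gcongr; exact h n
      _ = A * (1 / 2) ^ n := by
          rw [mul_assoc, ← mul_pow]
          congr 2
          field_simp
          norm_num
  have hys : ‖y‖₊ ≤ s := by rw [← NNReal.coe_le_coe, hs', coe_nnnorm]; exact hy
  have hsrad : (s : ENNReal) < p.radius := by
    refine lt_of_le_of_lt ?_ hrad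
    rw [ENNReal.coe_le_coe]
    exact le_self_add
  have hk : ‖p.changeOrigin y k‖₊ * s ^ k ≤ (2 * A).toNNReal := by
    refine le_trans ?_ ((NNReal.tsum_comp_le_tsum_of_inj hsum
      (i := fun c : Σ l : ℕ, { s : Finset (Fin (k + l)) // s.card = l } => ⟨k, c⟩)
      (fun a b hab => by simpa using hab)).trans htot)
    dsimp only
    rw [NNReal.tsum_mul_right]
    gcongr
    refine (p.nnnorm_changeOrigin_le k (lt_of_le_of_lt (by exact_mod_cast hys) hsrad)).trans ?_
    refine Summable.tsum_le_tsum (fun c => ?_) ?_ (p.changeOriginSeries_summable_aux₂ hsrad k)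
    · gcongr
    · refine NNReal.summable_of_le (fun c => ?_) (p.changeOriginSeries_summable_aux₂ hsrad k)
      gcongr
  rw [← NNReal.coe_le_coe, Real.coe_toNNReal _ (by positivity)] at hk
  push_cast at hk
  rw [hs', inv_pow, ← div_eq_mul_inv, div_le_iff₀ (by positivity)] at hk
  exact hk

/-- The sum of the Taylor series of `f` at `q`, when the Taylor coefficients are bounded. -/
theorem hasFPowerSeriesOnBall_taylorSeries [CompleteSpace F] {f : X → F} {q : X} {A M : ℝ}
    (hM : 0 < M) (h : ∀ n, ‖taylorSeries f q n‖ ≤ A * M ^ n) :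
    HasFPowerSeriesOnBall (fun x => (taylorSeries f q).sum (x - q)) (taylorSeries f q) q
      (ENNReal.ofReal M⁻¹) := by
  have hr := FormalMultilinearSeries.le_radius_of_norm_le hM h
  have hpos : 0 < ENNReal.ofReal M⁻¹ := ENNReal.ofReal_pos.2 (by positivity)
  have h1 := ((taylorSeries f q).hasFPowerSeriesOnBall (hpos.trans_le hr)).comp_sub q
  rw [zero_add] at h1
  exact h1.mono hpos hr

theorem norm_taylor_remainder_le [CompleteSpace F] {f : X → F} {x y : X} {n : ℕ} {C : ℝ}
    (hf : ∀ t ∈ Set.Icc (0 : ℝ) 1, ContDiffAt ℝ (n + 1) f (x + t • y))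
    (hC : ∀ t ∈ Set.Icc (0 : ℝ) 1, ‖iteratedFDeriv ℝ (n + 1) f (x + t • y) (fun _ => y)‖ ≤ C) :
    ‖f (x + y) - ∑ k ∈ Finset.range (n + 1), taylorSeries f x k (fun _ => y)‖ ≤
      (n ! : ℝ)⁻¹ * C := by
  have := map_add_eq_sum_add_integral_iteratedFDeriv (f := f) (x := x) (y := y) (n := n) hf
  simp_rw [taylorSeries_diag]
  rw [this, add_sub_cancel_left, norm_smul, norm_inv, Real.norm_natCast]
  gcongr
  have := intervalIntegral.norm_integral_le_of_norm_le_const (a := 0) (b := 1) (C := C)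
    (f := fun t : ℝ => (1 - t) ^ n • iteratedFDeriv ℝ (n + 1) f (x + t • y) (fun _ => y)) (by
      intro t ht
      rw [uIoc_of_le zero_le_one] at ht
      rw [norm_smul, norm_pow, Real.norm_eq_abs, abs_of_nonneg (by linarith [ht.2])]
      refine (mul_le_of_le_one_left (norm_nonneg _) ?_).trans (hC t ⟨ht.1.le, ht.2⟩)
      exact pow_le_one₀ (by linarith [ht.2]) (by linarith [ht.1]))
  simpa using this

/-- A smooth function with bounds of analytic type is analytic. -/
theorem analyticAt_of_taylorBound [CompleteSpace F] {f : X → F} {x : X} {ρ A M : ℝ} (hρ : 0 < ρ)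
    (hA : 0 ≤ A) (hM : 0 < M) (hf : ∀ y ∈ Metric.ball x ρ, ContDiffAt ℝ ∞ f y)
    (hb : ∀ y ∈ Metric.ball x ρ, TaylorBound f y A M) : AnalyticAt ℝ f x := by
  have h1 := (hb x (Metric.mem_ball_self hρ)).norm_taylorSeries_le hA hM.le
  set M' := 2 * Real.exp 1 * M with hM'
  have hM'0 : 0 < M' := by positivity
  have h2 := hasFPowerSeriesOnBall_taylorSeries hM'0 h1
  refine h2.analyticAt.congr ?_
  have hr : 0 < min ρ (min M⁻¹ M'⁻¹) := lt_min hρ (lt_min (by positivity) (by positivity))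
  filter_upwards [Metric.ball_mem_nhds x hr] with z hz
  obtain ⟨y, rfl⟩ : ∃ y, z = x + y := ⟨z - x, by abel⟩
  rw [Metric.mem_ball, dist_eq_norm, add_sub_cancel_left] at hz
  have hy1 : ‖y‖ < ρ := hz.trans_le (min_le_left _ _)
  have hy2 : ‖y‖ < M⁻¹ := hz.trans_le ((min_le_right _ _).trans (min_le_left _ _))
  have hy3 : ‖y‖ < M'⁻¹ := hz.trans_le ((min_le_right _ _).trans (min_le_right _ _))
  have hq : M * ‖y‖ < 1 := by
    calc M * ‖y‖ < M * M⁻¹ := by gcongr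
      _ = 1 := mul_inv_cancel₀ hM.ne'
  have hsum := h2.hasSum (y := y) (by
    rw [Metric.mem_eball, edist_zero_right, ← ofReal_norm]
    exact (ENNReal.ofReal_lt_ofReal_iff (by positivity)).2 hy3)
  refine tendsto_nhds_unique ((tendsto_add_atTop_iff_nat 1).2 hsum.tendsto_sum_nat) ?_
  rw [tendsto_iff_norm_sub_tendsto_zero]
  -- The remainder estimate divides by `n !` while the bound on the derivative has `(n + 1)!`; the
  -- resulting factor `n + 1` is harmless since `M * ‖y‖ < 1`.
  have hlim : Tendsto (fun n : ℕ => A * (((n + 1 : ℕ) : ℝ) * (M * ‖y‖) ^ (n + 1))) atTop (𝓝 0) := by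
    have := (tendsto_self_mul_const_pow_of_abs_lt_one (r := M * ‖y‖)
      (by rw [abs_of_nonneg (by positivity)]; exact hq))
    have := ((tendsto_add_atTop_iff_nat 1).2 this).const_mul A
    simpa using this
  refine squeeze_zero (fun _ => norm_nonneg _) (fun n => ?_) hlim
  rw [norm_sub_rev]
  have hmem : ∀ t ∈ Set.Icc (0 : ℝ) 1, x + t • y ∈ Metric.ball x ρ := by
    intro t ht
    rw [Metric.mem_ball, dist_eq_norm, add_sub_cancel_left, norm_smul, Real.norm_eq_abs,
      abs_of_nonneg ht.1]
    exact (mul_le_of_le_one_left (norm_nonneg _) ht.2).trans_lt hy1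
  refine (norm_taylor_remainder_le (C := (n + 1)! * (A * M ^ (n + 1)) * ‖y‖ ^ (n + 1))
    (fun t ht => (hf _ (hmem t ht)).of_le (by exact_mod_cast le_top))
    (fun t ht => hb _ (hmem t ht) (n + 1) y)).trans_eq ?_
  rw [Nat.factorial_succ]
  push_cast
  rw [mul_pow]
  field_simp

end TaylorSeries

/-! ### Functions vanishing to infinite order at a point. -/

section Flat

variable {X F : Type*} [NormedAddCommGroup X] [NormedSpace ℝ X]
  [NormedAddCommGroup F] [NormedSpace ℝ F]

/-- `v` vanishes to infinite order at `q`. -/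
def IsFlatAt (v : X → F) (q : X) : Prop :=
  ∀ n : ℕ, v =O[𝓝 q] fun x => ‖x - q‖ ^ n

theorem IsFlatAt.congr {u v : X → F} {q : X} (hu : IsFlatAt u q) (h : u =ᶠ[𝓝 q] v) :
    IsFlatAt v q := fun n => (hu n).congr' h EventuallyEq.rfl

theorem isFlatAt_zero (q : X) : IsFlatAt (fun _ => (0 : F)) q := fun _ => isBigO_zero _ _

theorem IsFlatAt.add {u v : X → F} {q : X} (hu : IsFlatAt u q) (hv : IsFlatAt v q) :
    IsFlatAt (fun x => u x + v x) q := fun n => (hu n).add (hv n)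

theorem IsFlatAt.sub {u v : X → F} {q : X} (hu : IsFlatAt u q) (hv : IsFlatAt v q) :
    IsFlatAt (fun x => u x - v x) q := fun n => (hu n).sub (hv n)

theorem IsFlatAt.sum {ι : Type*} {s : Finset ι} {u : ι → X → F} {q : X}
    (hu : ∀ i ∈ s, IsFlatAt (u i) q) : IsFlatAt (fun x => ∑ i ∈ s, u i x) q :=
  fun n => IsBigO.fun_sum fun i hi => hu i hi n

theorem IsFlatAt.smul_left {u : X → ℝ} {v : X → F} {q : X} (hv : IsFlatAt v q)
    (hu : ContinuousAt u q) : IsFlatAt (fun x => u x • v x) q := by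
  intro n
  simpa using (hu.isBigO_one (F := ℝ)).smul (hv n)

theorem IsFlatAt.mul_left {u v : X → ℝ} {q : X} (hv : IsFlatAt v q)
    (hu : ContinuousAt u q) : IsFlatAt (fun x => u x * v x) q := hv.smul_left hu

theorem IsFlatAt.comp_ray {v : X → F} {q : X} (hv : IsFlatAt v q) (ξ : X) (n : ℕ) :
    (fun t : ℝ => v (q + t • ξ)) =O[𝓝 0] fun t => t ^ n := by
  have h1 : Tendsto (fun t : ℝ => q + t • ξ) (𝓝 0) (𝓝 q) := by
    have : Continuous fun t : ℝ => q + t • ξ := by fun_prop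
    simpa using this.tendsto 0
  refine ((hv n).comp_tendsto h1).trans ?_
  refine IsBigO.of_bound (‖ξ‖ ^ n) (Eventually.of_forall fun t => ?_)
  simp only [Function.comp_apply, add_sub_cancel_left, norm_smul, norm_pow, mul_pow]
  rw [norm_mul, norm_pow, norm_pow, norm_norm, norm_norm, mul_comm]

theorem not_isFlatAt_one (q : X) : ¬ IsFlatAt (fun _ => (1 : ℝ)) q := by
  intro h
  have h1 := (h 1).trans_tendsto (g'' := fun x => ‖x - q‖ ^ 1) (by
    have : Continuous fun x : X => ‖x - q‖ ^ 1 := by fun_prop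
    simpa using this.tendsto q)
  exact one_ne_zero (tendsto_nhds_unique tendsto_const_nhds h1)

/-- Second order Taylor estimate with a moving base point. -/
theorem ContDiffAt.exists_second_order_bound {E F : Type*} [NormedAddCommGroup E] [NormedSpace ℝ E]
    [NormedAddCommGroup F] [NormedSpace ℝ F] {v : E → F} {a : E} (hs : ContDiffAt ℝ 2 v a) :
    ∃ K ε : ℝ, 0 ≤ K ∧ 0 < ε ∧ ∀ x y, x ∈ Metric.ball a ε → y ∈ Metric.ball a ε →
      ‖v y - v x - fderiv ℝ v x (y - x)‖ ≤ K * ‖y - x‖ ^ 2 := by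
  have hd : ContDiffAt ℝ 1 (fderiv ℝ v) a := hs.fderiv_right (by norm_num)
  obtain ⟨K, s, hsq, hK⟩ := hd.exists_lipschitzOnWith
  have hdiff : ∀ᶠ x in 𝓝 a, DifferentiableAt ℝ v x := by
    filter_upwards [hs.eventually (by simp)] with x hx
    exact hx.differentiableAt (by norm_num)
  obtain ⟨ε, hε, hball⟩ := Metric.eventually_nhds_iff_ball.1 (hdiff.and hsq)
  refine ⟨K, ε, K.2, hε, fun x y hx hy => ?_⟩
  have hseg : segment ℝ x y ⊆ Metric.ball a ε := (convex_ball a ε).segment_subset hx hy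
  have := (convex_segment (𝕜 := ℝ) x y).norm_image_sub_le_of_norm_fderiv_le'
    (f := v) (φ := fderiv ℝ v x) (C := K * ‖y - x‖) (x := x) (y := y)
    (fun z hz => (hball z (hseg hz)).1) (fun z hz => by
      rw [← dist_eq_norm]
      refine (hK.dist_le_mul z (hball z (hseg hz)).2 x (hball x hx).2).trans ?_
      gcongr
      rw [dist_eq_norm]
      obtain ⟨θ, hθ, rfl⟩ := (segment_eq_image' ℝ x y ▸ hz)
      simp only [add_sub_cancel_left, norm_smul, Real.norm_eq_abs, abs_of_nonneg hθ.1]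
      exact mul_le_of_le_one_left (norm_nonneg _) hθ.2)
    (left_mem_segment ℝ _ _) (right_mem_segment ℝ _ _)
  rwa [mul_assoc, ← sq] at this

/-- Compare the derivative with a difference quotient of step `s = ‖x - q‖ ^ N`. The second order
error is `O(s ^ 2)`, and the two values of `v` are `O(‖x - q‖ ^ (2 * N)) = O(s ^ 2)`; dividing by
`s` leaves `O(s)`. -/
theorem IsFlatAt.fderiv_apply {v : X → F} {q : X} (hv : IsFlatAt v q) (hs : ContDiffAt ℝ 2 v q)
    (w : X) : IsFlatAt (fun x => fderiv ℝ v x w) q := by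
  have h0 : fderiv ℝ v q = 0 := ((hv 2).hasFDerivAt one_lt_two).fderiv
  obtain ⟨K, ε, hK, hε, hball⟩ := hs.exists_second_order_bound
  have main : ∀ x y, x ∈ Metric.ball q ε → x + y ∈ Metric.ball q ε →
      ‖fderiv ℝ v x y‖ ≤ K * ‖y‖ * ‖y‖ + ‖v (x + y)‖ + ‖v x‖ := by
    intro x y hx hy
    have := hball x (x + y) hx hy
    rw [add_sub_cancel_left, sq, ← mul_assoc] at this
    have e : fderiv ℝ v x y = -(v (x + y) - v x - fderiv ℝ v x y) + v (x + y) - v x := by abel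
    rw [e]
    refine (norm_sub_le _ _).trans ?_
    gcongr
    refine (norm_add_le _ _).trans ?_
    rw [norm_neg]
    gcongr
  intro n
  -- it suffices to treat large `n`
  suffices h : (fun x => fderiv ℝ v x w) =O[𝓝 q] fun x => ‖x - q‖ ^ (n + 1) by
    refine h.trans ?_
    have h1 : Tendsto (fun x : X => ‖x - q‖) (𝓝 q) (𝓝 0) := by
      have : Continuous fun x : X => ‖x - q‖ := by fun_prop
      simpa using this.tendsto q
    have := (h1.isBigO_one ℝ).mul (isBigO_refl (fun x : X => ‖x - q‖ ^ n) (𝓝 q))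
    simpa [pow_succ'] using this
  set N := n + 1 with hN
  obtain ⟨C, hC0, hC⟩ := (hv (2 * N)).exists_nonneg
  rw [IsBigOWith] at hC
  have ht : Tendsto (fun x => x + ‖x - q‖ ^ N • w) (𝓝 q) (𝓝 q) := by
    have : Continuous fun x => x + ‖x - q‖ ^ N • w := by fun_prop
    simpa [hN] using this.tendsto q
  refine IsBigO.of_bound (K * ‖w‖ * ‖w‖ + C * (1 + ‖w‖) ^ (2 * N) + C) ?_
  filter_upwards [hC, ht.eventually hC, Metric.ball_mem_nhds q hε,
    ht.eventually (Metric.ball_mem_nhds q hε), Metric.ball_mem_nhds q one_pos]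
    with x h1 h2 h3 h4 h5
  by_cases hx : x = q
  · simp [hx, h0]
  have hpos : 0 < ‖x - q‖ := norm_pos_iff.2 (sub_ne_zero.2 hx)
  rw [Metric.mem_ball, dist_eq_norm] at h5
  set s := ‖x - q‖ ^ N with hsdef
  have hs0 : 0 < s := pow_pos hpos N
  have h6 := main x (s • w) h3 h4
  rw [map_smul, norm_smul, norm_smul, Real.norm_eq_abs, abs_of_pos hs0] at h6
  rw [norm_pow, norm_norm] at h1 h2
  rw [norm_pow, norm_norm, ← hsdef]
  have e2 : ‖x - q‖ ^ (2 * N) = s * s := by rw [two_mul, pow_add]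
  have h7 : ‖x + s • w - q‖ ≤ (1 + ‖w‖) * ‖x - q‖ := by
    have : x + s • w - q = (x - q) + s • w := by abel
    rw [this]
    refine (norm_add_le _ _).trans ?_
    rw [norm_smul, Real.norm_eq_abs, abs_of_pos hs0]
    have : s ≤ ‖x - q‖ := by
      rw [hsdef, hN, pow_succ]
      exact mul_le_of_le_one_left hpos.le (pow_le_one₀ hpos.le h5.le)
    nlinarith [norm_nonneg w]
  have h8 : ‖v (x + s • w)‖ ≤ C * ((1 + ‖w‖) ^ (2 * N) * (s * s)) := by
    refine h2.trans ?_
    rw [← e2, ← mul_pow]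
    gcongr
  rw [e2] at h1
  have h9 : s * ‖fderiv ℝ v x w‖ ≤ s * ((K * ‖w‖ * ‖w‖ + C * (1 + ‖w‖) ^ (2 * N) + C) * s) := by
    nlinarith
  exact le_of_mul_le_mul_left h9 hs0

/-- Taylor's formula in several variables. -/
theorem ContDiffAt.taylor_isBigO [CompleteSpace F] {v : X → F} {q : X} (hs : ContDiffAt ℝ ∞ v q)
    (n : ℕ) : (fun x => v x - ∑ k ∈ Finset.range n, taylorSeries v q k (fun _ => x - q)) =O[𝓝 q]
      fun x => ‖x - q‖ ^ n := by
  rcases n with _ | n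
  · simpa using hs.continuousAt.isBigO_one (F := ℝ)
  have h1 : ContDiffAt ℝ (n + 1) v q := hs.of_le (by exact_mod_cast le_top)
  have h2 : ContinuousAt (iteratedFDeriv ℝ (n + 1) v) q :=
    (hs.iteratedFDeriv_right (m := 0) (i := n + 1) (by exact_mod_cast le_top)).continuousAt
  have h3 : ∀ᶠ x in 𝓝 q, ‖iteratedFDeriv ℝ (n + 1) v x‖ ≤ ‖iteratedFDeriv ℝ (n + 1) v q‖ + 1 :=
    (h2.norm.eventually (gt_mem_nhds (lt_add_one _))).mono fun x hx => hx.le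
  obtain ⟨ε, hε, hball⟩ := Metric.eventually_nhds_iff_ball.1
    ((h1.eventually (by simp)).and h3)
  refine IsBigO.of_bound ((n.factorial : ℝ)⁻¹ * (‖iteratedFDeriv ℝ (n + 1) v q‖ + 1)) ?_
  filter_upwards [Metric.ball_mem_nhds q hε] with x hx
  have hmem : ∀ t ∈ Set.Icc (0 : ℝ) 1, q + t • (x - q) ∈ Metric.ball q ε := by
    intro t ht
    rw [Metric.mem_ball, dist_eq_norm, add_sub_cancel_left, norm_smul, Real.norm_eq_abs,
      abs_of_nonneg ht.1]
    rw [Metric.mem_ball, dist_eq_norm] at hx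
    exact (mul_le_of_le_one_left (norm_nonneg _) ht.2).trans_lt hx
  have := norm_taylor_remainder_le (f := v) (x := q) (y := x - q) (n := n)
    (C := (‖iteratedFDeriv ℝ (n + 1) v q‖ + 1) * ‖x - q‖ ^ (n + 1))
    (fun t ht => (hball _ (hmem t ht)).1) (fun t ht => by
      refine (ContinuousMultilinearMap.le_opNorm _ _).trans ?_
      rw [Finset.prod_const, Finset.card_univ, Fintype.card_fin]
      gcongr
      exact (hball _ (hmem t ht)).2)
  rw [add_sub_cancel] at this
  rw [norm_pow, norm_norm, mul_assoc]
  exact this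

/-- A smooth function which is not flat has a nonzero leading homogeneous term. -/
theorem exists_leading_term [CompleteSpace F] {v : X → F} {q : X} (hs : ContDiffAt ℝ ∞ v q)
    (hv : ¬ IsFlatAt v q) :
    ∃ (e : ℕ) (B : ContinuousMultilinearMap ℝ (fun _ : Fin e => X) F),
      (∃ ξ, B (fun _ => ξ) ≠ 0) ∧
      (fun x => v x - B (fun _ => x - q)) =O[𝓝 q] fun x => ‖x - q‖ ^ (e + 1) := by
  classical
  have hex : ∃ e, ∃ ξ, taylorSeries v q e (fun _ => ξ) ≠ 0 := by
    by_contra! hcon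
    apply hv
    intro n
    have := hs.taylor_isBigO n
    simpa [hcon] using this
  refine ⟨Nat.find hex, taylorSeries v q (Nat.find hex), Nat.find_spec hex, ?_⟩
  have := hs.taylor_isBigO (Nat.find hex + 1)
  simp only [Finset.sum_range_succ] at this
  refine this.congr_left fun x => ?_
  congr 1
  rw [Finset.sum_eq_zero, zero_add]
  intro k hk
  have := Nat.find_min hex (Finset.mem_range.1 hk)
  push Not at this
  exact this _

theorem ContinuousMultilinearMap.analyticAt_diag [CompleteSpace F] {e : ℕ}
    (B : ContinuousMultilinearMap ℝ (fun _ : Fin e => X) F) (x : X) :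
    AnalyticAt ℝ (fun ξ => B (fun _ => ξ)) x := by
  have : ContDiff ℝ ω (fun ξ : X => B (fun _ => ξ)) :=
    B.contDiff.comp (contDiff_pi.2 fun _ => contDiff_id)
  exact this.contDiffAt.analyticAt

theorem ContinuousMultilinearMap.exists_diag_ne_zero_mem [CompleteSpace F] {e : ℕ}
    (B : ContinuousMultilinearMap ℝ (fun _ : Fin e => X) F) (hB : ∃ ξ, B (fun _ => ξ) ≠ 0)
    {U : Set X} (hU : IsOpen U) (hne : U.Nonempty) : ∃ ξ ∈ U, B (fun _ => ξ) ≠ 0 := by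
  by_contra! hcon
  obtain ⟨ξ, hξ⟩ := hB
  obtain ⟨z, hz⟩ := hne
  apply hξ
  have h1 : AnalyticOnNhd ℝ (fun ξ => B (fun _ => ξ)) univ := fun x _ => B.analyticAt_diag x
  have h2 := h1.eqOn_zero_of_preconnected_of_eventuallyEq_zero isPreconnected_univ (mem_univ z)
    (by filter_upwards [hU.mem_nhds hz] with x hx using hcon x hx)
  exact h2 (mem_univ ξ)

/-- A smooth function which is not flat does not vanish on generic rays. -/
theorem exists_ray_ne_zero [CompleteSpace F] {v : X → F} {q : X} (hs : ContDiffAt ℝ ∞ v q)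
    (hv : ¬ IsFlatAt v q) {U : Set X} (hU : IsOpen U) (hne : U.Nonempty) :
    ∃ ξ ∈ U, ∀ᶠ t in 𝓝[≠] (0 : ℝ), v (q + t • ξ) ≠ 0 := by
  -- On a direction where the leading form does not vanish, the term `t ^ e • B ξ` dominates the
  -- remainder `O(t ^ (e + 1))`.
  obtain ⟨e, B, hB, hO⟩ := exists_leading_term hs hv
  obtain ⟨ξ, hξU, hξ⟩ := B.exists_diag_ne_zero_mem hB hU hne
  refine ⟨ξ, hξU, ?_⟩
  have h1 : Tendsto (fun t : ℝ => q + t • ξ) (𝓝 0) (𝓝 q) := by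
    have : Continuous fun t : ℝ => q + t • ξ := by fun_prop
    simpa using this.tendsto 0
  obtain ⟨C, hC⟩ := (hO.comp_tendsto h1).bound
  have h2 : ∀ᶠ t : ℝ in 𝓝 0, |t| * (C * ‖ξ‖ ^ (e + 1)) < ‖B fun _ => ξ‖ := by
    have : Continuous fun t : ℝ => |t| * (C * ‖ξ‖ ^ (e + 1)) := by fun_prop
    have := this.tendsto 0
    simp only [abs_zero, zero_mul] at this
    exact this.eventually (gt_mem_nhds (norm_pos_iff.2 hξ))
  filter_upwards [nhdsWithin_le_nhds hC, nhdsWithin_le_nhds h2, self_mem_nhdsWithin]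
    with t h3 h4 h5 h6
  simp only [Function.comp_apply, add_sub_cancel_left, h6, zero_sub, norm_neg] at h3
  have e1 : (B fun _ => t • ξ) = t ^ e • B fun _ => ξ := by
    have := B.toMultilinearMap.map_smul_univ (fun _ => t) (fun _ => ξ)
    simpa using this
  rw [e1, norm_smul, norm_smul, norm_pow, norm_pow, norm_mul, norm_norm, norm_norm,
    Real.norm_eq_abs, mul_pow, pow_succ] at h3
  have h7 : 0 < |t| ^ e := pow_pos (abs_pos.2 h5) e
  have : |t| ^ e * ‖B fun _ => ξ‖ ≤ |t| ^ e * (|t| * (C * ‖ξ‖ ^ (e + 1))) := by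
    calc _ ≤ _ := h3
      _ = _ := by ring
  have := le_of_mul_le_mul_left this h7
  linarith

/-- A smooth function which vanishes on an open cone is flat at its vertex. -/
theorem isFlatAt_of_cone [CompleteSpace F] {v : X → F} {q : X} (hs : ContDiffAt ℝ ∞ v q)
    {U : Set X} (hU : IsOpen U) (hne : U.Nonempty)
    (h : ∀ ξ ∈ U, ∃ᶠ t in 𝓝[≠] (0 : ℝ), v (q + t • ξ) = 0) : IsFlatAt v q := by
  by_contra hv
  obtain ⟨ξ, hξ, hne0⟩ := exists_ray_ne_zero hs hv hU hne
  exact (h ξ hξ) hne0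

end Flat

/-! ### Divisibility by powers of a parameter and implicit functions. -/

section Expansions

theorem isBigO_pow_of_le {m n : ℕ} (h : m ≤ n) :
    (fun t : ℝ => t ^ n) =O[𝓝 0] fun t => t ^ m := by
  obtain ⟨k, rfl⟩ := Nat.exists_eq_add_of_le h
  have h1 : (fun t : ℝ => t ^ k) =O[𝓝 0] fun _ => (1 : ℝ) :=
    (continuous_pow k).continuousAt.isBigO_one (F := ℝ)
  simpa [pow_add] using (isBigO_refl (fun t : ℝ => t ^ m) (𝓝 0)).mul h1

theorem coeff_eq_zero_of_isBigO (n : ℕ) : ∀ r : ℕ → ℝ,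
    (fun t : ℝ => ∑ i ∈ Finset.range n, r i * t ^ i) =O[𝓝[≠] 0] (fun t => t ^ n) →
    ∀ i < n, r i = 0 := by
  induction n with
  | zero => intro r _ i hi; exact absurd hi (Nat.not_lt_zero i)
  | succ n ih =>
    intro r h
    have h0 : r 0 = 0 := by
      have t1 : Tendsto (fun t : ℝ => t ^ (n + 1)) (𝓝[≠] 0) (𝓝 0) := by
        have : Continuous fun t : ℝ => t ^ (n + 1) := by fun_prop
        simpa using (this.tendsto 0).mono_left nhdsWithin_le_nhds
      have t2 := h.trans_tendsto t1
      have t3 : Tendsto (fun t : ℝ => ∑ i ∈ Finset.range (n + 1), r i * t ^ i) (𝓝[≠] 0)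
          (𝓝 (r 0)) := by
        have : Continuous fun t : ℝ => ∑ i ∈ Finset.range (n + 1), r i * t ^ i := by fun_prop
        have := (this.tendsto 0).mono_left (nhdsWithin_le_nhds (s := {0}ᶜ))
        simpa [Finset.sum_range_succ'] using this
      exact tendsto_nhds_unique t3 t2
    have h1 := ih (fun i => r (i + 1)) (by
      obtain ⟨C, hC⟩ := h.bound
      refine IsBigO.of_bound C ?_
      filter_upwards [hC, self_mem_nhdsWithin] with t ht ht0
      have ht0' : 0 < ‖t‖ := norm_pos_iff.2 ht0
      rw [Finset.sum_range_succ', h0] at ht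
      simp only [zero_mul, add_zero, pow_succ, ← mul_assoc] at ht
      rw [← Finset.sum_mul, norm_mul, norm_mul, ← mul_assoc] at ht
      exact le_of_mul_le_mul_right ht ht0')
    intro i hi
    rcases i with _ | i
    · exact h0
    · exact h1 i (by omega)

/-- An analytic function with leading term `c z * t ^ n` in `t`, for each `z`, is divisible by
`t ^ n`. -/
theorem AnalyticAt.exists_pow_factor
    {Z : Type*} [NormedAddCommGroup Z] [NormedSpace ℝ Z] [FiniteDimensional ℝ Z]
    {h : Z × ℝ → ℝ} {z₀ : Z} (hh : AnalyticAt ℝ h (z₀, 0)) {n : ℕ} {c : Z → ℝ}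
    (hc : ∀ᶠ z in 𝓝 z₀, (fun t : ℝ => h (z, t) - t ^ n * c z) =O[𝓝 0] fun t => t ^ (n + 1)) :
    ∃ Q : Z × ℝ → ℝ, AnalyticAt ℝ Q (z₀, 0) ∧ (∀ᶠ x in 𝓝 (z₀, (0 : ℝ)), h x = x.2 ^ n * Q x) ∧
      ∀ᶠ z in 𝓝 z₀, Q (z, 0) = c z := by
  obtain ⟨Q, r, hQ, hr, e⟩ := hh.exists_taylor_division n
  have t0 : ∀ z : Z, Tendsto (fun t : ℝ => (z, t)) (𝓝 0) (𝓝 (z, 0)) := fun z => by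
    have : Continuous fun t : ℝ => (z, t) := by fun_prop
    exact this.tendsto 0
  have t1 : Tendsto (fun z : Z => (z, (0 : ℝ))) (𝓝 z₀) (𝓝 (z₀, 0)) := by
    have : Continuous fun z : Z => (z, (0 : ℝ)) := by fun_prop
    exact this.tendsto z₀
  -- For each fixed `z` the asymptotics in `t` force the Taylor remainder to vanish and identify the
  -- value of the quotient at `t = 0`.
  have key : ∀ᶠ z in 𝓝 z₀, (∀ i < n, r i z = 0) ∧ Q (z, 0) = c z := by
    filter_upwards [hc, t1.eventually e.eventually_nhds,
      t1.eventually hQ.eventually_analyticAt] with z h1 h2 h3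
    have h2' := (t0 z).eventually h2
    have hQc : ContinuousAt (fun t : ℝ => Q (z, t)) 0 :=
      ContinuousAt.comp (g := Q) (f := fun t : ℝ => (z, t)) h3.continuousAt (t0 z)
    have hr0 : ∀ i < n, r i z = 0 := by
      refine coeff_eq_zero_of_isBigO n (fun i => r i z) ?_
      have a1 : (fun t : ℝ => h (z, t)) =O[𝓝 0] fun t => t ^ n := by
        have b1 := h1.trans (isBigO_pow_of_le (Nat.le_succ n))
        have b2 : (fun t : ℝ => t ^ n * c z) =O[𝓝 0] fun t => t ^ n :=
          by
            simpa only [mul_comm] using (isBigO_refl (fun t : ℝ => t ^ n) (𝓝 0)).const_mul_left (c z)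
        simpa using b1.add b2
      have a2 : (fun t : ℝ => t ^ n * Q (z, t)) =O[𝓝 0] fun t => t ^ n := by
        simpa using (isBigO_refl (fun t : ℝ => t ^ n) (𝓝 0)).mul (hQc.isBigO_one (F := ℝ))
      refine ((a1.sub a2).mono nhdsWithin_le_nhds).congr' ?_ EventuallyEq.rfl
      filter_upwards [nhdsWithin_le_nhds h2'] with t ht
      rw [ht]; simp
    refine ⟨hr0, ?_⟩
    have a3 : Tendsto (fun t : ℝ => Q (z, t) - c z) (𝓝[≠] 0) (𝓝 0) := by
      have b : (fun t : ℝ => Q (z, t) - c z) =O[𝓝[≠] 0] fun t => t := by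
        obtain ⟨C, hC⟩ := h1.bound
        refine IsBigO.of_bound C ?_
        filter_upwards [nhdsWithin_le_nhds hC, nhdsWithin_le_nhds h2', self_mem_nhdsWithin]
          with t ht h4 ht0
        rw [h4, Finset.sum_eq_zero (fun i hi => by rw [hr0 i (Finset.mem_range.1 hi), zero_mul]),
          add_zero, ← mul_sub, norm_mul, pow_succ, norm_mul] at ht
        have : 0 < ‖t ^ n‖ := norm_pos_iff.2 (pow_ne_zero n ht0)
        refine le_of_mul_le_mul_left ?_ this
        linarith
      refine b.trans_tendsto ?_
      exact tendsto_id.mono_left nhdsWithin_le_nhds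
    have a4 : Tendsto (fun t : ℝ => Q (z, t) - c z) (𝓝[≠] 0) (𝓝 (Q (z, 0) - c z)) :=
      (hQc.tendsto.sub_const _).mono_left nhdsWithin_le_nhds
    exact sub_eq_zero.1 (tendsto_nhds_unique a4 a3)
  refine ⟨Q, hQ, ?_, key.mono fun z hz => hz.2⟩
  have t2 : Tendsto (fun x : Z × ℝ => x.1) (𝓝 (z₀, 0)) (𝓝 z₀) := continuous_fst.tendsto (z₀, 0)
  filter_upwards [e, t2.eventually key] with x h1 h2
  rw [h1, Finset.sum_eq_zero (fun i hi => by rw [h2.1 i (Finset.mem_range.1 hi), zero_mul]),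
    add_zero]

/-- Analytic implicit functions, with a quantitative uniqueness statement. -/
theorem AnalyticAt.exists_implicit {U V : Type*} [NormedAddCommGroup U] [NormedSpace ℝ U]
    [CompleteSpace U] [NormedAddCommGroup V] [NormedSpace ℝ V] [CompleteSpace V]
    {g : U × V → V} {u₀ : U} {v₀ : V} (hg : AnalyticAt ℝ g (u₀, v₀)) {c : ℝ} (hc : c ≠ 0)
    (h0 : ∀ᶠ v in 𝓝 v₀, g (u₀, v) = c • (v - v₀)) :
    ∃ ζ : U → V, AnalyticAt ℝ ζ u₀ ∧ ζ u₀ = v₀ ∧ (∀ᶠ u in 𝓝 u₀, g (u, ζ u) = 0) ∧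
      ∃ C : ℝ, ∀ᶠ p in 𝓝 (u₀, v₀), ‖p.2 - ζ p.1‖ ≤ C * ‖g p‖ := by
  have hg0 : g (u₀, v₀) = 0 := by simpa using h0.self_of_nhds
  have hgc : ContDiffAt ℝ ω g (u₀, v₀) := hg.contDiffAt
  have hpart : fderiv ℝ g (u₀, v₀) ∘L .inr ℝ U V = c • ContinuousLinearMap.id ℝ V := by
    have h1 : HasFDerivAt (fun v => g (u₀, v)) (fderiv ℝ g (u₀, v₀) ∘L .inr ℝ U V) v₀ :=
      HasFDerivAt.comp (g := g) v₀ hg.differentiableAt.hasFDerivAt (hasFDerivAt_prodMk_right u₀ v₀)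
    have h2 : HasFDerivAt (fun v => c • (v - v₀)) (c • ContinuousLinearMap.id ℝ V) v₀ :=
      ((hasFDerivAt_id v₀).sub_const v₀).const_smul c
    exact h1.unique (h2.congr_of_eventuallyEq h0)
  have hinv : (fderiv ℝ g (u₀, v₀) ∘L .inr ℝ U V).IsInvertible := by
    rw [hpart]
    refine ⟨ContinuousLinearEquiv.smulLeft (Units.mk0 c hc), ?_⟩
    ext v; rfl
  set ζ := hgc.implicitFunction (by simp) hinv with hζ
  have hζA : AnalyticAt ℝ ζ u₀ := (hgc.contDiffAt_implicitFunction (by simp) hinv).analyticAt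
  have hζ0 : ζ u₀ = v₀ := hgc.implicitFunction_apply_self (by simp) hinv
  have hζz : ∀ᶠ u in 𝓝 u₀, g (u, ζ u) = 0 := by
    have := hgc.eventually_apply_implicitFunction (by simp) hinv
    rw [hg0] at this
    exact this
  refine ⟨ζ, hζA, hζ0, hζz, 2 / |c|, ?_⟩
  have hstrict := hgc.hasStrictFDerivAt (by simp)
  -- Between `p` and the solution `(p.1, ζ p.1)`, `g` varies by `c • (p.2 - ζ p.1)` up to half its
  -- size; absorbing this error gives the constant `2 / |c|`.
  have hb := hstrict.isLittleO.bound (c := |c| / 2) (by positivity)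
  have t1 : Tendsto (fun p : U × V => (p, (p.1, ζ p.1))) (𝓝 (u₀, v₀))
      (𝓝 ((u₀, v₀), (u₀, v₀))) := by
    refine tendsto_id.prodMk_nhds ?_
    have h1 : Tendsto (fun p : U × V => p.1) (𝓝 (u₀, v₀)) (𝓝 u₀) :=
      continuous_fst.tendsto (u₀, v₀)
    have h2 := hζA.continuousAt.tendsto
    rw [hζ0] at h2
    exact h1.prodMk_nhds (h2.comp h1)
  have t2 : Tendsto (fun p : U × V => p.1) (𝓝 (u₀, v₀)) (𝓝 u₀) := continuous_fst.tendsto (u₀, v₀)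
  filter_upwards [t1.eventually hb, t2.eventually hζz] with p h1 h2
  have e1 : p - (p.1, ζ p.1) = (0, p.2 - ζ p.1) := by
    ext1 <;> simp
  have e2 : fderiv ℝ g (u₀, v₀) (0, p.2 - ζ p.1) = c • (p.2 - ζ p.1) := by
    have := congrArg (fun L : V →L[ℝ] V => L (p.2 - ζ p.1)) hpart
    simpa using this
  simp only [e1, h2, sub_zero, e2] at h1
  have e3 : ‖((0 : U), p.2 - ζ p.1)‖ = ‖p.2 - ζ p.1‖ := by simp [Prod.norm_def]
  rw [e3] at h1
  have h3 : |c| * ‖p.2 - ζ p.1‖ ≤ ‖g p‖ + |c| / 2 * ‖p.2 - ζ p.1‖ := by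
    calc |c| * ‖p.2 - ζ p.1‖ = ‖g p - (g p - c • (p.2 - ζ p.1))‖ := by
          rw [sub_sub_cancel, norm_smul, Real.norm_eq_abs]
      _ ≤ ‖g p‖ + ‖g p - c • (p.2 - ζ p.1)‖ := norm_sub_le _ _
      _ ≤ _ := by gcongr
  have hc' : 0 < |c| := abs_pos.2 hc
  rw [div_mul_eq_mul_div, le_div_iff₀ hc']
  linarith

end Expansions

/-! ### Weighted blow-up of a graph along which analytic equations are flat. -/

section BlowUp

variable {X G F : Type} [NormedAddCommGroup X] [NormedSpace ℝ X]
  [NormedAddCommGroup G] [NormedSpace ℝ G] [NormedAddCommGroup F] [NormedSpace ℝ F] {r : ℕ}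

/-- The Jacobian matrix of `h` in the directions `w` of the second factor. -/
noncomputable def jacMatrix (h : Fin r → X × F → ℝ) (w : Fin r → F) (p : X × F) :
    Matrix (Fin r) (Fin r) ℝ := Matrix.of fun i j => fderiv ℝ (h i) p (0, w j)

/-- A weighted blow-up of the graph of `T` over a neighbourhood of `q`. -/
def blowUp (q : X) (T : X → F) (Λ : ((Fin r → ℝ) × G) ≃L[ℝ] F) (e : ℕ) (ξ : X) (z : G)
    (z' : Fin r → ℝ) (t : ℝ) : X × F :=
  -- The Jacobian determinant has order `e` along the graph. In the `r` directions that the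
  -- equations see, the weight `e + 1` makes quadratic terms `O(t ^ (2 * e + 2))`, beyond the main
  -- term of order `2 * e + 1` obtained with the adjugate. In the remaining directions the weight `2
  -- * e + 2` makes even linear terms negligible.
  (q + t • ξ, T (q + t • ξ) + Λ (t ^ (e + 1) • z', t ^ (2 * e + 2) • z))

theorem tendsto_ray (q ξ : X) : Tendsto (fun t : ℝ => q + t • ξ) (𝓝 0) (𝓝 q) := by
  have : Continuous fun t : ℝ => q + t • ξ := by fun_prop
  simpa using this.tendsto 0

theorem isBigO_ray {v : X → F} {q : X} {n : ℕ} (hv : v =O[𝓝 q] fun x => ‖x - q‖ ^ n) (ξ : X) :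
    (fun t : ℝ => v (q + t • ξ)) =O[𝓝 0] fun t => t ^ n := by
  refine (hv.comp_tendsto (tendsto_ray q ξ)).trans ?_
  refine IsBigO.of_bound (‖ξ‖ ^ n) (Eventually.of_forall fun t => ?_)
  simp only [Function.comp_apply, add_sub_cancel_left, norm_smul, norm_pow, mul_pow]
  rw [norm_mul, norm_pow, norm_pow, norm_norm, norm_norm, mul_comm]

theorem isBigO_smul_const {E : Type*} [NormedAddCommGroup E] [NormedSpace ℝ E] (m n : ℕ)
    (h : m ≤ n) (v : E) : (fun t : ℝ => t ^ n • v) =O[𝓝 0] fun t => t ^ m := by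
  have h1 : (fun t : ℝ => t ^ n • v) =O[𝓝 0] fun t => t ^ n := by
    refine IsBigO.of_bound ‖v‖ (Eventually.of_forall fun t => ?_)
    rw [norm_smul, mul_comm]
  exact h1.trans (isBigO_pow_of_le h)

variable {f T : X → F} {q : X} {e : ℕ}

/-- Expansion of a function which is flat along the graph of `f` at nearby points. -/
theorem isBigO_sub_fderiv_of_flat {h : X × F → ℝ} (hh : AnalyticAt ℝ h (q, f q))
    (hf : ContinuousAt f q) (hflat : IsFlatAt (fun x => h (x, f x)) q)
    (hT : (fun x => f x - T x) =O[𝓝 q] fun x => ‖x - q‖ ^ (2 * e + 3))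
    (hTc : ContinuousAt T q) (Λ : ((Fin r → ℝ) × G) ≃L[ℝ] F) (ξ : X) (z : G) (z' : Fin r → ℝ) :
    (fun t : ℝ => h (blowUp q T Λ e ξ z z' t) -
      t ^ (e + 1) * fderiv ℝ h (q + t • ξ, T (q + t • ξ)) (0, Λ (z', 0))) =O[𝓝 0]
      fun t => t ^ (2 * e + 2) := by
  have hTq : T q = f q := by
    have h1 : Tendsto (fun x => ‖x - q‖ ^ (2 * e + 3)) (𝓝 q) (𝓝 0) := by
      have : Continuous fun x => ‖x - q‖ ^ (2 * e + 3) := by fun_prop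
      simpa using this.tendsto q
    have h2 := hT.trans_tendsto h1
    have h3 : Tendsto (fun x => f x - T x) (𝓝 q) (𝓝 (f q - T q)) := hf.sub hTc
    exact (sub_eq_zero.1 (tendsto_nhds_unique h3 h2)).symm
  obtain ⟨K, ε, hK, hε, hball⟩ :=
    (hh.contDiffAt (n := 2)).exists_second_order_bound
  have hd : ContDiffAt ℝ 1 h (q, f q) := hh.contDiffAt
  obtain ⟨L, s, hs, hL⟩ := hd.exists_lipschitzOnWith
  have r1 := tendsto_ray q ξ
  have cγ : Tendsto (fun t : ℝ => (q + t • ξ, T (q + t • ξ))) (𝓝 0) (𝓝 (q, f q)) :=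
    r1.prodMk_nhds (hTq ▸ hTc.tendsto.comp r1)
  have cΓ : Tendsto (fun t : ℝ => (q + t • ξ, f (q + t • ξ))) (𝓝 0) (𝓝 (q, f q)) :=
    r1.prodMk_nhds (hf.tendsto.comp r1)
  have cσ : Tendsto (blowUp q T Λ e ξ z z') (𝓝 0) (𝓝 (q, f q)) := by
    have h1 : Tendsto (fun t : ℝ => Λ (t ^ (e + 1) • z', t ^ (2 * e + 2) • z)) (𝓝 0) (𝓝 0) := by
      have : Continuous fun t : ℝ => Λ (t ^ (e + 1) • z', t ^ (2 * e + 2) • z) := by fun_prop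
      have h := this.tendsto 0
      rw [zero_pow (Nat.succ_ne_zero e), zero_pow (Nat.succ_ne_zero (2 * e + 1)), zero_smul,
        zero_smul, Prod.mk_zero_zero, map_zero] at h
      exact h
    have h2 : Tendsto (fun t : ℝ => T (q + t • ξ) + Λ (t ^ (e + 1) • z', t ^ (2 * e + 2) • z))
        (𝓝 0) (𝓝 (f q)) := by
      have : Tendsto (fun t : ℝ => T (q + t • ξ)) (𝓝 0) (𝓝 (f q)) := hTq ▸ hTc.tendsto.comp r1
      simpa using this.add h1
    exact r1.prodMk_nhds h2
  -- the three contributions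
  have b1 : (fun t : ℝ => h (blowUp q T Λ e ξ z z' t) - h (q + t • ξ, T (q + t • ξ)) -
      fderiv ℝ h (q + t • ξ, T (q + t • ξ))
        (0, Λ (t ^ (e + 1) • z', t ^ (2 * e + 2) • z))) =O[𝓝 0] fun t => t ^ (2 * e + 2) := by
    have h1 : (fun t : ℝ => ‖((0 : X), Λ (t ^ (e + 1) • z', t ^ (2 * e + 2) • z))‖ ^ 2) =O[𝓝 0]
        fun t => t ^ (2 * e + 2) := by
      have h2 : (fun t : ℝ => ((0 : X), Λ (t ^ (e + 1) • z', t ^ (2 * e + 2) • z))) =O[𝓝 0]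
          fun t => t ^ (e + 1) := by
        refine IsBigO.prod_left (isBigO_zero _ _) ?_
        refine (Λ : ((Fin r → ℝ) × G) →L[ℝ] F).isBigO_comp _ _ |>.trans ?_
        exact (isBigO_smul_const _ _ le_rfl z').prod_left (isBigO_smul_const _ _ (by omega) z)
      have h3 := h2.norm_left.pow 2
      refine h3.congr_right fun t => ?_
      ring
    refine IsBigO.trans ?_ h1
    refine IsBigO.of_bound K ?_
    filter_upwards [cγ.eventually (Metric.ball_mem_nhds _ hε),
      cσ.eventually (Metric.ball_mem_nhds _ hε)] with t h2 h3
    have := hball _ _ h2 h3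
    have e1 : blowUp q T Λ e ξ z z' t - (q + t • ξ, T (q + t • ξ)) =
        (0, Λ (t ^ (e + 1) • z', t ^ (2 * e + 2) • z)) := by
      ext1 <;> simp [blowUp]
    rw [e1] at this
    rw [Real.norm_eq_abs (_ ^ 2), abs_of_nonneg (by positivity)]
    exact this
  have b2 : (fun t : ℝ => h (q + t • ξ, T (q + t • ξ))) =O[𝓝 0] fun t => t ^ (2 * e + 2) := by
    have h1 := hflat.comp_ray ξ (2 * e + 2)
    have h2 : (fun t : ℝ => h (q + t • ξ, T (q + t • ξ)) - h (q + t • ξ, f (q + t • ξ))) =O[𝓝 0]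
        fun t => t ^ (2 * e + 2) := by
      have h3 := (isBigO_ray hT ξ).trans (isBigO_pow_of_le (show 2 * e + 2 ≤ 2 * e + 3 by omega))
      refine IsBigO.trans ?_ h3
      refine IsBigO.of_bound L ?_
      filter_upwards [cγ.eventually hs, cΓ.eventually hs] with t h4 h5
      have := hL.dist_le_mul _ h4 _ h5
      rw [dist_eq_norm, dist_eq_norm] at this
      refine this.trans_eq ?_
      rw [Prod.mk_sub_mk, sub_self, Prod.norm_mk, norm_zero, max_eq_right (norm_nonneg _),
        norm_sub_rev]
    simpa using h2.add h1
  have hfd : ContinuousAt (fderiv ℝ h) (q, f q) := hh.fderiv.continuousAt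
  have b3 : (fun t : ℝ => fderiv ℝ h (q + t • ξ, T (q + t • ξ))
      (0, Λ (0, t ^ (2 * e + 2) • z))) =O[𝓝 0] fun t => t ^ (2 * e + 2) := by
    have h1 : (fun t : ℝ => fderiv ℝ h (q + t • ξ, T (q + t • ξ)) (0, Λ (0, z))) =O[𝓝 0]
        fun _ => (1 : ℝ) := by
      refine Tendsto.isBigO_one (c := fderiv ℝ h (q, f q) (0, Λ (0, z))) ℝ ?_
      exact ((ContinuousLinearMap.apply ℝ ℝ ((0 : X), Λ (0, z))).continuous.tendsto _).comp
        (hfd.tendsto.comp cγ)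
    have h2 := (isBigO_refl (fun t : ℝ => t ^ (2 * e + 2)) (𝓝 0)).mul h1
    refine (h2.congr_left fun t => ?_).congr_right fun t => mul_one _
    have : ((0 : X), Λ (0, t ^ (2 * e + 2) • z)) = t ^ (2 * e + 2) • ((0 : X), Λ (0, z)) := by
      ext1
      · simp
      · simp only [Prod.smul_snd]; rw [← map_smul]; congr 1; ext1 <;> simp
    rw [this, map_smul, smul_eq_mul]
  refine ((b1.add b2).add b3).congr_left fun t => ?_
  have e1 : ((0 : X), Λ (t ^ (e + 1) • z', t ^ (2 * e + 2) • z)) =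
      t ^ (e + 1) • ((0 : X), Λ (z', 0)) + ((0 : X), Λ (0, t ^ (2 * e + 2) • z)) := by
    ext1
    · simp
    · simp only [Prod.smul_snd, Prod.snd_add]
      rw [← map_smul, ← map_add]; congr 1; ext1 <;> simp
  rw [e1, map_add, map_smul, smul_eq_mul]
  ring

/-- The leading term of `D` along a curve close to the graph of `f`. -/
theorem isBigO_sub_leading {D : X × F → ℝ} (hD : AnalyticAt ℝ D (q, f q)) (hf : ContinuousAt f q)
    {B : ContinuousMultilinearMap ℝ (fun _ : Fin e => X) ℝ}
    (hB : (fun x => D (x, f x) - B (fun _ => x - q)) =O[𝓝 q] fun x => ‖x - q‖ ^ (e + 1))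
    {ξ : X} {y : ℝ → F} (hy : (fun t => f (q + t • ξ) - y t) =O[𝓝 0] fun t => t ^ (e + 1)) :
    (fun t : ℝ => D (q + t • ξ, y t) - t ^ e * B (fun _ => ξ)) =O[𝓝 0] fun t => t ^ (e + 1) := by
  have hd : ContDiffAt ℝ 1 D (q, f q) := hD.contDiffAt
  obtain ⟨L, s, hs, hL⟩ := hd.exists_lipschitzOnWith
  have r1 := tendsto_ray q ξ
  have cΓ : Tendsto (fun t : ℝ => (q + t • ξ, f (q + t • ξ))) (𝓝 0) (𝓝 (q, f q)) :=
    r1.prodMk_nhds (hf.tendsto.comp r1)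
  have cy : Tendsto y (𝓝 0) (𝓝 (f q)) := by
    have h1 : Tendsto (fun t : ℝ => t ^ (e + 1)) (𝓝 0) (𝓝 0) := by
      have : Continuous fun t : ℝ => t ^ (e + 1) := by fun_prop
      simpa using this.tendsto 0
    have h2 := (hf.tendsto.comp r1).sub (hy.trans_tendsto h1)
    simpa using h2
  have cσ : Tendsto (fun t : ℝ => (q + t • ξ, y t)) (𝓝 0) (𝓝 (q, f q)) := r1.prodMk_nhds cy
  have b1 : (fun t : ℝ => D (q + t • ξ, y t) - D (q + t • ξ, f (q + t • ξ))) =O[𝓝 0]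
      fun t => t ^ (e + 1) := by
    refine IsBigO.trans ?_ hy
    refine IsBigO.of_bound L ?_
    filter_upwards [cσ.eventually hs, cΓ.eventually hs] with t h4 h5
    have := hL.dist_le_mul _ h4 _ h5
    rw [dist_eq_norm, dist_eq_norm] at this
    refine this.trans_eq ?_
    rw [Prod.mk_sub_mk, sub_self, Prod.norm_mk, norm_zero, max_eq_right (norm_nonneg _),
      norm_sub_rev]
  have b2 := isBigO_ray hB ξ
  refine (b1.add b2).congr_left fun t => ?_
  have e1 : (B fun _ => t • ξ) = t ^ e • B fun _ => ξ := by
    have := B.toMultilinearMap.map_smul_univ (fun _ => t) (fun _ => ξ)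
    simpa using this
  rw [add_sub_cancel_left, e1, smul_eq_mul]
  ring

theorem analyticAt_det {E : Type*} [NormedAddCommGroup E] [NormedSpace ℝ E] {n : ℕ}
    {A : E → Matrix (Fin n) (Fin n) ℝ} {a : E} (hA : ∀ i j, AnalyticAt ℝ (fun x => A x i j) a) :
    AnalyticAt ℝ (fun x => (A x).det) a := by
  simp only [Matrix.det_apply]
  refine Finset.analyticAt_fun_sum _ fun σ _ => ?_
  exact (Finset.analyticAt_fun_prod _ fun i _ => hA (σ i) i).const_smul

theorem analyticAt_adjugate {E : Type*} [NormedAddCommGroup E] [NormedSpace ℝ E] {n : ℕ}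
    {A : E → Matrix (Fin n) (Fin n) ℝ} {a : E} (hA : ∀ i j, AnalyticAt ℝ (fun x => A x i j) a)
    (i j : Fin n) : AnalyticAt ℝ (fun x => (A x).adjugate i j) a := by
  simp only [Matrix.adjugate_apply]
  refine analyticAt_det fun k l => ?_
  by_cases hk : k = j
  · simp only [hk, Matrix.updateRow_self]; exact analyticAt_const
  · simp only [Matrix.updateRow_ne hk]; exact hA k l

theorem analyticAt_jacMatrix {h : Fin r → X × F → ℝ} {w : Fin r → F} {p : X × F}
    (hh : ∀ i, AnalyticAt ℝ (h i) p) (i j : Fin r) :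
    AnalyticAt ℝ (fun p => jacMatrix h w p i j) p :=
  ((ContinuousLinearMap.apply ℝ ℝ ((0 : X), w j)).analyticAt _).fun_comp (hh i).fderiv

theorem fderiv_eq_jacMatrix_mulVec (h : Fin r → X × F → ℝ) (Λ : ((Fin r → ℝ) × G) ≃L[ℝ] F)
    (p : X × F) (z' : Fin r → ℝ) (i : Fin r) : fderiv ℝ (h i) p (0, Λ (z', 0)) =
      (jacMatrix h (fun j => Λ (Pi.single j 1, 0)) p).mulVec z' i := by
  set L : (Fin r → ℝ) →ₗ[ℝ] ℝ := ((fderiv ℝ (h i) p).comp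
    ((ContinuousLinearMap.inr ℝ X F).comp ((Λ : ((Fin r → ℝ) × G) →L[ℝ] F).comp
      (ContinuousLinearMap.inl ℝ (Fin r → ℝ) G)))).toLinearMap with hL
  have h1 : ∀ v, fderiv ℝ (h i) p (0, Λ (v, 0)) = L v := fun v => rfl
  rw [h1, LinearMap.pi_apply_eq_sum_univ L z', Matrix.mulVec, dotProduct]
  refine Finset.sum_congr rfl fun j _ => ?_
  rw [smul_eq_mul, mul_comm]
  congr 1
  have : (fun k => if j = k then (1 : ℝ) else 0) = Pi.single j 1 := by
    ext k; simp [Pi.single_apply, eq_comm]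
  rw [this]
  rfl

/-- Any point of the hyperplane where the last coordinate vanishes is a limit of points off it, so
continuity suffices. -/
theorem eventually_eq_zero_of_ne {Z : Type*} [NormedAddCommGroup Z] [NormedSpace ℝ Z]
    {u : Z × ℝ → ℝ} {o : Z × ℝ} (hu : AnalyticAt ℝ u o)
    (h : ∀ᶠ p in 𝓝 o, p.2 ≠ 0 → u p = 0) : ∀ᶠ p in 𝓝 o, u p = 0 := by
  filter_upwards [hu.eventually_analyticAt, h.eventually_nhds] with p h1 h2
  by_cases hp : p.2 = 0
  · have t1 : Tendsto (fun s : ℝ => (p.1, s)) (𝓝[≠] 0) (𝓝 p) := by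
      have : Continuous fun s : ℝ => (p.1, s) := by fun_prop
      have := (this.tendsto 0).mono_left (nhdsWithin_le_nhds (s := {0}ᶜ))
      rw [← hp, Prod.mk.eta] at this
      rwa [hp] at this
    have t2 : Tendsto (fun s : ℝ => u (p.1, s)) (𝓝[≠] 0) (𝓝 (u p)) :=
      h1.continuousAt.tendsto.comp t1
    refine tendsto_nhds_unique (t2.congr' ?_) tendsto_const_nhds
    filter_upwards [t1.eventually h2, self_mem_nhdsWithin] with s h3 h4
    exact h3 h4
  · exact h2.self_of_nhds hp

theorem isBigO_inv_pow_smul {E : Type*} [NormedAddCommGroup E] [NormedSpace ℝ E] {v : ℝ → E}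
    (m k : ℕ) (hv : v =O[𝓝[≠] 0] fun t => t ^ (m + k)) :
    (fun t : ℝ => (t ^ m)⁻¹ • v t) =O[𝓝[≠] 0] fun t => t ^ k := by
  have h1 := (isBigO_refl (fun t : ℝ => (t ^ m)⁻¹) (𝓝[≠] 0)).smul hv
  refine h1.congr' EventuallyEq.rfl ?_
  filter_upwards [self_mem_nhdsWithin] with t ht
  have : t ^ m ≠ 0 := pow_ne_zero m ht
  rw [smul_eq_mul, pow_add]
  field_simp

/-- A graph satisfying enough equations to infinite order is, up to infinite order, contained in
the image of an analytic parametrization of the zero set of the equations. -/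
theorem exists_blowUp_parametrization [FiniteDimensional ℝ X] [FiniteDimensional ℝ G]
    [FiniteDimensional ℝ F] {h : Fin r → X × F → ℝ} (hh : ∀ i, AnalyticAt ℝ (h i) (q, f q))
    (hf : ContDiffAt ℝ ∞ f q) (hflat : ∀ i, IsFlatAt (fun x => h i (x, f x)) q)
    (Λ : ((Fin r → ℝ) × G) ≃L[ℝ] F)
    {B : ContinuousMultilinearMap ℝ (fun _ : Fin e => X) ℝ}
    (hB : (fun x => (jacMatrix h (fun j => Λ (Pi.single j 1, 0)) (x, f x)).det -
      B (fun _ => x - q)) =O[𝓝 q] fun x => ‖x - q‖ ^ (e + 1)) {ξ₀ : X} (hξ₀ : B (fun _ => ξ₀) ≠ 0) :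
    ∃ T : X → F, (∀ x, AnalyticAt ℝ T x) ∧ T q = f q ∧ ∃ ζ : (X × G) × ℝ → (Fin r → ℝ),
      AnalyticAt ℝ ζ ((ξ₀, 0), 0) ∧
      (∀ᶠ p in 𝓝 (((ξ₀, 0), 0) : (X × G) × ℝ), ∀ i,
        h i (blowUp q T Λ e p.1.1 p.1.2 (ζ p) p.2) = 0) ∧
      (∃ U : (X × G) × ℝ → ℝ, AnalyticAt ℝ U ((ξ₀, 0), 0) ∧ U ((ξ₀, 0), 0) ≠ 0 ∧
        ∀ᶠ p in 𝓝 (((ξ₀, 0), 0) : (X × G) × ℝ),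
          (jacMatrix h (fun j => Λ (Pi.single j 1, 0))
            (blowUp q T Λ e p.1.1 p.1.2 (ζ p) p.2)).det = p.2 ^ e * U p) ∧
      ∀ᶠ ξ in 𝓝 ξ₀, ∃ z : ℝ → G, Tendsto z (𝓝[≠] 0) (𝓝 0) ∧ ∀ n : ℕ,
        (fun t : ℝ => f (q + t • ξ) - (blowUp q T Λ e ξ (z t) (ζ ((ξ, z t), t)) t).2) =O[𝓝[≠] 0]
          fun t => t ^ n := by
  set w : Fin r → F := fun j => Λ (Pi.single j 1, 0) with hw
  -- the Taylor polynomial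
  set T : X → F := fun x => ∑ k ∈ Finset.range (2 * e + 3), taylorSeries f q k (fun _ => x - q)
    with hT
  have hTA : ∀ x, AnalyticAt ℝ T x := by
    intro x
    refine Finset.analyticAt_fun_sum _ fun k _ => ?_
    exact AnalyticAt.fun_comp (g := fun y => taylorSeries f q k (fun _ => y))
      ((taylorSeries f q k).analyticAt_diag _) (analyticAt_id.sub analyticAt_const)
  have hfT : (fun x => f x - T x) =O[𝓝 q] fun x => ‖x - q‖ ^ (2 * e + 3) :=
    hf.taylor_isBigO (2 * e + 3)
  have hTq : T q = f q := by
    have h1 : Tendsto (fun x => ‖x - q‖ ^ (2 * e + 3)) (𝓝 q) (𝓝 0) := by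
      have : Continuous fun x => ‖x - q‖ ^ (2 * e + 3) := by fun_prop
      simpa using this.tendsto q
    have h2 := hfT.trans_tendsto h1
    have h3 : Tendsto (fun x => f x - T x) (𝓝 q) (𝓝 (f q - T q)) :=
      hf.continuousAt.sub (hTA q).continuousAt
    exact (sub_eq_zero.1 (tendsto_nhds_unique h3 h2)).symm
  refine ⟨T, hTA, hTq, ?_⟩
  set D : X × F → ℝ := fun p => (jacMatrix h w p).det with hD
  have hDA : AnalyticAt ℝ D (q, f q) := analyticAt_det (analyticAt_jacMatrix hh)
  -- the parametrizations
  set γ : X × ℝ → X × F := fun p => (q + p.2 • p.1, T (q + p.2 • p.1)) with hγ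
  have hrayA : ∀ p : X × ℝ, AnalyticAt ℝ (fun p : X × ℝ => q + p.2 • p.1) p := fun p =>
    analyticAt_const.add (analyticAt_snd.smul analyticAt_fst)
  have hγA : ∀ p, AnalyticAt ℝ γ p := fun p =>
    (hrayA p).prod (AnalyticAt.fun_comp (g := T) (hTA _) (hrayA p))
  have hγ0 : ∀ ξ, γ (ξ, 0) = (q, f q) := by intro ξ; simp [hγ, hTq]
  set σ : ((X × G) × (Fin r → ℝ)) × ℝ → X × F := fun p =>
    blowUp q T Λ e p.1.1.1 p.1.1.2 p.1.2 p.2 with hσ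
  have hσA : ∀ p, AnalyticAt ℝ σ p := by
    intro p
    have h1 : AnalyticAt ℝ (fun p : ((X × G) × (Fin r → ℝ)) × ℝ => q + p.2 • p.1.1.1) p :=
      analyticAt_const.add (analyticAt_snd.smul
        (((ContinuousLinearMap.fst ℝ X G).comp ((ContinuousLinearMap.fst ℝ _ (Fin r → ℝ)).comp
          (ContinuousLinearMap.fst ℝ _ ℝ))).analyticAt p))
    have h2 : AnalyticAt ℝ (fun p : ((X × G) × (Fin r → ℝ)) × ℝ =>
        (p.2 ^ (e + 1) • p.1.2, p.2 ^ (2 * e + 2) • p.1.1.2)) p :=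
      ((analyticAt_snd.pow _).smul (((ContinuousLinearMap.snd ℝ _ (Fin r → ℝ)).comp
          (ContinuousLinearMap.fst ℝ _ ℝ)).analyticAt p)).prod
        ((analyticAt_snd.pow _).smul (((ContinuousLinearMap.snd ℝ X G).comp
          ((ContinuousLinearMap.fst ℝ _ (Fin r → ℝ)).comp
          (ContinuousLinearMap.fst ℝ _ ℝ))).analyticAt p))
    exact h1.prod ((AnalyticAt.fun_comp (g := T) (hTA _) h1).add
      (AnalyticAt.fun_comp (g := Λ) ((Λ : ((Fin r → ℝ) × G) →L[ℝ] F).analyticAt _) h2))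
  have hσ0 : ∀ z, σ (z, 0) = (q, f q) := by
    intro z
    simp [hσ, blowUp, hTq]
  have hJγ : ∀ ξ i j, AnalyticAt ℝ (fun p : X × ℝ => jacMatrix h w (γ p) i j) (ξ, 0) :=
    fun ξ i j => AnalyticAt.fun_comp_of_eq (g := fun p => jacMatrix h w p i j)
      (analyticAt_jacMatrix hh i j) (hγA _) (hγ0 ξ)
  have hDasym : ∀ ξ (y : ℝ → F), (fun t => f (q + t • ξ) - y t) =O[𝓝 0] (fun t => t ^ (e + 1)) →
      (fun t : ℝ => D (q + t • ξ, y t) - t ^ e * B (fun _ => ξ)) =O[𝓝 0] fun t => t ^ (e + 1) :=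
    fun ξ y hy => isBigO_sub_leading hDA hf.continuousAt hB hy
  have hTray : ∀ ξ, (fun t : ℝ => f (q + t • ξ) - T (q + t • ξ)) =O[𝓝 0]
      fun t => t ^ (2 * e + 3) := fun ξ => isBigO_ray hfT ξ
  have hDγ : ∀ ξ, (fun t : ℝ => D (γ (ξ, t)) - t ^ e * B (fun _ => ξ)) =O[𝓝 0]
      fun t => t ^ (e + 1) := fun ξ =>
    hDasym ξ _ ((hTray ξ).trans (isBigO_pow_of_le (by omega)))
  obtain ⟨U₁, hU₁A, hU₁, hU₁c⟩ := AnalyticAt.exists_pow_factor (n := e)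
    (AnalyticAt.fun_comp_of_eq (g := D) hDA (hγA (ξ₀, 0)) (hγ0 ξ₀))
    (Eventually.of_forall hDγ)
  have hU₁0 : U₁ (ξ₀, 0) ≠ 0 := by rw [hU₁c.self_of_nhds]; exact hξ₀
  -- the equations, solved for the leading term
  set Φ : Fin r → ((X × G) × (Fin r → ℝ)) × ℝ → ℝ := fun k p =>
    ∑ i, (jacMatrix h w (γ (p.1.1.1, p.2))).adjugate k i * h i (σ p) with hΦ
  have hξt : ∀ p : ((X × G) × (Fin r → ℝ)) × ℝ, AnalyticAt ℝ
      (fun p : ((X × G) × (Fin r → ℝ)) × ℝ => (p.1.1.1, p.2)) p := fun p =>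
    (((ContinuousLinearMap.fst ℝ X G).comp ((ContinuousLinearMap.fst ℝ _ (Fin r → ℝ)).comp
          (ContinuousLinearMap.fst ℝ _ ℝ))).analyticAt p).prod analyticAt_snd
  have hΦA : ∀ k z, AnalyticAt ℝ (Φ k) (z, 0) := by
    intro k z
    refine Finset.analyticAt_fun_sum _ fun i _ => ?_
    refine AnalyticAt.mul ?_ (AnalyticAt.fun_comp_of_eq (g := h i) (hh i) (hσA _) (hσ0 z))
    exact AnalyticAt.fun_comp_of_eq
      (g := fun p : X × ℝ => (jacMatrix h w (γ p)).adjugate k i)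
      (analyticAt_adjugate (hJγ z.1.1) k i) (hξt _) rfl
  have hΦasym : ∀ k z, (fun t : ℝ => Φ k (z, t) - t ^ (2 * e + 1) * (B (fun _ => z.1.1) * z.2 k))
      =O[𝓝 0] fun t => t ^ (2 * e + 1 + 1) := by
    rintro k ⟨⟨ξ, z⟩, z'⟩
    have a1 : (fun t : ℝ => ∑ i, (jacMatrix h w (γ (ξ, t))).adjugate k i *
        (h i (blowUp q T Λ e ξ z z' t) - t ^ (e + 1) * fderiv ℝ (h i) (γ (ξ, t)) (0, Λ (z', 0))))
        =O[𝓝 0] fun t => t ^ (2 * e + 1 + 1) := by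
      refine IsBigO.fun_sum fun i _ => ?_
      have b1 := isBigO_sub_fderiv_of_flat (hh i) hf.continuousAt (hflat i) hfT
        (hTA q).continuousAt Λ ξ z z'
      have b2 : (fun t : ℝ => (jacMatrix h w (γ (ξ, t))).adjugate k i) =O[𝓝 0]
          fun _ => (1 : ℝ) := by
        have : ContinuousAt (fun t : ℝ => (jacMatrix h w (γ (ξ, t))).adjugate k i) 0 :=
          ContinuousAt.comp_of_eq (g := fun p : X × ℝ => (jacMatrix h w (γ p)).adjugate k i)
            (f := fun t : ℝ => (ξ, t)) (analyticAt_adjugate (hJγ ξ) k i).continuousAt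
            (by fun_prop) rfl
        exact this.isBigO_one (F := ℝ)
      simpa using b2.mul b1
    have a2 := ((isBigO_refl (fun t : ℝ => t ^ (e + 1)) (𝓝 0)).mul (hDγ ξ)).const_mul_left (z' k)
    have a3 : (fun t : ℝ => t ^ (e + 1) * t ^ (e + 1)) = fun t => t ^ (2 * e + 1 + 1) := by
      ext t; ring
    rw [a3] at a2
    refine (a1.add a2).congr_left fun t => ?_
    -- The adjugate decouples the linear part: the system becomes `D • z'`, with `D` of order `t ^
    -- e`.
    have a4 : ∑ i, (jacMatrix h w (γ (ξ, t))).adjugate k i *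
        fderiv ℝ (h i) (γ (ξ, t)) (0, Λ (z', 0)) = D (γ (ξ, t)) * z' k := by
      simp_rw [fderiv_eq_jacMatrix_mulVec]
      change (jacMatrix h w (γ (ξ, t))).adjugate.mulVec
        ((jacMatrix h w (γ (ξ, t))).mulVec z') k = _
      rw [Matrix.mulVec_mulVec, Matrix.adjugate_mul, Matrix.smul_mulVec, Matrix.one_mulVec]
      rfl
    simp only [mul_sub, Finset.sum_sub_distrib, hΦ, hσ]
    have a5 : ∑ i, (jacMatrix h w (γ (ξ, t))).adjugate k i *
        (t ^ (e + 1) * fderiv ℝ (h i) (γ (ξ, t)) (0, Λ (z', 0))) =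
        t ^ (e + 1) * (D (γ (ξ, t)) * z' k) := by
      rw [← a4, Finset.mul_sum]
      exact Finset.sum_congr rfl fun i _ => by ring
    rw [a5]
    ring
  set z₀ : (X × G) × (Fin r → ℝ) := ((ξ₀, 0), 0) with hz₀
  -- Dividing by `t ^ (2 * e + 1)` leaves a system which at `t = 0` reads `B(ξ) • z'`. It is
  -- nondegenerate near `ξ₀`, so the implicit function theorem solves it for `z' = ζ(ξ, z, t)`.
  have hQex := fun k => AnalyticAt.exists_pow_factor (hΦA k z₀) (Eventually.of_forall (hΦasym k))
  choose Q hQA hQ hQc using hQex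
  set swap : ((X × G) × ℝ) × (Fin r → ℝ) → ((X × G) × (Fin r → ℝ)) × ℝ := fun p =>
    ((p.1.1, p.2), p.1.2) with hswap
  have hswapA : ∀ p, AnalyticAt ℝ swap p := fun p =>
    ((((ContinuousLinearMap.fst ℝ (X × G) ℝ).comp (ContinuousLinearMap.fst ℝ _ _)).prod
      (ContinuousLinearMap.snd ℝ _ (Fin r → ℝ))).prod
      ((ContinuousLinearMap.snd ℝ (X × G) ℝ).comp (ContinuousLinearMap.fst ℝ _ _))).analyticAt p
  set g : ((X × G) × ℝ) × (Fin r → ℝ) → (Fin r → ℝ) := fun p k => Q k (swap p) with hg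
  have hgA : AnalyticAt ℝ g (((ξ₀, 0), 0), 0) :=
    AnalyticAt.pi fun k => AnalyticAt.fun_comp_of_eq (g := Q k) (hQA k) (hswapA _) rfl
  have hg0 : ∀ᶠ v in 𝓝 (0 : Fin r → ℝ), g (((ξ₀, 0), 0), v) = B (fun _ => ξ₀) • (v - 0) := by
    have t1 : Tendsto (fun v : Fin r → ℝ => (((ξ₀, 0), v) : (X × G) × (Fin r → ℝ))) (𝓝 0)
        (𝓝 z₀) := by
      have : Continuous fun v : Fin r → ℝ => (((ξ₀, 0), v) : (X × G) × (Fin r → ℝ)) := by fun_prop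
      exact this.tendsto 0
    filter_upwards [t1.eventually (eventually_all.2 hQc)] with v hv
    ext k
    simp only [hg, hswap, hv k, sub_zero, Pi.smul_apply, smul_eq_mul]
  obtain ⟨ζ, hζA, hζ0, hζz, C, hC⟩ := hgA.exists_implicit hξ₀ hg0
  set o : (X × G) × ℝ := ((ξ₀, 0), 0) with ho
  set S : (X × G) × ℝ → X × F := fun p => blowUp q T Λ e p.1.1 p.1.2 (ζ p) p.2 with hS
  have hgraphA : AnalyticAt ℝ (fun p => (p, ζ p)) o := analyticAt_id.prod hζA
  have hSA : AnalyticAt ℝ S o := AnalyticAt.fun_comp (g := σ) (hσA _)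
    (AnalyticAt.fun_comp (g := swap) (hswapA _) hgraphA)
  have hS0 : S o = (q, f q) := hσ0 ((ξ₀, 0), ζ o)
  have hgraph : Tendsto (fun p => (p, ζ p)) (𝓝 o) (𝓝 (o, 0)) := by
    have := hgraphA.continuousAt.tendsto
    rwa [hζ0] at this
  have hswap0 : Tendsto swap (𝓝 (o, 0)) (𝓝 (z₀, 0)) := (hswapA _).continuousAt.tendsto
  have hQall : ∀ᶠ p in 𝓝 (o, (0 : Fin r → ℝ)),
      ∀ k, Φ k (swap p) = (swap p).2 ^ (2 * e + 1) * Q k (swap p) :=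
    hswap0.eventually (eventually_all.2 hQ)
  have hζtend : ∀ {P : (X × G) × ℝ → Prop}, (∀ᶠ p in 𝓝 o, P p) →
      ∀ᶠ z in 𝓝 ((ξ₀, 0) : X × G), ∀ᶠ p in 𝓝 (z, (0 : ℝ)), P p := by
    intro P hP
    have : Continuous fun z : X × G => (z, (0 : ℝ)) := by fun_prop
    exact (this.tendsto (ξ₀, 0)).eventually hP.eventually_nhds
  refine ⟨ζ, hζA, ?_, ?_, ?_⟩
  · refine eventually_all.2 fun i => ?_
    -- For `t ≠ 0` the Jacobian matrix on the Taylor graph is invertible, its determinant being `t ^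
    -- e` times a unit, so the adjugated equations imply the original ones.
    refine eventually_eq_zero_of_ne (AnalyticAt.fun_comp_of_eq (g := h i) (hh i) hSA hS0) ?_
    have t1 : Tendsto (fun p : (X × G) × ℝ => (p.1.1, p.2)) (𝓝 o) (𝓝 (ξ₀, 0)) := by
      have : Continuous fun p : (X × G) × ℝ => (p.1.1, p.2) := by fun_prop
      exact this.tendsto o
    filter_upwards [hgraph.eventually hQall, hζz, t1.eventually hU₁,
      t1.eventually (hU₁A.continuousAt.eventually_ne hU₁0)] with p h1 h2 h3 h4 hp
    have h5 : (jacMatrix h w (γ (p.1.1, p.2))).adjugate.mulVec (fun i => h i (S p)) = 0 := by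
      ext k
      have : Q k (swap (p, ζ p)) = 0 := congrFun h2 k
      have h6 := h1 k
      rw [this, mul_zero] at h6
      exact h6
    have h7 := congrArg (fun v => (jacMatrix h w (γ (p.1.1, p.2))).mulVec v i) h5
    simp only [Matrix.mulVec_mulVec, Matrix.mul_adjugate, Matrix.smul_mulVec, Matrix.one_mulVec,
      Matrix.mulVec_zero, Pi.smul_apply, Pi.zero_apply, smul_eq_mul] at h7
    refine (mul_eq_zero.1 h7).resolve_left ?_
    have h8 : (jacMatrix h w (γ (p.1.1, p.2))).det = p.2 ^ e * U₁ (p.1.1, p.2) := h3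
    rw [h8]
    exact mul_ne_zero (pow_ne_zero e hp) h4
  · obtain ⟨U, hUA, hU, hUc⟩ := AnalyticAt.exists_pow_factor (n := e)
      (h := fun p => D (S p)) (z₀ := (ξ₀, 0)) (c := fun z => B (fun _ => z.1))
      (AnalyticAt.fun_comp_of_eq (g := D) hDA hSA hS0) (by
        filter_upwards [hζtend hζA.eventually_analyticAt] with z hz
        refine hDasym z.1 _ ?_
        have h1 := (hTray z.1).trans (isBigO_pow_of_le (show e + 1 ≤ 2 * e + 3 by omega))
        have h2 : (fun t : ℝ => Λ (t ^ (e + 1) • ζ (z, t), t ^ (2 * e + 2) • z.2)) =O[𝓝 0]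
            fun t => t ^ (e + 1) := by
          refine (Λ : ((Fin r → ℝ) × G) →L[ℝ] F).isBigO_comp _ _ |>.trans ?_
          refine IsBigO.prod_left ?_ (isBigO_smul_const _ _ (by omega) z.2)
          have h3 : (fun t : ℝ => ζ (z, t)) =O[𝓝 0] fun _ => (1 : ℝ) := by
            have : ContinuousAt (fun t : ℝ => ζ (z, t)) 0 :=
              ContinuousAt.comp_of_eq (g := ζ) (f := fun t : ℝ => (z, t))
                hz.self_of_nhds.continuousAt (by fun_prop) rfl
            exact this.isBigO_one (F := ℝ)
          simpa using (isBigO_refl (fun t : ℝ => t ^ (e + 1)) (𝓝 0)).smul h3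
        refine (h1.sub h2).congr_left fun t => ?_
        simp only [blowUp]
        abel)
    refine ⟨U, hUA, ?_, hU⟩
    rw [ho, hUc.self_of_nhds]
    exact hξ₀
  · have hξ : Tendsto (fun ξ : X => ((((ξ, 0), 0), 0) : ((X × G) × ℝ) × (Fin r → ℝ))) (𝓝 ξ₀)
        (𝓝 (o, 0)) := by
      have : Continuous fun ξ : X => ((((ξ, 0), 0), 0) : ((X × G) × ℝ) × (Fin r → ℝ)) := by
        fun_prop
      exact this.tendsto ξ₀
    filter_upwards [hξ.eventually (hC.and hQall).eventually_nhds] with ξ hR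
    -- The graph of `f` itself in blow-up coordinates. Since `T` approximates `f` to order `2 * e +
    -- 3`, both rescaled components tend to `0` with `t`.
    set y : ℝ → (Fin r → ℝ) × G := fun t => Λ.symm (f (q + t • ξ) - T (q + t • ξ)) with hy
    have hyO : y =O[𝓝[≠] 0] fun t => t ^ (2 * e + 3) :=
      ((Λ.symm : F →L[ℝ] (Fin r → ℝ) × G).isBigO_comp _ _).trans
        ((hTray ξ).mono nhdsWithin_le_nhds)
    have hpow : ∀ k, k ≠ 0 → Tendsto (fun t : ℝ => t ^ k) (𝓝[≠] 0) (𝓝 0) := by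
      intro k hk
      have : Continuous fun t : ℝ => t ^ k := by fun_prop
      have := (this.tendsto 0).mono_left (nhdsWithin_le_nhds (s := {0}ᶜ))
      rwa [zero_pow hk] at this
    have hz2 : Tendsto (fun t : ℝ => (t ^ (2 * e + 2))⁻¹ • (y t).2) (𝓝[≠] 0) (𝓝 0) :=
      (isBigO_inv_pow_smul (2 * e + 2) 1 (IsBigO.trans isBigO_snd_prod' hyO)).trans_tendsto
        (hpow 1 one_ne_zero)
    have hz1 : Tendsto (fun t : ℝ => (t ^ (e + 1))⁻¹ • (y t).1) (𝓝[≠] 0) (𝓝 0) :=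
      (isBigO_inv_pow_smul (e + 1) (e + 2) ((IsBigO.trans isBigO_fst_prod' hyO).congr_right
        fun t => by ring)).trans_tendsto (hpow (e + 2) (by omega))
    refine ⟨fun t => (t ^ (2 * e + 2))⁻¹ • (y t).2, hz2, fun n => ?_⟩
    set c : ℝ → ((X × G) × ℝ) × (Fin r → ℝ) := fun t =>
      (((ξ, (t ^ (2 * e + 2))⁻¹ • (y t).2), t), (t ^ (e + 1))⁻¹ • (y t).1) with hc
    have hct : Tendsto c (𝓝[≠] 0) (𝓝 (((ξ, 0), 0), 0)) :=
      ((tendsto_const_nhds.prodMk_nhds hz2).prodMk_nhds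
        (tendsto_id.mono_left nhdsWithin_le_nhds)).prodMk_nhds hz1
    have hσc : ∀ᶠ t in 𝓝[≠] (0 : ℝ), σ (swap (c t)) = (q + t • ξ, f (q + t • ξ)) := by
      filter_upwards [self_mem_nhdsWithin] with t ht
      have h1 : t ^ (e + 1) ≠ 0 := pow_ne_zero _ ht
      have h2 : t ^ (2 * e + 2) ≠ 0 := pow_ne_zero _ ht
      simp only [hσ, hswap, hc, blowUp, smul_smul, mul_inv_cancel₀ h1, mul_inv_cancel₀ h2,
        one_smul, hy, Prod.mk.eta, Λ.apply_symm_apply, add_sub_cancel]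
    have hΦO : ∀ k m, (fun t : ℝ => Φ k (swap (c t))) =O[𝓝[≠] 0] fun t => t ^ m := by
      intro k m
      have b1 : (fun t : ℝ => ∑ i, (jacMatrix h w (γ (ξ, t))).adjugate k i *
          h i (q + t • ξ, f (q + t • ξ))) =O[𝓝 0] fun t => t ^ m := by
        refine IsBigO.fun_sum fun i _ => ?_
        have b2 : (fun t : ℝ => (jacMatrix h w (γ (ξ, t))).adjugate k i) =O[𝓝 0]
            fun _ => (1 : ℝ) := by
          have : ContinuousAt (fun t : ℝ => (jacMatrix h w (γ (ξ, t))).adjugate k i) 0 :=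
            ContinuousAt.comp_of_eq (g := fun p : X × ℝ => (jacMatrix h w (γ p)).adjugate k i)
              (f := fun t : ℝ => (ξ, t)) (analyticAt_adjugate (hJγ ξ) k i).continuousAt
              (by fun_prop) rfl
          exact this.isBigO_one (F := ℝ)
        simpa using b2.mul ((hflat i).comp_ray ξ m)
      refine (b1.mono nhdsWithin_le_nhds).congr' ?_ EventuallyEq.rfl
      filter_upwards [hσc] with t ht
      simp only [hΦ, ht]
      rfl
    have hQO : ∀ k m, (fun t : ℝ => Q k (swap (c t))) =O[𝓝[≠] 0] fun t => t ^ m := by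
      intro k m
      refine (isBigO_inv_pow_smul (2 * e + 1) m (hΦO k (2 * e + 1 + m))).congr' ?_ EventuallyEq.rfl
      filter_upwards [hct.eventually hR, self_mem_nhdsWithin] with t h1 ht
      have h2 : t ^ (2 * e + 1) ≠ 0 := pow_ne_zero _ ht
      have h3 : (swap (c t)).2 = t := rfl
      rw [h1.2 k, h3, smul_eq_mul, inv_mul_cancel_left₀ h2]
    -- The graph solves the reduced system to infinite order, so by the quantitative uniqueness of
    -- implicit functions its `z'`-coordinate agrees with `ζ` to infinite order.
    have hdiff : (fun t : ℝ => (c t).2 - ζ (c t).1) =O[𝓝[≠] 0] fun t => t ^ n := by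
      have h1 : (fun t : ℝ => g (c t)) =O[𝓝[≠] 0] fun t => t ^ n :=
        isBigO_pi.2 fun k => hQO k n
      refine IsBigO.trans (IsBigO.of_bound C ?_) h1
      filter_upwards [hct.eventually hR] with t h2
      exact h2.1
    have hfin : (fun t : ℝ => Λ (t ^ (e + 1) • ((c t).2 - ζ (c t).1), 0)) =O[𝓝[≠] 0]
        fun t => t ^ n := by
      refine (Λ : ((Fin r → ℝ) × G) →L[ℝ] F).isBigO_comp _ _ |>.trans ?_
      refine IsBigO.prod_left ?_ (isBigO_zero _ _)
      have h3 : (fun t : ℝ => t ^ (e + 1)) =O[𝓝[≠] 0] fun _ => (1 : ℝ) :=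
        (hpow (e + 1) (by omega)).isBigO_one ℝ
      simpa using h3.smul hdiff
    refine hfin.congr' ?_ EventuallyEq.rfl
    filter_upwards [self_mem_nhdsWithin] with t ht
    have h1 : t ^ (e + 1) ≠ 0 := pow_ne_zero _ ht
    have h2 : t ^ (2 * e + 2) ≠ 0 := pow_ne_zero _ ht
    have h3 : Λ (y t) = f (q + t • ξ) - T (q + t • ξ) := Λ.apply_symm_apply _
    simp only [blowUp, hc, smul_sub, smul_smul, mul_inv_cancel₀ h1, mul_inv_cancel₀ h2, one_smul]
    rw [← sub_sub, ← h3, ← map_sub]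
    congr 1
    ext1 <;> simp

end BlowUp

/-! ### Ideals of analytic germs stable under differentiation up to powers of a coordinate. -/

section Ideal

variable {E : Type*} [NormedAddCommGroup E] [NormedSpace ℝ E]

/-- The ideal generated by `𝒢` in the ring of germs at `o` of analytic functions. -/
inductive AnalyticIdeal (o : E) (𝒢 : Set (E → ℝ)) : (E → ℝ) → Prop
  | zero : AnalyticIdeal o 𝒢 fun _ => 0
  | base {g : E → ℝ} : g ∈ 𝒢 → AnalyticIdeal o 𝒢 g
  | mul {a g : E → ℝ} : AnalyticAt ℝ a o → AnalyticIdeal o 𝒢 g →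
      AnalyticIdeal o 𝒢 fun x => a x * g x
  | add {g h : E → ℝ} : AnalyticIdeal o 𝒢 g → AnalyticIdeal o 𝒢 h →
      AnalyticIdeal o 𝒢 fun x => g x + h x
  | congr {g h : E → ℝ} : AnalyticIdeal o 𝒢 g → g =ᶠ[𝓝 o] h → AnalyticIdeal o 𝒢 h

namespace AnalyticIdeal

variable {o : E} {𝒢 : Set (E → ℝ)} {η : E → ℝ}

theorem sum {ι : Type*} (s : Finset ι) {g : ι → E → ℝ} (h : ∀ i ∈ s, AnalyticIdeal o 𝒢 (g i)) :
    AnalyticIdeal o 𝒢 fun x => ∑ i ∈ s, g i x := by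
  classical
  induction s using Finset.induction_on with
  | empty => simpa using zero
  | insert i s hi ih =>
    simp only [Finset.sum_insert hi]
    exact (h i (Finset.mem_insert_self i s)).add
      (ih fun j hj => h j (Finset.mem_insert_of_mem hj))

theorem analyticAt (h𝒢 : ∀ g ∈ 𝒢, AnalyticAt ℝ g o) (h : AnalyticIdeal o 𝒢 η) :
    AnalyticAt ℝ η o := by
  induction h with
  | zero => exact analyticAt_const
  | base hg => exact h𝒢 _ hg
  | mul ha _ ih => exact ha.fun_mul ih
  | add _ _ ih1 ih2 => exact ih1.fun_add ih2
  | congr _ he ih => exact ih.congr he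

/-- By the Leibniz rule it is enough to check stability on generators; multiplication by `τ` makes
up for derivatives that leave the ideal. -/
theorem mul_fderiv (h𝒢 : ∀ g ∈ 𝒢, AnalyticAt ℝ g o) {τ : E → ℝ} (hτ : AnalyticAt ℝ τ o) {w : E}
    (hd : ∀ g ∈ 𝒢, AnalyticIdeal o 𝒢 fun x => τ x * fderiv ℝ g x w) (h : AnalyticIdeal o 𝒢 η) :
    AnalyticIdeal o 𝒢 fun x => τ x * fderiv ℝ η x w := by
  induction h with
  | zero => simpa using zero
  | base hg => exact hd _ hg
  | @mul a g ha hg ih =>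
    have h1 : AnalyticAt ℝ (fun x => τ x * fderiv ℝ a x w) o :=
      hτ.fun_mul (((ContinuousLinearMap.apply ℝ ℝ w).analyticAt _).fun_comp ha.fderiv)
    refine ((mul ha ih).add (mul h1 hg)).congr ?_
    filter_upwards [ha.eventually_analyticAt, (hg.analyticAt h𝒢).eventually_analyticAt]
      with x h2 h3
    rw [fderiv_fun_mul h2.differentiableAt h3.differentiableAt]
    simp only [_root_.add_apply, _root_.smul_apply, smul_eq_mul]
    ring
  | add hg hh ih1 ih2 =>
    refine (ih1.add ih2).congr ?_
    filter_upwards [(hg.analyticAt h𝒢).eventually_analyticAt,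
      (hh.analyticAt h𝒢).eventually_analyticAt] with x h2 h3
    rw [fderiv_fun_add h2.differentiableAt h3.differentiableAt]
    simp only [_root_.add_apply]
    ring
  | congr hg he ih =>
    refine ih.congr ?_
    filter_upwards [he.eventuallyEq_nhds] with x hx
    rw [hx.fderiv_eq]

theorem isBigO {γ : ℝ → E} {l : Filter ℝ} (hγ : Tendsto γ l (𝓝 o)) (n : ℕ)
    (h𝒢 : ∀ g ∈ 𝒢, (fun t => g (γ t)) =O[l] fun t => t ^ n) (h : AnalyticIdeal o 𝒢 η) :
    (fun t => η (γ t)) =O[l] fun t => t ^ n := by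
  induction h with
  | zero => exact isBigO_zero _ _
  | base hg => exact h𝒢 _ hg
  | mul ha _ ih =>
    have h1 := (ha.continuousAt.tendsto.comp hγ).isBigO_one ℝ
    simpa using h1.mul ih
  | add _ _ ih1 ih2 => exact ih1.add ih2
  | congr _ he ih => exact ih.congr' (hγ.eventually he) EventuallyEq.rfl

end AnalyticIdeal

/-- If an ideal of analytic germs is closed under differentiation up to powers of the last
coordinate, and vanishes to infinite order along a curve transverse to the hyperplane where this
coordinate is zero, then it is zero. -/
theorem eventually_eq_zero_of_differential_ideal {Z : Type*} [NormedAddCommGroup Z]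
    [NormedSpace ℝ Z] {o : Z × ℝ} {𝒢 : Set (Z × ℝ → ℝ)} (h𝒢 : ∀ g ∈ 𝒢, AnalyticAt ℝ g o) (k : ℕ)
    (hd : ∀ g ∈ 𝒢, ∀ w, AnalyticIdeal o 𝒢 fun x => x.2 ^ k * fderiv ℝ g x w) {z : ℝ → Z}
    (hz : Tendsto (fun t => (z t, t)) (𝓝[≠] 0) (𝓝 o))
    (hO : ∀ n : ℕ, ∀ g ∈ 𝒢, (fun t => g (z t, t)) =O[𝓝[≠] 0] fun t => t ^ n)
    {g : Z × ℝ → ℝ} (hg : g ∈ 𝒢) : ∀ᶠ x in 𝓝 o, g x = 0 := by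
  have hs : ∀ x : Z × ℝ, AnalyticAt ℝ (fun x : Z × ℝ => x.2) x := fun x =>
    (ContinuousLinearMap.snd ℝ Z ℝ).analyticAt x
  -- Saturate the ideal by powers of the last coordinate `t`. The saturation is closed under
  -- derivatives, because `t ^ (k + 1 + j) ∂η` equals `t * t ^ k ∂(t ^ j η)` minus a multiple of `t
  -- ^ j η`. Its members vanish at `o`, because `t ^ j η` is `O(t ^ (j + 1))` along the curve.
  refine eventuallyEq_zero_of_fderiv_mem (o := o) (𝒩 := {η | AnalyticAt ℝ η o ∧
    ∃ j : ℕ, AnalyticIdeal o 𝒢 fun x => x.2 ^ j * η x}) (fun η h => h.1) ?_ ?_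
    ⟨h𝒢 g hg, 0, by simpa using AnalyticIdeal.base hg⟩
  · rintro η ⟨hη, j, hj⟩ w
    refine ⟨((ContinuousLinearMap.apply ℝ ℝ w).analyticAt _).fun_comp hη.fderiv, k + 1 + j, ?_⟩
    have h1 := hj.mul_fderiv h𝒢 ((hs o).fun_pow k) (fun g hg => hd g hg w)
    have h2 : AnalyticAt ℝ (fun x : Z × ℝ => - (j * w.2 * x.2 ^ k)) o :=
      (analyticAt_const.fun_mul ((hs o).fun_pow k)).fun_neg
    refine ((AnalyticIdeal.mul (hs o) h1).add (AnalyticIdeal.mul h2 hj)).congr ?_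
    filter_upwards [hη.eventually_analyticAt] with x hx
    have h3 : HasFDerivAt (fun x : Z × ℝ => x.2) (ContinuousLinearMap.snd ℝ Z ℝ) x :=
      (ContinuousLinearMap.snd ℝ Z ℝ).hasFDerivAt
    have h4 := ((h3.pow j).mul hx.differentiableAt.hasFDerivAt).fderiv
    have h5 : (fun x : Z × ℝ => x.2 ^ j * η x) = (fun x : Z × ℝ => x.2 ^ j) * η := rfl
    have h6 : ((fun x : Z × ℝ => x.2) ^ j) = fun x : Z × ℝ => x.2 ^ j := rfl
    rw [h5]
    try rw [h6] at h4
    rw [h4]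
    simp only [_root_.add_apply, _root_.smul_apply, smul_eq_mul, ContinuousLinearMap.coe_snd',
      nsmul_eq_mul]
    rcases j with _ | j
    · simp; ring
    · simp only [Nat.add_sub_cancel, pow_succ]; push_cast; ring
  · rintro η ⟨hη, j, hj⟩
    have h1 := hj.isBigO hz (j + 1) (hO (j + 1))
    have h2 := isBigO_inv_pow_smul j 1 h1
    have h3 : Tendsto (fun t : ℝ => t ^ 1) (𝓝[≠] 0) (𝓝 0) := by
      have : Continuous fun t : ℝ => t ^ 1 := by fun_prop
      simpa using (this.tendsto 0).mono_left (nhdsWithin_le_nhds (s := {0}ᶜ))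
    have h4 := h2.trans_tendsto h3
    refine tendsto_nhds_unique ((hη.continuousAt.tendsto.comp hz)) (h4.congr' ?_)
    filter_upwards [self_mem_nhdsWithin] with t ht
    have : t ^ j ≠ 0 := pow_ne_zero _ ht
    simp [this]

end Ideal

/-! ### Linear algebra: bordered determinants and adapted coordinates. -/

section Linear

/-- The Schur complement formula. The factor `A.det` on both sides makes it valid for singular `A`
as well. -/
theorem Matrix.det_mul_det_succ {r : ℕ} (M : Matrix (Fin (r + 1)) (Fin (r + 1)) ℝ)
    (A : Matrix (Fin r) (Fin r) ℝ) (hA : ∀ i j, A i j = M i.castSucc j.castSucc) :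
    A.det * M.det = A.det * (A.det * M (Fin.last r) (Fin.last r) -
      ∑ j : Fin r, M (Fin.last r) j.castSucc *
        A.adjugate.mulVec (fun i => M i.castSucc (Fin.last r)) j) := by
  by_cases hdet : A.det = 0
  · simp [hdet]
  congr 1
  have hu : IsUnit A.det := isUnit_iff_ne_zero.2 hdet
  let : Invertible A := A.invertibleOfIsUnitDet hu
  have h1 : M.submatrix (finSumFinEquiv : Fin r ⊕ Fin 1 ≃ Fin (r + 1)) finSumFinEquiv =
      Matrix.fromBlocks A (Matrix.of fun i _ => M i.castSucc (Fin.last r))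
        (Matrix.of fun _ j => M (Fin.last r) j.castSucc)
        (Matrix.of fun _ _ => M (Fin.last r) (Fin.last r)) := by
    ext i j
    rcases i with i | i <;> rcases j with j | j
    · simp [hA]; rfl
    · fin_cases j; simp; rfl
    · fin_cases i; simp; rfl
    · fin_cases i; fin_cases j; simp; rfl
  rw [← Matrix.det_submatrix_equiv_self (finSumFinEquiv : Fin r ⊕ Fin 1 ≃ Fin (r + 1)) M, h1,
    Matrix.det_fromBlocks₁₁, Matrix.det_fin_one, Matrix.invOf_eq_nonsing_inv, Matrix.inv_def,
    Ring.inverse_eq_inv']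
  have h2 : ((Matrix.of fun _ j => M (Fin.last r) j.castSucc : Matrix (Fin 1) (Fin r) ℝ) *
      (A.det⁻¹ • A.adjugate) *
      (Matrix.of fun i _ => M i.castSucc (Fin.last r) : Matrix (Fin r) (Fin 1) ℝ)) 0 0 =
      A.det⁻¹ * ∑ j : Fin r, M (Fin.last r) j.castSucc *
        A.adjugate.mulVec (fun i => M i.castSucc (Fin.last r)) j := by
    rw [Matrix.mul_smul, Matrix.smul_mul, Matrix.smul_apply, smul_eq_mul, Matrix.mul_assoc]
    rfl
  rw [Matrix.sub_apply, h2, mul_sub, mul_inv_cancel_left₀ hdet]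
  rfl

theorem exists_continuousLinearEquiv_single {F : Type} [NormedAddCommGroup F] [NormedSpace ℝ F]
    [FiniteDimensional ℝ F] {r : ℕ} {w : Fin r → F} (hw : LinearIndependent ℝ w) :
    ∃ Λ : ((Fin r → ℝ) × (Fin (Module.finrank ℝ F - r) → ℝ)) ≃L[ℝ] F,
      ∀ j, Λ (Pi.single j 1, 0) = w j := by
  set P := Submodule.span ℝ (range w) with hP
  obtain ⟨Q, hQ⟩ := P.exists_isCompl
  have h1 : Module.finrank ℝ P = r := by
    rw [hP, finrank_span_eq_card hw, Fintype.card_fin]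
  have h2 : Module.finrank ℝ Q = Module.finrank ℝ F - r := by
    have := Submodule.finrank_add_eq_of_isCompl hQ
    omega
  let e1 : (Fin r → ℝ) ≃ₗ[ℝ] P := (Module.Basis.span hw).equivFun.symm
  let e2 : (Fin (Module.finrank ℝ F - r) → ℝ) ≃ₗ[ℝ] Q :=
    LinearEquiv.ofFinrankEq _ _ (by rw [h2, Module.finrank_fin_fun])
  refine ⟨((e1.prodCongr e2).trans (P.prodEquivOfIsCompl Q hQ)).toContinuousLinearEquiv,
    fun j => ?_⟩
  have h3 : (e1 (Pi.single j 1) : F) = w j := by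
    have : e1 (Pi.single j 1) = Module.Basis.span hw j := by
      simp only [e1, Module.Basis.equivFun_symm_apply, Pi.single_apply, ite_smul, one_smul, zero_smul,
        Finset.sum_ite_eq', Finset.mem_univ, if_true]
    rw [this, Module.Basis.span_apply]
  simp [h3]

end Linear

/-- Every section over an open set of a linear projection to a space of dimension larger than `m`
which is analytic takes some value outside `V`. -/
def SectionDimLE {E : Type} [NormedAddCommGroup E] [NormedSpace ℝ E] (V : Set E) (m : ℕ) : Prop :=
  ∀ (A : Type) [NormedAddCommGroup A] [NormedSpace ℝ A] [FiniteDimensional ℝ A] (l : E →L[ℝ] A)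
    (s : A → E) (O : Set A), IsOpen O → O.Nonempty → AnalyticOnNhd ℝ s O →
    (∀ a ∈ O, l (s a) = a ∧ s a ∈ V) → Module.finrank ℝ A ≤ m

/-! ### Differentials modulo those of a given system. -/

section Rank

variable {X F : Type} [NormedAddCommGroup X] [NormedSpace ℝ X]
  [NormedAddCommGroup F] [NormedSpace ℝ F]

/-- The differential of `g` modulo the differentials of the `h i`, up to a power of the
Jacobian determinant of `h`. -/
noncomputable def reducedDeriv {r : ℕ} (h : Fin r → X × F → ℝ) (w : Fin r → F) (g : X × F → ℝ)
    (p : X × F) : (X × F) →L[ℝ] ℝ :=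
  (jacMatrix h w p).det • ((jacMatrix h w p).det • fderiv ℝ g p -
    ∑ j, fderiv ℝ g p (0, w j) • ∑ i, (jacMatrix h w p).adjugate j i • fderiv ℝ (h i) p)

theorem reducedDeriv_apply {r : ℕ} (h : Fin r → X × F → ℝ) (w : Fin r → F) (g : X × F → ℝ)
    (p b : X × F) : reducedDeriv h w g p b = (jacMatrix h w p).det * ((jacMatrix h w p).det *
      fderiv ℝ g p b - ∑ j, fderiv ℝ g p (0, w j) *
        ∑ i, (jacMatrix h w p).adjugate j i * fderiv ℝ (h i) p b) := by
  simp [reducedDeriv, _root_.sum_apply]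

theorem analyticAt_reducedDeriv {r : ℕ} {h : Fin r → X × F → ℝ} {w : Fin r → F} {g : X × F → ℝ}
    {p : X × F} (hh : ∀ i, AnalyticAt ℝ (h i) p) (hg : AnalyticAt ℝ g p) (b : X × F) :
    AnalyticAt ℝ (fun p => reducedDeriv h w g p b) p := by
  simp only [reducedDeriv_apply]
  have h1 : ∀ {k : X × F → ℝ} (b : X × F), AnalyticAt ℝ k p →
      AnalyticAt ℝ (fun p => fderiv ℝ k p b) p := fun b hk =>
    ((ContinuousLinearMap.apply ℝ ℝ b).analyticAt _).fun_comp hk.fderiv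
  have h2 := analyticAt_det (analyticAt_jacMatrix (w := w) hh)
  refine h2.fun_mul ((h2.fun_mul (h1 b hg)).fun_sub (Finset.analyticAt_fun_sum _ fun j _ => ?_))
  exact (h1 _ hg).fun_mul (Finset.analyticAt_fun_sum _ fun i _ =>
    (analyticAt_adjugate (analyticAt_jacMatrix hh) j i).fun_mul (h1 _ (hh i)))

/-- On vertical vectors the reduced derivative is a bordered Jacobian minor times the old
determinant. Maximality of the system is a statement about these minors. -/
theorem reducedDeriv_eq_det {r : ℕ} (h : Fin r → X × F → ℝ) (w : Fin r → F) (g : X × F → ℝ)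
    (p : X × F) (y : F) : reducedDeriv h w g p (0, y) = (jacMatrix h w p).det *
      (jacMatrix (Fin.snoc h g : Fin (r + 1) → X × F → ℝ) (Fin.snoc w y : Fin (r + 1) → F) p).det := by
  rw [Matrix.det_mul_det_succ _ (jacMatrix h w p) (fun i j => by simp [jacMatrix]),
    reducedDeriv_apply]
  congr 2
  · simp [jacMatrix]
  · refine Finset.sum_congr rfl fun j _ => ?_
    simp [jacMatrix, Matrix.mulVec, dotProduct]

variable {f : X → F} {q : X}

theorem fderiv_comp_graph {g : X × F → ℝ} {x : X} (hg : DifferentiableAt ℝ g (x, f x))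
    (hf : DifferentiableAt ℝ f x) (u : X) : fderiv ℝ (fun x => g (x, f x)) x u =
      fderiv ℝ g (x, f x) (u, fderiv ℝ f x u) := by
  have h1 : HasFDerivAt (fun x => (x, f x)) ((ContinuousLinearMap.id ℝ X).prod (fderiv ℝ f x)) x :=
    (hasFDerivAt_id x).prodMk hf.hasFDerivAt
  have h2 := (hg.hasFDerivAt.comp x h1).fderiv
  have h3 : (g ∘ fun x => (x, f x)) = fun x => g (x, f x) := rfl
  rw [h3] at h2
  rw [h2]
  rfl

theorem contDiffAt_comp_graph {n : WithTop ℕ∞} {g : X × F → ℝ} (hg : AnalyticAt ℝ g (q, f q))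
    (hf : ContDiffAt ℝ n f q) : ContDiffAt ℝ n (fun x => g (x, f x)) q :=
  ContDiffAt.comp (g := g) (f := fun x => (x, f x)) q hg.contDiffAt (contDiffAt_id.prodMk hf)

/-- If the differential of `g` is dependent, to infinite order along the graph of `f`, on the
differentials of the `h i`, then the reduced derivatives of `g` are flat. -/
theorem isFlatAt_reducedDeriv [FiniteDimensional ℝ F] {r : ℕ} {h : Fin r → X × F → ℝ} {w : Fin r → F} {g : X × F → ℝ}
    (hh : ∀ i, AnalyticAt ℝ (h i) (q, f q)) (hg : AnalyticAt ℝ g (q, f q))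
    (hf : ContDiffAt ℝ ∞ f q) (hhflat : ∀ i, IsFlatAt (fun x => h i (x, f x)) q)
    (hgflat : IsFlatAt (fun x => g (x, f x)) q)
    (hdep : ∀ y, IsFlatAt (fun x => (jacMatrix (Fin.snoc h g : Fin (r + 1) → X × F → ℝ)
      (Fin.snoc w y : Fin (r + 1) → F) (x, f x)).det) q) (b : X × F) :
    IsFlatAt (fun x => reducedDeriv h w g (x, f x) b) q := by
  have hΓ : ContinuousAt (fun x => (x, f x)) q := continuousAt_id.prodMk hf.continuousAt
  have hcont : ∀ {k : X × F → ℝ}, AnalyticAt ℝ k (q, f q) → ContinuousAt (fun x => k (x, f x)) q :=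
    fun {k} hk => ContinuousAt.comp (g := k) (f := fun x => (x, f x)) hk.continuousAt hΓ
  have hD := hcont (analyticAt_det (analyticAt_jacMatrix (w := w) hh))
  have hvert : ∀ y, IsFlatAt (fun x => reducedDeriv h w g (x, f x) (0, y)) q := fun y => by
    simp only [reducedDeriv_eq_det]
    exact (hdep y).mul_left hD
  have hΓd : ∀ {k : X × F → ℝ}, AnalyticAt ℝ k (q, f q) → IsFlatAt (fun x => k (x, f x)) q →
      ∀ u, IsFlatAt (fun x => fderiv ℝ k (x, f x) (u, fderiv ℝ f x u)) q := by
    intro k hk hkf u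
    have h1 : ContDiffAt ℝ 2 (fun x => k (x, f x)) q :=
      contDiffAt_comp_graph hk (hf.of_le (WithTop.coe_le_coe.2 le_top))
    refine (hkf.fderiv_apply h1 u).congr ?_
    have h2 : ContDiffAt ℝ 1 f q := hf.of_le (by exact_mod_cast le_top)
    filter_upwards [hΓ.eventually hk.eventually_analyticAt, h2.eventually (by simp)] with x h3 h4
    exact fderiv_comp_graph h3.differentiableAt (h4.differentiableAt one_ne_zero) u
  -- Along vectors tangent to the graph, the differentials of `g` and of the `h i` are derivatives
  -- of flat functions, hence flat.
  have htan : ∀ u, IsFlatAt (fun x => reducedDeriv h w g (x, f x) (u, fderiv ℝ f x u)) q := by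
    intro u
    simp only [reducedDeriv_apply]
    refine (((hΓd hg hgflat u).mul_left hD).sub (IsFlatAt.sum fun j _ => ?_)).mul_left hD
    refine IsFlatAt.mul_left (IsFlatAt.sum fun i _ => (hΓd (hh i) (hhflat i) u).mul_left ?_) ?_
    · exact hcont (analyticAt_adjugate (analyticAt_jacMatrix hh) j i)
    · exact hcont (((ContinuousLinearMap.apply ℝ ℝ ((0 : X), w j)).analyticAt _).fun_comp hg.fderiv)
  set β := Module.finBasis ℝ F
  have hhor : ∀ u, IsFlatAt (fun x => reducedDeriv h w g (x, f x) (u, 0)) q := by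
    intro u
    have h1 : IsFlatAt (fun x => ∑ k, β.equivFun.toContinuousLinearEquiv (fderiv ℝ f x u) k *
        reducedDeriv h w g (x, f x) (0, β k)) q := by
      refine IsFlatAt.sum fun k _ => (hvert (β k)).mul_left ?_
      have h2 : ContinuousAt (fderiv ℝ f) q :=
        (hf.fderiv_right (m := ∞) (by simp)).continuousAt
      exact ContinuousAt.comp (g := fun L : X →L[ℝ] F => β.equivFun.toContinuousLinearEquiv (L u) k)
        (by fun_prop) h2
    refine ((htan u).sub h1).congr (Eventually.of_forall fun x => ?_)
    -- Horizontal vectors differ from tangent ones by vertical vectors with continuous coefficients,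
    -- so all directions are covered.
    have h3 : ((u, fderiv ℝ f x u) : X × F) = (u, 0) + ∑ k,
        β.equivFun.toContinuousLinearEquiv (fderiv ℝ f x u) k • ((0 : X), β k) := by
      have h4 := β.sum_equivFun (fderiv ℝ f x u)
      ext1
      · simp [Prod.fst_sum]
      · simp only [Prod.snd_add, Prod.snd_sum, Prod.smul_snd, zero_add]
        exact h4.symm
    simp only [h3, map_add, map_sum, map_smul, smul_eq_mul]
    ring
  have h5 : b = (b.1, 0) + (0, b.2) := by ext1 <;> simp
  rw [h5]
  simp only [map_add]
  exact (hhor b.1).add (hvert b.2)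

theorem linearIndependent_of_jacMatrix_det_ne_zero {r : ℕ} {h : Fin r → X × F → ℝ} {w : Fin r → F}
    {p : X × F} (hdet : (jacMatrix h w p).det ≠ 0) : LinearIndependent ℝ w := by
  rw [Fintype.linearIndependent_iff]
  intro c hc
  have h1 : (jacMatrix h w p).mulVec c = 0 := by
    ext i
    have h2 : fderiv ℝ (h i) p (0, ∑ j, c j • w j) = 0 := by rw [hc]; exact map_zero _
    have h3 : ((0 : X), ∑ j, c j • w j) = ∑ j, c j • ((0 : X), w j) := by
      ext1 <;> simp [Prod.fst_sum, Prod.snd_sum]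
    rw [h3, map_sum] at h2
    simp only [map_smul, smul_eq_mul] at h2
    simp only [Matrix.mulVec, dotProduct, jacMatrix, Matrix.of_apply, Pi.zero_apply]
    rw [← h2]
    exact Finset.sum_congr rfl fun j _ => mul_comm _ _
  exact congrFun (Matrix.eq_zero_of_mulVec_eq_zero hdet h1)

end Rank

/-! ### The number of independent equations equals the codimension. -/

section RankStep

section

variable {X G F : Type} [NormedAddCommGroup X] [NormedSpace ℝ X]
  [NormedAddCommGroup G] [NormedSpace ℝ G] [NormedAddCommGroup F] [NormedSpace ℝ F] {q : X}

theorem analyticAt_blowUp_comp {r e : ℕ} {T : X → F} (hT : ∀ x, AnalyticAt ℝ T x)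
    (Λ : ((Fin r → ℝ) × G) ≃L[ℝ] F) {ζ : (X × G) × ℝ → (Fin r → ℝ)} {p : (X × G) × ℝ}
    (hζ : AnalyticAt ℝ ζ p) :
    AnalyticAt ℝ (fun p => blowUp q T Λ e p.1.1 p.1.2 (ζ p) p.2) p := by
  have h1 : AnalyticAt ℝ (fun p : (X × G) × ℝ => p.1.1) p :=
    ((ContinuousLinearMap.fst ℝ X G).comp (ContinuousLinearMap.fst ℝ _ ℝ)).analyticAt p
  have h2 : AnalyticAt ℝ (fun p : (X × G) × ℝ => p.1.2) p :=
    ((ContinuousLinearMap.snd ℝ X G).comp (ContinuousLinearMap.fst ℝ _ ℝ)).analyticAt p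
  have h3 : AnalyticAt ℝ (fun p : (X × G) × ℝ => p.2) p :=
    (ContinuousLinearMap.snd ℝ (X × G) ℝ).analyticAt p
  have h4 : AnalyticAt ℝ (fun p : (X × G) × ℝ => q + p.2 • p.1.1) p :=
    analyticAt_const.fun_add (h3.fun_smul h1)
  refine h4.prod (((hT _).fun_comp h4).fun_add ?_)
  exact ((Λ : ((Fin r → ℝ) × G) →L[ℝ] F).analyticAt _).fun_comp
    (((h3.fun_pow _).fun_smul hζ).prod ((h3.fun_pow _).fun_smul h2))

end

variable {X G F : Type} [NormedAddCommGroup X] [NormedSpace ℝ X] [FiniteDimensional ℝ X]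
  [NormedAddCommGroup G] [NormedSpace ℝ G] [FiniteDimensional ℝ G]
  [NormedAddCommGroup F] [NormedSpace ℝ F] [FiniteDimensional ℝ F]

/-- On an analytic family of zeros of the `h i`, the reduced derivatives of `g` generate the
derivatives of `g` along the family. -/
theorem analyticIdeal_fderiv_comp {Z : Type*} [NormedAddCommGroup Z] [NormedSpace ℝ Z]
    {r e : ℕ} {h : Fin r → X × F → ℝ} {w : Fin r → F} {g : X × F → ℝ} {S : Z × ℝ → X × F} {o : Z × ℝ}
    (hS : AnalyticAt ℝ S o) (hh : ∀ i, AnalyticAt ℝ (h i) (S o)) (hg : AnalyticAt ℝ g (S o))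
    (hhS : ∀ i, ∀ᶠ p in 𝓝 o, h i (S p) = 0) {U : Z × ℝ → ℝ} (hU : AnalyticAt ℝ U o) (hU0 : U o ≠ 0)
    (hDU : ∀ᶠ p in 𝓝 o, (jacMatrix h w (S p)).det = p.2 ^ e * U p) {𝒢 : Set (Z × ℝ → ℝ)}
    (h𝒢 : ∀ b, (fun p => reducedDeriv h w g (S p) b) ∈ 𝒢) (v : Z × ℝ) :
    AnalyticIdeal o 𝒢 fun p => p.2 ^ (2 * e) * fderiv ℝ (fun p => g (S p)) p v := by
  set β := Module.finBasis ℝ (X × F)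
  have hb : AnalyticAt ℝ (fun p => fderiv ℝ S p v) o :=
    ((ContinuousLinearMap.apply ℝ (X × F) v).analyticAt _).fun_comp hS.fderiv
  have hc : ∀ k, AnalyticAt ℝ
      (fun p => β.equivFun.toContinuousLinearEquiv (fderiv ℝ S p v) k) o := fun k =>
    (((ContinuousLinearMap.proj (R := ℝ) (φ := fun _ => ℝ) k).comp
      (β.equivFun.toContinuousLinearEquiv :
        (X × F) →L[ℝ] (Fin (Module.finrank ℝ (X × F)) → ℝ))).analyticAt _).fun_comp hb
  have hUi : AnalyticAt ℝ (fun p => (U p ^ 2)⁻¹) o := (hU.fun_pow 2).fun_inv (pow_ne_zero 2 hU0)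
  refine (AnalyticIdeal.mul hUi (AnalyticIdeal.sum Finset.univ fun k _ =>
    AnalyticIdeal.mul (hc k) (AnalyticIdeal.base (h𝒢 (β k))))).congr ?_
  have hev : ∀ {k : X × F → ℝ}, AnalyticAt ℝ k (S o) → ∀ᶠ p in 𝓝 o,
      fderiv ℝ (fun p => k (S p)) p v = fderiv ℝ k (S p) (fderiv ℝ S p v) := by
    intro k hk
    filter_upwards [hS.continuousAt.eventually hk.eventually_analyticAt,
      hS.eventually_analyticAt] with p h1 h2
    have h3 := (h1.differentiableAt.hasFDerivAt.comp p h2.differentiableAt.hasFDerivAt).fderiv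
    have h4 : (k ∘ S) = fun p => k (S p) := rfl
    rw [h4] at h3
    rw [h3]
    rfl
  filter_upwards [hev hg, eventually_all.2 fun i => hev (hh i),
    eventually_all.2 fun i => (hhS i).eventually_nhds, hDU, hU.continuousAt.eventually_ne hU0]
    with p h1 h2 h3 h4 h5
  have h6 : ∑ k, β.equivFun.toContinuousLinearEquiv (fderiv ℝ S p v) k *
      reducedDeriv h w g (S p) (β k) = reducedDeriv h w g (S p) (fderiv ℝ S p v) := by
    conv_rhs => rw [← β.sum_equivFun (fderiv ℝ S p v)]
    simp only [map_sum, map_smul, smul_eq_mul]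
    rfl
  -- The `h i` vanish on the family, so in tangent directions only the term `det ^ 2 * dg` of the
  -- reduced derivative survives, and `det = t ^ e * U` with `U` a unit.
  have h7 : ∀ i, fderiv ℝ (h i) (S p) (fderiv ℝ S p v) = 0 := by
    intro i
    rw [← h2 i]
    have : (fun p => h i (S p)) =ᶠ[𝓝 p] fun _ => 0 := h3 i
    rw [this.fderiv_eq]
    simp
  rw [h6, reducedDeriv_apply]
  simp only [h7, mul_zero, Finset.sum_const_zero, sub_zero]
  rw [h4, h1]
  field_simp
  ring

/-- An analytic parametrization obtained by blowing up which takes values in `V` gives analytic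
sections over a space of the dimension of `X × G`. -/
theorem finrank_le_of_blowUp_mem {V : Set (X × F)} {m r e : ℕ} (hV : SectionDimLE V m) {q : X}
    {T : X → F} (hT : ∀ x, AnalyticAt ℝ T x) (Λ : ((Fin r → ℝ) × G) ≃L[ℝ] F) {ξ₀ : X}
    {ζ : (X × G) × ℝ → (Fin r → ℝ)} (hζ : AnalyticAt ℝ ζ ((ξ₀, 0), 0))
    (hmem : ∀ᶠ p in 𝓝 (((ξ₀, 0), 0) : (X × G) × ℝ),
      blowUp q T Λ e p.1.1 p.1.2 (ζ p) p.2 ∈ V) :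
    Module.finrank ℝ X + Module.finrank ℝ G ≤ m := by
  obtain ⟨t, ht, ht0⟩ : ∃ t : ℝ, (∀ᶠ p in 𝓝 (((ξ₀, 0), t) : (X × G) × ℝ), AnalyticAt ℝ ζ p ∧
      blowUp q T Λ e p.1.1 p.1.2 (ζ p) p.2 ∈ V) ∧ t ≠ 0 := by
    have h1 : Tendsto (fun t : ℝ => (((ξ₀, 0), t) : (X × G) × ℝ)) (𝓝[≠] 0) (𝓝 ((ξ₀, 0), 0)) := by
      have : Continuous fun t : ℝ => (((ξ₀, 0), t) : (X × G) × ℝ) := by fun_prop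
      exact (this.tendsto 0).mono_left nhdsWithin_le_nhds
    exact ((h1.eventually (hζ.eventually_analyticAt.and hmem).eventually_nhds).and
      self_mem_nhdsWithin).exists
  -- At a fixed `t ≠ 0` the blow-up is undone: `κ` recovers `ξ` and `z` from `x` and the
  -- `G`-component, so the family is a section of a linear projection onto `X × G`.
  set κ : X × G → (X × G) × ℝ := fun a => ((t⁻¹ • (a.1 - q),
    (t ^ (2 * e + 2))⁻¹ • (a.2 - (Λ.symm (T a.1)).2)), t) with hκ
  have hfst : ∀ a : X × G, AnalyticAt ℝ (fun a : X × G => a.1) a := fun a =>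
    (ContinuousLinearMap.fst ℝ X G).analyticAt a
  have hsnd : ∀ a : X × G, AnalyticAt ℝ (fun a : X × G => a.2) a := fun a =>
    (ContinuousLinearMap.snd ℝ X G).analyticAt a
  have hTA : ∀ a : X × G, AnalyticAt ℝ (fun a : X × G => T a.1) a := fun a =>
    (hT a.1).fun_comp (hfst a)
  have hκA : ∀ a, AnalyticAt ℝ κ a := by
    intro a
    refine AnalyticAt.prod (AnalyticAt.prod ?_ ?_) analyticAt_const
    · exact ((hfst a).fun_sub analyticAt_const).fun_const_smul
    · refine ((hsnd a).fun_sub ?_).fun_const_smul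
      exact (((ContinuousLinearMap.snd ℝ (Fin r → ℝ) G).comp
        (Λ.symm : F →L[ℝ] (Fin r → ℝ) × G)).analyticAt _).fun_comp
        (hTA a)
  have hκc : Continuous κ := continuous_iff_continuousAt.2 fun a => (hκA a).continuousAt
  obtain ⟨O', hO', hO'o, hpO'⟩ := eventually_nhds_iff.1 ht
  have hpow : t ^ (2 * e + 2) ≠ 0 := pow_ne_zero _ ht0
  have h1 := hV (X × G) ((ContinuousLinearMap.fst ℝ X F).prod
    (((ContinuousLinearMap.snd ℝ (Fin r → ℝ) G).comp
        (Λ.symm : F →L[ℝ] (Fin r → ℝ) × G)).comp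
      (ContinuousLinearMap.snd ℝ X F)))
    (fun a => (a.1, T a.1 + Λ (t ^ (e + 1) • ζ (κ a), a.2 - (Λ.symm (T a.1)).2)))
    (κ ⁻¹' O') (hO'o.preimage hκc) ?_ ?_ ?_
  · rwa [Module.finrank_prod] at h1
  · refine ⟨(q + t • ξ₀, (Λ.symm (T (q + t • ξ₀))).2), ?_⟩
    change κ _ ∈ O'
    have : κ (q + t • ξ₀, (Λ.symm (T (q + t • ξ₀))).2) = ((ξ₀, 0), t) := by
      simp [hκ, smul_smul, inv_mul_cancel₀ ht0]
    rw [this]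
    exact hpO'
  · intro a ha
    refine (hfst a).prod ((hTA a).fun_add ?_)
    refine ((Λ : ((Fin r → ℝ) × G) →L[ℝ] F).analyticAt _).fun_comp (AnalyticAt.prod ?_ ?_)
    · exact ((hO' _ ha).1.fun_comp (hκA a)).fun_const_smul
    · refine (hsnd a).fun_sub ?_
      exact (((ContinuousLinearMap.snd ℝ (Fin r → ℝ) G).comp
        (Λ.symm : F →L[ℝ] (Fin r → ℝ) × G)).analyticAt _).fun_comp
        (hTA a)
  · intro a ha
    refine ⟨?_, ?_⟩
    · ext1
      · rfl
      · simp
    · have h2 := (hO' _ ha).2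
      have h3 : blowUp q T Λ e (κ a).1.1 (κ a).1.2 (ζ (κ a)) (κ a).2 =
          (a.1, T a.1 + Λ (t ^ (e + 1) • ζ (κ a), a.2 - (Λ.symm (T a.1)).2)) := by
        simp only [blowUp, hκ, smul_smul, mul_inv_cancel₀ ht0, mul_inv_cancel₀ hpow, one_smul,
          add_sub_cancel]
      rw [h3] at h2
      exact h2

variable {f : X → F} {q : X}

/-- A maximal system of independent equations of the graph of `f` has as many elements as the
codimension of the graph. -/
theorem finrank_le_of_maximal_rank {W V : Set (X × F)} (hW : IsOpen W) (hqW : (q, f q) ∈ W)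
    {𝓕 : Set (X × F → ℝ)} (h𝓕 : ∀ h ∈ 𝓕, AnalyticOnNhd ℝ h W)
    (hV : ∀ p ∈ W, (∀ h ∈ 𝓕, h p = 0) → p ∈ V) (hdim : SectionDimLE V (Module.finrank ℝ X))
    (hf : ContDiffAt ℝ ∞ f q) (h𝓕flat : ∀ h ∈ 𝓕, IsFlatAt (fun x => h (x, f x)) q)
    {r : ℕ} {h : Fin r → X × F → ℝ} {w : Fin r → F} (hh : ∀ i, AnalyticOnNhd ℝ (h i) W)
    (hhflat : ∀ i, IsFlatAt (fun x => h i (x, f x)) q)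
    (hdet : ¬ IsFlatAt (fun x => (jacMatrix h w (x, f x)).det) q)
    (hmax : ∀ g : X × F → ℝ, AnalyticOnNhd ℝ g W → IsFlatAt (fun x => g (x, f x)) q → ∀ y,
      IsFlatAt (fun x => (jacMatrix (Fin.snoc h g : Fin (r + 1) → X × F → ℝ)
        (Fin.snoc w y : Fin (r + 1) → F) (x, f x)).det) q) : Module.finrank ℝ F ≤ r := by
  have hq : ∀ i, AnalyticAt ℝ (h i) (q, f q) := fun i => hh i _ hqW
  have hw : LinearIndependent ℝ w := by
    have : ∃ x, (jacMatrix h w (x, f x)).det ≠ 0 := by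
      by_contra! hcon
      exact hdet ((isFlatAt_zero q).congr (Eventually.of_forall fun x => (hcon x).symm))
    obtain ⟨x, hx⟩ := this
    exact linearIndependent_of_jacMatrix_det_ne_zero hx
  obtain ⟨Λ, hΛ⟩ := exists_continuousLinearEquiv_single hw
  have hdsm : ContDiffAt ℝ ∞ (fun x => (jacMatrix h w (x, f x)).det) q :=
    contDiffAt_comp_graph (analyticAt_det (analyticAt_jacMatrix hq)) hf
  obtain ⟨e, B, ⟨ξ₀, hξ₀⟩, hB⟩ := exists_leading_term hdsm hdet
  have hwΛ : (fun j => Λ (Pi.single j 1, 0)) = w := funext hΛ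
  obtain ⟨T, hT, hTq, ζ, hζ, hhS, ⟨U, hUA, hU0, hDU⟩, hcurve⟩ :=
    exists_blowUp_parametrization (e := e) (B := B) hq hf hhflat Λ (by rw [hwΛ]; exact hB) hξ₀
  rw [hwΛ] at hDU
  set o : (X × (Fin (Module.finrank ℝ F - r) → ℝ)) × ℝ := ((ξ₀, 0), 0) with ho
  set S : (X × (Fin (Module.finrank ℝ F - r) → ℝ)) × ℝ → X × F := fun p =>
    blowUp q T Λ e p.1.1 p.1.2 (ζ p) p.2 with hS
  have hSA : ∀ p, AnalyticAt ℝ ζ p → AnalyticAt ℝ S p := fun p hp => analyticAt_blowUp_comp hT Λ hp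
  have hSo : S o = (q, f q) := by simp [hS, ho, blowUp, hTq]
  obtain ⟨z, hz, hzO⟩ := hcurve.self_of_nhds
  -- The pullbacks of all analytic functions on `W` that are flat along the graph, not just of the
  -- equations in `𝓕`: by maximality the reduced derivatives of such functions are flat again, which
  -- closes the family under differentiation.
  set 𝒢 : Set ((X × (Fin (Module.finrank ℝ F - r) → ℝ)) × ℝ → ℝ) :=
    {η | ∃ g : X × F → ℝ, AnalyticOnNhd ℝ g W ∧ IsFlatAt (fun x => g (x, f x)) q ∧ η = fun p => g (S p)} with h𝒢
  have hzo : Tendsto (fun t => (((ξ₀, z t), t) : (X × (Fin (Module.finrank ℝ F - r) → ℝ)) × ℝ))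
      (𝓝[≠] 0) (𝓝 o) :=
    (tendsto_const_nhds.prodMk_nhds hz).prodMk_nhds (tendsto_id.mono_left nhdsWithin_le_nhds)
  have hSt : Tendsto (fun t => S ((ξ₀, z t), t)) (𝓝[≠] 0) (𝓝 (q, f q)) :=
    hSo ▸ (hSA o hζ).continuousAt.tendsto.comp hzo
  have hray : Tendsto (fun t : ℝ => q + t • ξ₀) (𝓝[≠] 0) (𝓝 q) :=
    (tendsto_ray q ξ₀).mono_left nhdsWithin_le_nhds
  have hΓt : Tendsto (fun t : ℝ => (q + t • ξ₀, f (q + t • ξ₀))) (𝓝[≠] 0) (𝓝 (q, f q)) :=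
    hray.prodMk_nhds (hf.continuousAt.tendsto.comp hray)
  have hvanish : ∀ g : X × F → ℝ, AnalyticOnNhd ℝ g W → IsFlatAt (fun x => g (x, f x)) q →
      ∀ᶠ p in 𝓝 o, g (S p) = 0 := by
    intro g hg hgflat
    refine eventually_eq_zero_of_differential_ideal (𝒢 := 𝒢) ?_ (2 * e) ?_ hzo ?_
      ⟨g, hg, hgflat, rfl⟩
    · rintro _ ⟨g, hg, -, rfl⟩
      exact AnalyticAt.fun_comp_of_eq (g := g) (hg _ hqW) (hSA o hζ) hSo
    · rintro _ ⟨g, hg, hgflat, rfl⟩ v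
      refine analyticIdeal_fderiv_comp (h := h) (w := w) (hSA o hζ) (fun i => hSo ▸ hq i)
        (hSo ▸ hg _ hqW) (eventually_all.1 hhS) hUA hU0 hDU (fun b => ?_) v
      exact ⟨fun p => reducedDeriv h w g p b,
        fun p hp => analyticAt_reducedDeriv (fun i => hh i p hp) (hg p hp) b,
        isFlatAt_reducedDeriv hq (hg _ hqW) hf hhflat hgflat (hmax g hg hgflat) b, rfl⟩
    · rintro n _ ⟨g, hg, hgflat, rfl⟩
      obtain ⟨L, s, hs, hL⟩ := ((hg _ hqW).contDiffAt (n := 1)).exists_lipschitzOnWith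
      have b1 : (fun t : ℝ => g (q + t • ξ₀, f (q + t • ξ₀)) - g (S ((ξ₀, z t), t))) =O[𝓝[≠] 0]
          fun t => t ^ n := by
        refine IsBigO.trans ?_ (hzO n)
        refine IsBigO.of_bound L ?_
        filter_upwards [hΓt.eventually hs, hSt.eventually hs] with t h4 h5
        have := hL.dist_le_mul _ h4 _ h5
        rw [dist_eq_norm, dist_eq_norm] at this
        refine this.trans_eq ?_
        have h6 : ((q + t • ξ₀, f (q + t • ξ₀)) : X × F) - S ((ξ₀, z t), t) =
          (0, f (q + t • ξ₀) - (blowUp q T Λ e ξ₀ (z t) (ζ ((ξ₀, z t), t)) t).2) := by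
          ext1 <;> simp [hS, blowUp]
        rw [h6, Prod.norm_mk, norm_zero, max_eq_right (norm_nonneg _)]
      refine (((hgflat.comp_ray ξ₀ n).mono nhdsWithin_le_nhds).sub b1).congr_left fun t => ?_
      ring
  have hmem : ∀ᶠ p in 𝓝 o, S p ∈ V := by
    have h1 : ∀ᶠ p in 𝓝 o, AnalyticAt ℝ ζ p ∧ S p ∈ W :=
      hζ.eventually_analyticAt.and ((hSA o hζ).continuousAt.eventually
        (hSo ▸ hW.mem_nhds hqW))
    -- The set `𝓕` may be infinite and each equation vanishes on a neighbourhood of its own; the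
    -- identity theorem on a fixed ball makes the neighbourhood common.
    obtain ⟨ε, hε, hball⟩ := Metric.eventually_nhds_iff_ball.1 h1
    filter_upwards [Metric.ball_mem_nhds o hε] with p hp
    refine hV _ (hball p hp).2 fun g hg => ?_
    have h2 : AnalyticOnNhd ℝ (fun p => g (S p)) (Metric.ball o ε) := fun p hp =>
      (h𝓕 g hg _ (hball p hp).2).fun_comp (hSA p (hball p hp).1)
    exact AnalyticOnNhd.eqOn_zero_of_preconnected_of_eventuallyEq_zero (𝕜 := ℝ) h2
      (convex_ball o ε).isPreconnected (Metric.mem_ball_self hε)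
      (hvanish g (h𝓕 g hg) (h𝓕flat g hg)) hp
  have := finrank_le_of_blowUp_mem hdim hT Λ hζ hmem
  rw [Module.finrank_fin_fun] at this
  omega

/-- A set of equations which defines a set of dimension at most that of the graph of `f` and which
hold to infinite order along this graph yields as many independent equations as the codimension. -/
theorem exists_full_rank {W V : Set (X × F)} (hW : IsOpen W) (hqW : (q, f q) ∈ W)
    {𝓕 : Set (X × F → ℝ)} (h𝓕 : ∀ h ∈ 𝓕, AnalyticOnNhd ℝ h W)
    (hV : ∀ p ∈ W, (∀ h ∈ 𝓕, h p = 0) → p ∈ V) (hdim : SectionDimLE V (Module.finrank ℝ X))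
    (hf : ContDiffAt ℝ ∞ f q) (h𝓕flat : ∀ h ∈ 𝓕, IsFlatAt (fun x => h (x, f x)) q) :
    ∃ (h : Fin (Module.finrank ℝ F) → X × F → ℝ) (w : Fin (Module.finrank ℝ F) → F),
      (∀ i, AnalyticOnNhd ℝ (h i) W) ∧ (∀ i, IsFlatAt (fun x => h i (x, f x)) q) ∧
      ¬ IsFlatAt (fun x => (jacMatrix h w (x, f x)).det) q := by
  classical
  set Pr : ℕ → Prop := fun r => ∃ (h : Fin r → X × F → ℝ) (w : Fin r → F),
      (∀ i, AnalyticOnNhd ℝ (h i) W) ∧ (∀ i, IsFlatAt (fun x => h i (x, f x)) q) ∧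
      ¬ IsFlatAt (fun x => (jacMatrix h w (x, f x)).det) q with hPr
  by_contra hcon
  have hstep : ∀ r, r ≤ Module.finrank ℝ F → Pr r := by
    intro r
    induction r with
    | zero =>
      -- The empty system has determinant `1`, which is not flat.
      intro _
      refine ⟨Fin.elim0, Fin.elim0, fun i => i.elim0, fun i => i.elim0, ?_⟩
      simpa using not_isFlatAt_one q
    | succ r ih =>
      intro hr
      obtain ⟨h, w, hh, hflat, hdet⟩ := ih (by omega)
      by_contra hno
      have := finrank_le_of_maximal_rank hW hqW h𝓕 hV hdim hf h𝓕flat hh hflat hdet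
        (fun g hg hgflat y => by
          by_contra hne
          refine hno ⟨Fin.snoc h g, Fin.snoc w y, ?_, ?_, hne⟩
          · intro i
            refine Fin.lastCases ?_ (fun i => ?_) i
            · simpa using hg
            · simpa using hh i
          · intro i
            refine Fin.lastCases ?_ (fun i => ?_) i
            · simpa using hgflat
            · simpa using hflat i)
      omega
  exact hcon (hstep _ le_rfl)

end RankStep

/-! ### Convergence of the Taylor series of the graph. -/

section Convergence

variable {X F : Type*} [NormedAddCommGroup X] [NormedSpace ℝ X]
  [NormedAddCommGroup F] [NormedSpace ℝ F] [CompleteSpace F]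

theorem AnalyticAt.exists_taylorBound {f : X → F} {x : X} (hf : AnalyticAt ℝ f x) :
    ∃ A M ε : ℝ, 0 < A ∧ 0 < M ∧ 0 < ε ∧ ∀ y ∈ Metric.ball x ε, TaylorBound f y A M := by
  obtain ⟨p, r, hp⟩ := hf
  obtain ⟨s, hs0, hs⟩ := ENNReal.lt_iff_exists_nnreal_btwn.1 hp.r_pos
  have hs0' : 0 < s := by exact_mod_cast hs0
  obtain ⟨C, hC, hb⟩ := p.norm_le_div_pow_of_pos_of_lt_radius hs0' (hs.trans_le hp.r_le)
  have hs1 : (0 : ℝ) < s := hs0'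
  refine ⟨2 * C, 4 * (s : ℝ)⁻¹, min (4 * (s : ℝ)⁻¹)⁻¹ s, by positivity, by positivity,
    lt_min (by positivity) hs1, fun y hy => ?_⟩
  rw [Metric.mem_ball, lt_min_iff, dist_eq_norm] at hy
  have h1 : ∀ n, ‖p n‖ ≤ C * (s : ℝ)⁻¹ ^ n := fun n => by
    rw [inv_pow, ← div_eq_mul_inv]; exact hb n
  have h2 : (‖y - x‖₊ : ENNReal) < r := by
    refine lt_trans ?_ hs
    exact_mod_cast hy.2
  have := hp.taylorBound_of_mem (by positivity) h1 hy.1.le h2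
  rwa [add_sub_cancel] at this

theorem taylorBound_of_norm_taylorSeries_le {f : X → F} {q : X} {A M : ℝ}
    (h : ∀ n, ‖taylorSeries f q n‖ ≤ A * M ^ n) : TaylorBound f q A M := by
  intro n y
  have h1 := taylorSeries_diag f q n y
  rw [eq_inv_smul_iff₀ (by positivity)] at h1
  rw [← h1, norm_smul, Real.norm_natCast, mul_assoc]
  gcongr
  refine ((taylorSeries f q n).le_opNorm _).trans ?_
  rw [Finset.prod_const, Finset.card_univ, Fintype.card_fin]
  gcongr
  exact h n

/-- The sum of the convergent Taylor series has the same expansion as `f`, so it differs from `f` by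
a flat function, which need not be zero at this stage. -/
theorem exists_hasFPowerSeriesOnBall_isFlatAt_sub {f : X → F} {q : X} (hf : ContDiffAt ℝ ∞ f q)
    {A M : ℝ} (hM : 0 < M) (h : TaylorBound f q A M) :
    ∃ (g : X → F) (p : FormalMultilinearSeries ℝ X F),
      HasFPowerSeriesOnBall g p q (ENNReal.ofReal (2 * Real.exp 1 * M)⁻¹) ∧
      (∀ n, ‖p n‖ ≤ A * (2 * Real.exp 1 * M) ^ n) ∧ IsFlatAt (fun x => f x - g x) q := by
  have hA : 0 ≤ A := by simpa using (norm_nonneg _).trans (h 0 0)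
  have hn := h.norm_taylorSeries_le hA hM.le
  have hp := hasFPowerSeriesOnBall_taylorSeries (by positivity) hn
  refine ⟨_, _, hp, hn, fun n => ?_⟩
  have h1 := hf.taylor_isBigO n
  have h2 := hp.hasFPowerSeriesAt.isBigO_sub_partialSum_pow n
  have h3 : Tendsto (fun x => x - q) (𝓝 q) (𝓝 0) := by
    have : Continuous fun x => x - q := by fun_prop
    simpa using this.tendsto q
  refine (h1.sub (h2.comp_tendsto h3)).congr_left fun x => ?_
  simp only [Function.comp_apply, FormalMultilinearSeries.partialSum, add_sub_cancel]
  abel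

theorem coeff_eq_of_isBigO {u : ℝ → F} {a b : ℕ → F} {n : ℕ}
    (ha : (fun t : ℝ => u t - ∑ k ∈ Finset.range n, t ^ k • a k) =O[𝓝[≠] 0] fun t => t ^ n)
    (hb : (fun t : ℝ => u t - ∑ k ∈ Finset.range n, t ^ k • b k) =O[𝓝[≠] 0] fun t => t ^ n)
    {k : ℕ} (hk : k < n) : a k = b k := by
  rw [← sub_eq_zero]
  refine (SeparatingDual.eq_zero_iff_forall_dual_eq_zero (R := ℝ) _).2 fun L => ?_
  refine coeff_eq_zero_of_isBigO n (fun i => L (a i - b i)) ?_ k hk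
  have h1 := ((L.isBigO_comp _ _).trans (hb.sub ha))
  refine h1.congr_left fun t => ?_
  simp only [map_sub, map_sum, map_smul, smul_eq_mul, sub_sub_sub_cancel_left, mul_comm,
    mul_sub, Finset.sum_sub_distrib]

theorem ContDiffAt.taylor_ray {f : X → F} {q : X} (hf : ContDiffAt ℝ ∞ f q) (ξ : X) (n : ℕ) :
    (fun t : ℝ => f (q + t • ξ) -
      ∑ k ∈ Finset.range n, t ^ k • taylorSeries f q k (fun _ => ξ)) =O[𝓝 0] fun t => t ^ n := by
  have h1 := hf.taylor_isBigO n
  have h2 : Tendsto (fun t : ℝ => q + t • ξ) (𝓝 0) (𝓝 q) := by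
    have : Continuous fun t : ℝ => q + t • ξ := by fun_prop
    simpa using this.tendsto 0
  refine ((h1.comp_tendsto h2).congr_left fun t => ?_).trans (IsBigO.of_bound (‖ξ‖ ^ n)
    (Eventually.of_forall fun t => ?_))
  · simp only [Function.comp_apply, add_sub_cancel_left]
    congr 1
    refine Finset.sum_congr rfl fun k _ => ?_
    have := (taylorSeries f q k).toMultilinearMap.map_smul_univ (fun _ => t) (fun _ => ξ)
    simpa using this
  · simp only [Function.comp_apply, add_sub_cancel_left, norm_smul, norm_pow, mul_pow]
    rw [norm_mul, norm_pow, norm_pow, norm_norm, norm_norm, mul_comm]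

/-- If the restrictions of `f` to the lines through `q` in an open set of directions are, to
infinite order, given by an analytic function, then the Taylor series of `f` converges. -/
theorem exists_taylorBound_of_rays {f : X → F} {q : X} (hf : ContDiffAt ℝ ∞ f q) {ξ₀ : X}
    {κ : X × ℝ → F} (hκ : AnalyticAt ℝ κ (ξ₀, 0))
    (h : ∀ᶠ ξ in 𝓝 ξ₀, ∀ n : ℕ,
      (fun t : ℝ => f (q + t • ξ) - κ (ξ, t)) =O[𝓝[≠] 0] fun t => t ^ n) :
    ∃ A M : ℝ, 0 < A ∧ 0 < M ∧ TaylorBound f q A M := by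
  obtain ⟨A, M, ε, hA, hM, hε, hb⟩ := hκ.exists_taylorBound
  have h1 : Tendsto (fun ξ : X => (ξ, (0 : ℝ))) (𝓝 ξ₀) (𝓝 (ξ₀, 0)) := by
    have : Continuous fun ξ : X => (ξ, (0 : ℝ)) := by fun_prop
    exact this.tendsto ξ₀
  have h2 := (h.and (h1.eventually hκ.eventually_analyticAt)).and
    (h1.eventually (Metric.ball_mem_nhds _ hε))
  obtain ⟨ρ, hρ, hball⟩ := Metric.nhds_basis_closedBall.eventually_iff.1 h2
  refine ⟨A, M * (2 * Real.exp 1 / ρ), hA, by positivity,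
    taylorBound_of_norm_taylorSeries_le fun n => ?_⟩
  rw [mul_pow, ← mul_assoc]
  -- For `ξ` near `ξ₀`, the `n`-th homogeneous term of `f` at `ξ` is the `n`-th Taylor coefficient
  -- of `κ (ξ, ·)`, bounded geometrically and uniformly in `ξ`.
  refine norm_taylorSeries_le (x := ξ₀) hρ (by positivity) fun ξ hξ => ?_
  obtain ⟨⟨h3, h4⟩, h5⟩ := hball (mem_closedBall_iff_norm.2 hξ)
  have h6 := (hf.taylor_ray ξ (n + 1)).mono (nhdsWithin_le_nhds (s := {0}ᶜ))
  have h7 := (h4.contDiffAt.taylor_ray (0, 1) (n + 1)).mono (nhdsWithin_le_nhds (s := {0}ᶜ))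
  have h8 : (fun t : ℝ => f (q + t • ξ) - ∑ k ∈ Finset.range (n + 1),
      t ^ k • taylorSeries κ (ξ, 0) k (fun _ => (0, 1))) =O[𝓝[≠] 0] fun t => t ^ (n + 1) := by
    refine ((h3 (n + 1)).add h7).congr_left fun t => ?_
    have : ((ξ, (0 : ℝ)) : X × ℝ) + t • ((0 : X), (1 : ℝ)) = (ξ, t) := by ext1 <;> simp
    rw [this]
    abel
  have h9 := coeff_eq_of_isBigO h6 h8 (Nat.lt_succ_self n)
  rw [taylorSeries_diag, taylorSeries_diag] at h9
  rw [smul_right_injective F (inv_ne_zero (by positivity : ((n.factorial : ℕ) : ℝ) ≠ 0)) h9]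
  refine (hb _ h5 n (0, 1)).trans_eq ?_
  simp

end Convergence

section

variable {X F : Type} [NormedAddCommGroup X] [NormedSpace ℝ X] [FiniteDimensional ℝ X]
  [NormedAddCommGroup F] [NormedSpace ℝ F] [FiniteDimensional ℝ F]

/-- A smooth function whose graph satisfies to infinite order at `q` a system of equations which is
not degenerate to infinite order has a convergent Taylor series at `q`. -/
theorem exists_taylorBound_of_full_rank {f : X → F} {q : X}
    {h : Fin (Module.finrank ℝ F) → X × F → ℝ} {w : Fin (Module.finrank ℝ F) → F}
    (hh : ∀ i, AnalyticAt ℝ (h i) (q, f q)) (hf : ContDiffAt ℝ ∞ f q)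
    (hflat : ∀ i, IsFlatAt (fun x => h i (x, f x)) q)
    (hdet : ¬ IsFlatAt (fun x => (jacMatrix h w (x, f x)).det) q) :
    ∃ A M : ℝ, 0 < A ∧ 0 < M ∧ TaylorBound f q A M := by
  have hw : LinearIndependent ℝ w := by
    have : ∃ x, (jacMatrix h w (x, f x)).det ≠ 0 := by
      by_contra! hcon
      exact hdet ((isFlatAt_zero q).congr (Eventually.of_forall fun x => (hcon x).symm))
    obtain ⟨x, hx⟩ := this
    exact linearIndependent_of_jacMatrix_det_ne_zero hx
  obtain ⟨Λ, hΛ⟩ := exists_continuousLinearEquiv_single hw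
  have hdsm : ContDiffAt ℝ ∞ (fun x => (jacMatrix h w (x, f x)).det) q :=
    contDiffAt_comp_graph (analyticAt_det (analyticAt_jacMatrix hh)) hf
  obtain ⟨e, B, ⟨ξ₀, hξ₀⟩, hB⟩ := exists_leading_term hdsm hdet
  have hwΛ : (fun j => Λ (Pi.single j 1, 0)) = w := funext hΛ
  obtain ⟨T, hT, hTq, ζ, hζ, -, -, hcurve⟩ :=
    exists_blowUp_parametrization (e := e) (B := B) hh hf hflat Λ (by rw [hwΛ]; exact hB) hξ₀
  -- With as many equations as dimensions of `F` there are no free variables `z` in the blow-up, so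
  -- the graph follows a single analytic family.
  have hsub : ∀ z : Fin (Module.finrank ℝ F - Module.finrank ℝ F) → ℝ, z = 0 := fun z => by
    ext i
    have := i.2
    omega
  refine exists_taylorBound_of_rays hf (ξ₀ := ξ₀)
    (κ := fun p => (blowUp q T Λ e p.1 0 (ζ ((p.1, 0), p.2)) p.2).2) ?_ ?_
  · have h1 : ∀ p, AnalyticAt ℝ (fun p : X × ℝ =>
        (((p.1, 0), p.2) : (X × (Fin (Module.finrank ℝ F - Module.finrank ℝ F) → ℝ)) × ℝ)) p :=
      fun p => (((ContinuousLinearMap.fst ℝ X ℝ).analyticAt p).prod analyticAt_const).prod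
        ((ContinuousLinearMap.snd ℝ X ℝ).analyticAt p)
    have h2 := (analyticAt_blowUp_comp (e := e) (q := q) hT Λ hζ).fun_comp_of_eq
      (h1 (ξ₀, 0)) rfl
    exact ((ContinuousLinearMap.snd ℝ X F).analyticAt _).fun_comp h2
  · filter_upwards [hcurve] with ξ hξ n
    obtain ⟨z, -, hz⟩ := hξ
    have h1 : z = fun _ => 0 := funext fun t => hsub _
    rw [h1] at hz
    exact hz n

end

/-! ### Flat analytic functions are zero. -/

section FlatAnalytic

variable {X F : Type*} [NormedAddCommGroup X] [NormedSpace ℝ X]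
  [NormedAddCommGroup F] [NormedSpace ℝ F] [CompleteSpace F]

omit [CompleteSpace F] [NormedSpace ℝ X] [NormedSpace ℝ F] in
theorem IsFlatAt.apply_eq_zero {u : X → F} {q : X} (hu : IsFlatAt u q) : u q = 0 := by
  have := (hu 1).eq_zero_of_norm_pow (n := 1) (by simp)
  simpa using this

theorem IsFlatAt.eventually_eq_zero {u : X → ℝ} {q : X} (hu : IsFlatAt u q)
    (hA : AnalyticAt ℝ u q) : ∀ᶠ x in 𝓝 q, u x = 0 := by
  refine eventuallyEq_zero_of_fderiv_mem (𝒩 := {η | AnalyticAt ℝ η q ∧ IsFlatAt η q})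
    (fun η h => h.1) (fun η h w => ⟨?_, ?_⟩) (fun η h => h.2.apply_eq_zero) ⟨hA, hu⟩
  · exact ((ContinuousLinearMap.apply ℝ ℝ w).analyticAt _).fun_comp h.1.fderiv
  · exact h.2.fderiv_apply h.1.contDiffAt w

theorem IsFlatAt.eqOn_zero {u : X → ℝ} {q : X} (hu : IsFlatAt u q) {Ω : Set X} (hq : q ∈ Ω)
    (hΩ : IsPreconnected Ω) (hA : AnalyticOnNhd ℝ u Ω) : ∀ x ∈ Ω, u x = 0 := fun _ hx =>
  AnalyticOnNhd.eqOn_zero_of_preconnected_of_eventuallyEq_zero (𝕜 := ℝ) hA hΩ hq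
    (hu.eventually_eq_zero (hA q hq)) hx

end FlatAnalytic

/-- A linear relation over the field of germs is a relation at almost every `t`, where the minor
excludes it. -/
theorem hasVanishingRank_of_det_ne_zero {T : Type} {𝒰 : Ultrafilter T} {E : Type}
    [NormedAddCommGroup E] [NormedSpace ℝ E] {x : T → E} {n : ℕ} {h : Fin n → E → ℝ}
    (hh : ∀ i, h i ∈ vanishingGerms 𝒰 x) (v : Fin n → E)
    (hdet : ∀ᶠ t in 𝒰, (Matrix.of fun i j => fderiv ℝ (h i) (x t) (v j)).det ≠ 0) :
    HasVanishingRank 𝒰 x n := by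
  refine ⟨h, hh, Fintype.linearIndependent_iff.2 fun c hc => ?_⟩
  have hex : ∀ i, ∃ γ : T → ℝ, ((γ : T → ℝ) : (𝒰 : Filter T).Germ ℝ) = c i := fun i =>
    Quotient.exists_rep (c i)
  choose γ hγ using hex
  have hsum : ∀ u : Fin n → T → ℝ, ∑ i, ((u i : T → ℝ) : (𝒰 : Filter T).Germ ℝ) =
      ((fun t => ∑ i, u i t : T → ℝ) : (𝒰 : Filter T).Germ ℝ) := by
    intro u
    have := (map_sum (Filter.Germ.coeRingHom (R := ℝ) (𝒰 : Filter T)) u Finset.univ).symm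
    have e : (∑ i, u i) = fun t => ∑ i, u i t := by ext t; simp
    rw [e] at this
    exact this
  have h1 : ∀ j, ∀ᶠ t in 𝒰, ∑ i, γ i t * fderiv ℝ (h i) (x t) (v j) = 0 := by
    intro j
    have h2 := congrFun hc (v j)
    rw [Finset.sum_apply] at h2
    have h3 : ∑ i, ((fun t => γ i t * fderiv ℝ (h i) (x t) (v j) : T → ℝ) :
        (𝒰 : Filter T).Germ ℝ) = 0 := by
      refine (Finset.sum_congr rfl fun i _ => ?_).trans h2
      rw [Pi.smul_apply, ← hγ i]
      rfl
    rw [hsum] at h3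
    exact Filter.Germ.coe_eq.1 h3
  intro i
  rw [← hγ i]
  refine Filter.Germ.coe_eq.2 ?_
  filter_upwards [eventually_all.2 h1, hdet] with t h2 h3
  have h4 : Matrix.vecMul (fun i => γ i t) (Matrix.of fun i j => fderiv ℝ (h i) (x t) (v j)) = 0 := by
    ext j
    exact h2 j
  exact congrFun (Matrix.eq_zero_of_vecMul_eq_zero h3 h4) i

/-! ### A flat difference from an analytic function vanishes along rays. -/

section Uniqueness

variable {X F : Type} [NormedAddCommGroup X] [NormedSpace ℝ X] [FiniteDimensional ℝ X]
  [NormedAddCommGroup F] [NormedSpace ℝ F] [FiniteDimensional ℝ F]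

/-- A solution of a nondegenerate system of analytic equations which is infinitely close to an
analytic function along a ray is equal to this function. -/
theorem eventually_eq_of_flat_of_equations {f g : X → F} {p : X} (ξ : X) (hg : AnalyticAt ℝ g p)
    (hfg : IsFlatAt (fun x => f x - g x) p)
    {h : Fin (Module.finrank ℝ F) → X × F → ℝ} {w : Fin (Module.finrank ℝ F) → F}
    (hh : ∀ i, AnalyticAt ℝ (h i) (p, g p)) {𝒰 : Ultrafilter ℝ} (h𝒰 : (𝒰 : Filter ℝ) ≤ 𝓝[≠] 0)
    (hz : ∀ i, ∀ᶠ t in (𝒰 : Filter ℝ), h i (p + t • ξ, f (p + t • ξ)) = 0)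
    (hdet : ∀ᶠ t in (𝒰 : Filter ℝ), (jacMatrix h w (p + t • ξ, f (p + t • ξ))).det ≠ 0) :
    ∀ᶠ t in (𝒰 : Filter ℝ), f (p + t • ξ) = g (p + t • ξ) := by
  have h𝒰0 : (𝒰 : Filter ℝ) ≤ 𝓝 0 := h𝒰.trans nhdsWithin_le_nhds
  set y : ℝ → ℝ × F := fun t => (0, f (p + t • ξ) - g (p + t • ξ)) with hy
  -- Coordinates over the ray in which the graph of `g` is the axis. The graph of `f` becomes `t •
  -- (1, 0)` plus a flat vertical vector, which elimination places on the axis.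
  set ι : ℝ × F → X × F := fun a => (p + a.1 • ξ, g (p + a.1 • ξ) + a.2) with hι
  have hι0 : ι 0 = (p, g p) := by simp [hι]
  have hr : AnalyticAt ℝ (fun a : ℝ × F => p + a.1 • ξ) 0 :=
    analyticAt_const.fun_add (((ContinuousLinearMap.fst ℝ ℝ F).analyticAt _).fun_smul
      analyticAt_const)
  have hgr : AnalyticAt ℝ (fun a : ℝ × F => g (p + a.1 • ξ)) 0 :=
    AnalyticAt.fun_comp_of_eq (g := g) (f := fun a : ℝ × F => p + a.1 • ξ) hg hr (by simp)
  have hιA : AnalyticAt ℝ ι 0 := hr.prod (hgr.fun_add ((ContinuousLinearMap.snd ℝ ℝ F).analyticAt _))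
  have hiA : ∀ i, AnalyticAt ℝ (fun a => h i (ι a)) 0 := fun i => by
    exact AnalyticAt.fun_comp_of_eq (g := h i) (f := ι) (hh i) hιA hι0
  have hflat : FlatAlong 𝒰 (fun t => t) y := by
    intro n
    have h1 := (hfg.comp_ray ξ (n + 1)).mono h𝒰0
    obtain ⟨C, hC⟩ := h1.bound
    have h2 : ∀ᶠ t in (𝒰 : Filter ℝ), C * |t| < 1 := by
      have : Tendsto (fun t : ℝ => C * |t|) (𝓝 0) (𝓝 0) := by
        have : Continuous fun t : ℝ => C * |t| := by fun_prop
        simpa using this.tendsto 0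
      exact h𝒰0 (this.eventually (gt_mem_nhds one_pos))
    filter_upwards [hC, h2] with t h3 h4
    rw [norm_pow, Real.norm_eq_abs, pow_succ] at h3
    have h5 : ‖y t‖ = ‖f (p + t • ξ) - g (p + t • ξ)‖ := by
      rw [hy, Prod.norm_mk, norm_zero, max_eq_right (norm_nonneg _)]
    rw [h5]
    calc _ ≤ C * (|t| ^ n * |t|) := h3
      _ = |t| ^ n * (C * |t|) := by ring
      _ ≤ |t| ^ n * 1 := by gcongr
      _ = |t| ^ n := mul_one _
  have hx : ∀ t, t • ((1 : ℝ), (0 : F)) + y t = (t, f (p + t • ξ) - g (p + t • ξ)) := by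
    intro t; simp [hy]
  have hιx : ∀ t, ι (t • ((1 : ℝ), (0 : F)) + y t) = (p + t • ξ, f (p + t • ξ)) := by
    intro t; rw [hx]; simp [hι]
  have hxt : Tendsto (fun t => t • ((1 : ℝ), (0 : F)) + y t) 𝒰 (𝓝 0) := by
    have h1 : Tendsto (fun t : ℝ => t • ((1 : ℝ), (0 : F))) 𝒰 (𝓝 0) := by
      have : Continuous fun t : ℝ => t • ((1 : ℝ), (0 : F)) := by fun_prop
      have := (this.tendsto 0).mono_left h𝒰0
      rwa [zero_smul] at this
    have h2 : Tendsto y 𝒰 (𝓝 0) := by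
      have h3 := ((hfg.comp_ray ξ 1).mono h𝒰0).trans_tendsto (g'' := fun t : ℝ => t ^ 1) (by
        have : Continuous fun t : ℝ => t ^ 1 := by fun_prop
        simpa using (this.tendsto 0).mono_left h𝒰0)
      exact tendsto_const_nhds.prodMk_nhds h3
    simpa using h1.add h2
  have hrank : HasVanishingRank 𝒰 (fun t => t • ((1 : ℝ), (0 : F)) + y t) (Module.finrank ℝ F) := by
    refine hasVanishingRank_of_det_ne_zero (h := fun i a => h i (ι a)) (fun i => ⟨hiA i, ?_⟩)
      (fun j => (0, w j)) ?_
    · filter_upwards [hz i] with t ht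
      rwa [hιx]
    · have hιd : ∀ a, AnalyticAt ℝ ι a → ∀ w, fderiv ℝ ι a (0, w) = (0, w) := by
        intro a ha w
        have h1 : HasDerivAt (fun s : ℝ => ι (a + s • ((0 : ℝ), w))) (fderiv ℝ ι a (0, w)) 0 := by
          have h2 : HasDerivAt (fun s : ℝ => a + s • ((0 : ℝ), w)) ((0 : ℝ), w) 0 := by
            simpa using ((hasDerivAt_id (0 : ℝ)).smul_const ((0 : ℝ), w)).const_add a
          refine HasFDerivAt.comp_hasDerivAt (f := fun s : ℝ => a + s • ((0 : ℝ), w)) (0 : ℝ)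
            (l := ι) ?_ h2
          simpa using ha.differentiableAt.hasFDerivAt
        have h3 : HasDerivAt (fun s : ℝ => ι (a + s • ((0 : ℝ), w))) ((0 : X), w) 0 := by
          have h4 : (fun s : ℝ => ι (a + s • ((0 : ℝ), w))) = fun s => ι a + s • ((0 : X), w) := by
            ext1 s
            ext1
            · simp [hι]
            · simp [hι, add_assoc]
          rw [h4]
          simpa using ((hasDerivAt_id (0 : ℝ)).smul_const ((0 : X), w)).const_add (ι a)
        exact h1.unique h3
      have hhev := eventually_all.2 fun i => (hh i).eventually_analyticAt
      filter_upwards [hdet, hxt.eventually hιA.eventually_analyticAt,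
        (hιA.continuousAt.tendsto.comp hxt).eventually (hι0 ▸ hhev)] with t h1 h2 h3
      convert h1 using 2
      ext i j
      have h4 := (HasFDerivAt.comp (t • ((1 : ℝ), (0 : F)) + y t)
        (h3 i).differentiableAt.hasFDerivAt h2.differentiableAt.hasFDerivAt).fderiv
      have h5 : (h i ∘ ι) = fun a => h i (ι a) := rfl
      rw [h5] at h4
      simp only [jacMatrix, Matrix.of_apply]
      rw [h4]
      simp only [Function.comp_apply, ContinuousLinearMap.comp_apply, hιd _ h2, hιx]
  have hfin := eventually_mem_span_of_hasVanishingRank (𝒰 := 𝒰) (Module.finrank ℝ F) (ℝ × F)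
    (by rw [Module.finrank_prod, Module.finrank_self, add_comm]) (1, 0) (fun t => t) y
    (by simp) h𝒰0 (h𝒰 self_mem_nhdsWithin) hflat hrank
  filter_upwards [hfin] with t ht
  obtain ⟨c, hc⟩ := Submodule.mem_span_singleton.1 ht
  have h1 : f (p + t • ξ) - g (p + t • ξ) = 0 := by
    have := congrArg Prod.snd hc
    simpa [hy] using this.symm
  exact sub_eq_zero.1 h1

end Uniqueness

section

variable {X F : Type*} [NormedAddCommGroup X] [NormedSpace ℝ X]
  [NormedAddCommGroup F] [NormedSpace ℝ F]

theorem TaylorBound.mono {f : X → F} {x : X} {A A' M M' : ℝ} (h : TaylorBound f x A M)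
    (hA : A ≤ A') (hA0 : 0 ≤ A') (hM0 : 0 ≤ M) (hM : M ≤ M') : TaylorBound f x A' M' := by
  intro n y
  refine (h n y).trans ?_
  gcongr

theorem TaylorBound.congr {f g : X → F} {x : X} {A M : ℝ} (h : TaylorBound f x A M)
    (hfg : f =ᶠ[𝓝 x] g) : TaylorBound g x A M := by
  intro n y
  rw [← (hfg.iteratedFDeriv ℝ n).eq_of_nhds]
  exact h n y

end

/-! ### Analyticity of the graph in the interior and extension past boundary points. -/

section Extension

variable {X F : Type} [NormedAddCommGroup X] [NormedSpace ℝ X] [FiniteDimensional ℝ X]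
  [NormedAddCommGroup F] [NormedSpace ℝ F] [FiniteDimensional ℝ F]

/-- `V` is defined in the open set `W` by the analytic equations `𝓕`. -/
structure IsEquationSet {E : Type} [NormedAddCommGroup E] [NormedSpace ℝ E] (V W : Set E)
    (𝓕 : Set (E → ℝ)) : Prop where
  isOpen : IsOpen W
  analyticOnNhd : ∀ h ∈ 𝓕, AnalyticOnNhd ℝ h W
  mem_iff : ∀ p ∈ W, p ∈ V ↔ ∀ h ∈ 𝓕, h p = 0

omit [FiniteDimensional ℝ X] in
theorem Convex.add_smul_sub_mem_of_mem_closure {Ω : Set X} (hΩ : IsOpen Ω) (hc : Convex ℝ Ω) {p x : X}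
    (hp : p ∈ closure Ω) (hx : x ∈ Ω) {t : ℝ} (h0 : 0 < t) (h1 : t ≤ 1) : p + t • (x - p) ∈ Ω := by
  have h2 := hc.combo_closure_interior_mem_interior hp (hΩ.interior_eq.symm ▸ hx)
    (sub_nonneg.2 h1) h0 (by ring)
  rw [hΩ.interior_eq] at h2
  convert h2 using 1
  rw [smul_sub, sub_smul, one_smul]
  abel

variable {V W : Set (X × F)} {𝓕 : Set (X × F → ℝ)} {f g : X → F} {p : X} {Ω : Set X}

/-- By convexity each `ξ` with `p + ξ ∈ Ω` gives a ray that stays in `Ω` for small `t > 0`. The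
equations vanish on this open cone of rays, hence are flat at its vertex `p`. -/
theorem IsEquationSet.exists_full_rank (hE : IsEquationSet V W 𝓕)
    (hdim : SectionDimLE V (Module.finrank ℝ X)) (hΩ : IsOpen Ω) (hc : Convex ℝ Ω)
    (hne : Ω.Nonempty) (hp : p ∈ closure Ω) (hf : ContDiffAt ℝ ∞ f p) (hW : (p, f p) ∈ W)
    (hV : ∀ x ∈ Ω, (x, f x) ∈ V) :
    ∃ (h : Fin (Module.finrank ℝ F) → X × F → ℝ) (w : Fin (Module.finrank ℝ F) → F),
      (∀ i, AnalyticOnNhd ℝ (h i) W) ∧ (∀ i, IsFlatAt (fun x => h i (x, f x)) p) ∧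
      ¬ IsFlatAt (fun x => (jacMatrix h w (x, f x)).det) p := by
  refine _root_.exists_full_rank hE.isOpen hW hE.analyticOnNhd (fun a ha h => (hE.mem_iff a ha).2 h)
    hdim hf fun h hh => ?_
  refine isFlatAt_of_cone (contDiffAt_comp_graph (hE.analyticOnNhd h hh _ hW) hf)
    (U := (fun ξ => p + ξ) ⁻¹' Ω) (hΩ.preimage (by fun_prop)) ?_ fun ξ hξ => ?_
  · obtain ⟨x, hx⟩ := hne
    exact ⟨x - p, by simpa using hx⟩
  · have h1 : Tendsto (fun t : ℝ => (p + t • ξ, f (p + t • ξ))) (𝓝 0) (𝓝 (p, f p)) :=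
      (tendsto_ray p ξ).prodMk_nhds (hf.continuousAt.tendsto.comp (tendsto_ray p ξ))
    have h2 : ∀ᶠ t in 𝓝[>] (0 : ℝ), h (p + t • ξ, f (p + t • ξ)) = 0 := by
      filter_upwards [nhdsWithin_le_nhds (h1.eventually (hE.isOpen.mem_nhds hW)),
        Ioc_mem_nhdsGT one_pos] with t ht ht1
      have h3 := hc.add_smul_sub_mem_of_mem_closure hΩ hp hξ ht1.1 ht1.2
      rw [add_sub_cancel_left] at h3
      exact (hE.mem_iff _ ht).1 (hV _ h3) h hh
    exact h2.frequently.filter_mono (nhdsWithin_mono _ fun t (ht : 0 < t) => ht.ne')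

omit [FiniteDimensional ℝ X] [FiniteDimensional ℝ F] in
theorem analyticOnNhd_comp_graph (hf : AnalyticOnNhd ℝ f Ω) {k : X × F → ℝ}
    (hk : AnalyticOnNhd ℝ k W) (hW : ∀ x ∈ Ω, (x, f x) ∈ W) :
    AnalyticOnNhd ℝ (fun x => k (x, f x)) Ω := fun x hx =>
  AnalyticAt.fun_comp (g := k) (f := fun x => (x, f x)) (hk _ (hW x hx))
    (analyticAt_id.prod (hf x hx))

/-- A function whose graph over a convex open set is analytic and contained in `V` is equal
to its analytic asymptotic expansion at a boundary point. -/
theorem IsEquationSet.eventually_eq_of_flat (hE : IsEquationSet V W 𝓕)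
    (hdim : SectionDimLE V (Module.finrank ℝ X)) (hΩ : IsOpen Ω) (hc : Convex ℝ Ω)
    (hp : p ∈ closure Ω) (hf : AnalyticOnNhd ℝ f Ω) (hW : ∀ x ∈ Ω, (x, f x) ∈ W)
    (hV : ∀ x ∈ Ω, (x, f x) ∈ V) (hg : AnalyticAt ℝ g p) (hgW : (p, g p) ∈ W)
    (hfg : IsFlatAt (fun x => f x - g x) p) : ∀ᶠ x in 𝓝 p, x ∈ Ω → f x = g x := by
  rcases Ω.eq_empty_or_nonempty with rfl | ⟨x₁, hx₁⟩
  · simp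
  -- The system is chosen at an interior point, where `f` is analytic: there flat equations hold
  -- exactly, and a determinant that is not flat vanishes on no open subset of `Ω`.
  obtain ⟨h, w, hh, hhflat, hdet⟩ := hE.exists_full_rank hdim hΩ hc ⟨x₁, hx₁⟩ (subset_closure hx₁)
    (hf x₁ hx₁).contDiffAt (hW x₁ hx₁) hV
  have hzero : ∀ i, ∀ x ∈ Ω, h i (x, f x) = 0 := fun i =>
    (hhflat i).eqOn_zero hx₁ hc.isPreconnected (analyticOnNhd_comp_graph hf (hh i) hW)
  have hDA : AnalyticOnNhd ℝ (fun x => (jacMatrix h w (x, f x)).det) Ω :=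
    analyticOnNhd_comp_graph (k := fun a => (jacMatrix h w a).det) hf
      (fun a ha => analyticAt_det (analyticAt_jacMatrix fun i => hh i a ha)) hW
  have hDne : ∀ x ∈ Ω, ∃ᶠ y in 𝓝 x, (jacMatrix h w (y, f y)).det ≠ 0 := by
    intro x hx hcon
    refine hdet ?_
    have h1 := hDA.eqOn_zero_of_preconnected_of_eventuallyEq_zero hc.isPreconnected hx
      (hcon.mono fun y hy => not_not.1 hy)
    refine (isFlatAt_zero x₁).congr ?_
    filter_upwards [hΩ.mem_nhds hx₁] with y hy using (h1 hy).symm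
  obtain ⟨ε, hε, hball⟩ := Metric.eventually_nhds_iff_ball.1 hg.eventually_analyticAt
  filter_upwards [Metric.ball_mem_nhds p hε] with x hxp hx
  by_contra hne
  have hcont : ContinuousAt (fun y => f y - g y) x :=
    (hf x hx).continuousAt.sub (hball x hxp).continuousAt
  have hev1 : ∀ᶠ y in 𝓝 x, y ∈ Ω := hΩ.mem_nhds hx
  have hev2 : ∀ᶠ y in 𝓝 x, y ∈ Metric.ball p ε := Metric.isOpen_ball.mem_nhds hxp
  -- A small move makes the determinant nonzero while keeping `f ≠ g`. On the segment from `p` to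
  -- `y` the analytic function `u` is then not identically zero, so it is nonzero arbitrarily close
  -- to `p`.
  obtain ⟨y, hyD, hyne, hyΩ, hyp⟩ := ((hDne x hx).and_eventually
    ((hcont.eventually_ne (sub_ne_zero.2 hne)).and (hev1.and hev2))).exists
  set ξ := y - p with hξ
  set u : ℝ → F := fun t => (jacMatrix h w (p + t • ξ, f (p + t • ξ))).det •
    (f (p + t • ξ) - g (p + t • ξ)) with hu
  have hmemΩ : ∀ t ∈ Ioc (0 : ℝ) 1, p + t • ξ ∈ Ω := fun t ht =>
    hc.add_smul_sub_mem_of_mem_closure hΩ hp hyΩ ht.1 ht.2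
  have hmemb : ∀ t ∈ Ioc (0 : ℝ) 1, p + t • ξ ∈ Metric.ball p ε := fun t ht => by
    rw [Metric.mem_ball, dist_eq_norm] at hyp ⊢
    rw [add_sub_cancel_left, norm_smul, Real.norm_eq_abs, abs_of_pos ht.1]
    exact (mul_le_of_le_one_left (norm_nonneg _) ht.2).trans_lt hyp
  have huA : AnalyticOnNhd ℝ u (Ioc 0 1) := by
    intro t ht
    have h1 : AnalyticAt ℝ (fun t : ℝ => p + t • ξ) t :=
      analyticAt_const.fun_add (analyticAt_id.fun_smul analyticAt_const)
    have h2 : ∀ {E : Type} [NormedAddCommGroup E] [NormedSpace ℝ E] {k : X → E},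
        AnalyticAt ℝ k (p + t • ξ) → AnalyticAt ℝ (fun t : ℝ => k (p + t • ξ)) t :=
      fun {E} _ _ {k} hk => AnalyticAt.fun_comp (g := k) (f := fun t : ℝ => p + t • ξ) hk h1
    exact (h2 (hDA _ (hmemΩ t ht))).fun_smul
      ((h2 (hf _ (hmemΩ t ht))).fun_sub (h2 (hball _ (hmemb t ht))))
  have hu1 : u 1 ≠ 0 := by
    simp only [hu, hξ, one_smul, add_sub_cancel]
    exact smul_ne_zero hyD hyne
  have hfreq : ∃ᶠ t in 𝓝[>] (0 : ℝ), u t ≠ 0 := by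
    intro hcon
    have h1 : ∀ᶠ t in 𝓝[>] (0 : ℝ), u t = 0 := by simpa using hcon
    obtain ⟨δ, hδ, hδ'⟩ := mem_nhdsGT_iff_exists_Ioo_subset.1 h1
    have hδ0 : 0 < δ := hδ
    set s := min (δ / 2) 1
    have hs0 : 0 < s := lt_min (by linarith) one_pos
    have hsδ : s < δ := (min_le_left _ _).trans_lt (by linarith)
    refine hu1 (huA.eqOn_zero_of_preconnected_of_eventuallyEq_zero isPreconnected_Ioc
      (z₀ := s) ⟨hs0, min_le_right _ _⟩ ?_ ⟨one_pos, le_rfl⟩)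
    filter_upwards [Ioo_mem_nhds hs0 hsδ] with t ht using hδ' ht
  have hNB : (𝓝[>] (0 : ℝ) ⊓ 𝓟 {t | u t ≠ 0}).NeBot := by
    rwa [← frequently_mem_iff_neBot]
  -- On this ultrafilter both the determinant and `f - g` are nonzero, contradicting uniqueness
  -- along the ray.
  set 𝒰 : Ultrafilter ℝ := Ultrafilter.of (𝓝[>] (0 : ℝ) ⊓ 𝓟 {t | u t ≠ 0})
  have h𝒰 : (𝒰 : Filter ℝ) ≤ 𝓝[>] (0 : ℝ) ⊓ 𝓟 {t | u t ≠ 0} := Ultrafilter.of_le _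
  have hune : ∀ᶠ t in (𝒰 : Filter ℝ), u t ≠ 0 := h𝒰 (mem_inf_of_right (mem_principal_self _))
  have hIoc : ∀ᶠ t in (𝒰 : Filter ℝ), t ∈ Ioc (0 : ℝ) 1 :=
    h𝒰 (mem_inf_of_left (Ioc_mem_nhdsGT one_pos))
  have hfin := eventually_eq_of_flat_of_equations (𝒰 := 𝒰) (w := w) ξ hg hfg
    (fun i => hh i _ hgW)
    ((h𝒰.trans inf_le_left).trans (nhdsWithin_mono _ fun t (ht : 0 < t) => ht.ne'))
    (fun i => hIoc.mono fun t ht => hzero i _ (hmemΩ t ht))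
    (hune.mono fun t ht h0 => ht (by simp only [hu]; rw [h0, zero_smul]))
  obtain ⟨t, h1, h2⟩ := (hfin.and hune).exists
  exact h2 (by simp only [hu]; rw [h1, sub_self, smul_zero])

/-- Bounds of analytic type at the points where `f` is not analytic imply bounds at the nearby
points. -/
theorem IsEquationSet.taylorBound_of_touching_ball (hE : IsEquationSet V W 𝓕)
    (hdim : SectionDimLE V (Module.finrank ℝ X)) {x y : X} (hxy : x ≠ y) (hf : ContDiffAt ℝ ∞ f x)
    (hfA : AnalyticOnNhd ℝ f (Metric.ball y (dist y x)))
    (hW : ∀ z ∈ Metric.closedBall y (dist y x), (z, f z) ∈ W)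
    (hV : ∀ z ∈ Metric.closedBall y (dist y x), (z, f z) ∈ V) {A M : ℝ} (hM : 0 < M)
    (hb : TaylorBound f x A M) (hd : dist y x ≤ (4 * (2 * Real.exp 1 * M))⁻¹) :
    TaylorBound f y (2 * A) (4 * (2 * Real.exp 1 * M)) := by
  obtain ⟨g, P, hP, hPn, hflat⟩ := exists_hasFPowerSeriesOnBall_isFlatAt_sub hf hM hb
  set K := 2 * Real.exp 1 * M with hK
  have hK0 : 0 < K := by positivity
  have hd0 : 0 < dist y x := dist_pos.2 hxy.symm
  have hx : x ∈ Metric.closedBall y (dist y x) := by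
    rw [Metric.mem_closedBall, dist_comm]
  have hgx : g x = f x := (sub_eq_zero.1 hflat.apply_eq_zero).symm
  have hcl : x ∈ closure (Metric.ball y (dist y x)) := by
    rw [closure_ball y hd0.ne']; exact hx
  have hev := hE.eventually_eq_of_flat hdim Metric.isOpen_ball (convex_ball _ _) hcl hfA
    (fun z hz => hW z (Metric.ball_subset_closedBall hz))
    (fun z hz => hV z (Metric.ball_subset_closedBall hz)) hP.analyticAt (hgx ▸ hW x hx) hflat
  have hsub : Metric.ball y (dist y x) ⊆ Metric.eball x (ENNReal.ofReal K⁻¹) := by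
    intro z hz
    rw [Metric.eball_ofReal, Metric.mem_ball]
    rw [Metric.mem_ball] at hz
    have h1 : dist z x < 2 * (4 * K)⁻¹ := by linarith [dist_triangle z y x]
    have h2 : 2 * (4 * K)⁻¹ = K⁻¹ / 2 := by field_simp; norm_num
    have h3 : 0 < K⁻¹ := by positivity
    linarith
  have hgA : AnalyticOnNhd ℝ g (Metric.ball y (dist y x)) := fun z hz =>
    hP.analyticOnNhd z (hsub hz)
  obtain ⟨O, hO, hOo, hxO⟩ := eventually_nhds_iff.1 hev
  obtain ⟨z, hz, hzΩ⟩ := mem_closure_iff.1 hcl O hOo hxO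
  -- Agreement near the touching point spreads over the ball by the identity theorem, and the bounds
  -- for the power series at `x` are re-expanded at `y`.
  have heq : EqOn f g (Metric.ball y (dist y x)) :=
    hfA.eqOn_of_preconnected_of_eventuallyEq hgA (convex_ball _ _).isPreconnected hzΩ (by
      filter_upwards [hOo.mem_nhds hz, Metric.isOpen_ball.mem_nhds hzΩ] with a h1 h2
      exact hO a h1 h2)
  have hyy : y ∈ Metric.ball y (dist y x) := Metric.mem_ball_self hd0
  have h1 := hP.taylorBound_of_mem hK0 hPn (y := y - x) (by rwa [← dist_eq_norm]) (by
    have := hsub hyy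
    rw [Metric.eball_ofReal, Metric.mem_ball, dist_eq_norm] at this
    rw [← enorm_eq_nnnorm, ← ofReal_norm]
    exact (ENNReal.ofReal_lt_ofReal_iff (by positivity)).2 this)
  rw [add_sub_cancel] at h1
  refine h1.congr ?_
  filter_upwards [Metric.isOpen_ball.mem_nhds hyy] with a ha using (heq ha).symm

/-- A smooth graph contained in an analytic set of the same dimension is analytic. -/
theorem IsEquationSet.analyticOnNhd_of_contDiff (hE : IsEquationSet V W 𝓕)
    (hdim : SectionDimLE V (Module.finrank ℝ X)) (hΩ : IsOpen Ω) (hf : ∀ x ∈ Ω, ContDiffAt ℝ ∞ f x)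
    (hW : ∀ x ∈ Ω, (x, f x) ∈ W) (hV : ∀ x ∈ Ω, (x, f x) ∈ V) : AnalyticOnNhd ℝ f Ω := by
  by_contra hcon
  set C : Set X := {x | x ∈ Ω ∧ ¬ AnalyticAt ℝ f x} with hC
  have hCne : C.Nonempty := by
    simp only [AnalyticOnNhd] at hcon
    push Not at hcon
    exact hcon
  have hCeq : C = Ω ∩ {x | AnalyticAt ℝ f x}ᶜ := rfl
  have hclosed : IsClosed ({x | AnalyticAt ℝ f x}ᶜ) := (isOpen_analyticAt ℝ f).isClosed_compl
  have : ProperSpace X := FiniteDimensional.proper ℝ X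
  have hlc : IsLocallyClosed C := hΩ.isLocallyClosed.inter hclosed.isLocallyClosed
  have : LocallyCompactSpace C := IsLocallyClosed.locallyCompactSpace hlc
  have : Nonempty C := hCne.to_subtype
  -- Every point of `C` has some Taylor bound by the convergence theorem. The sets with a fixed
  -- bound are closed in the locally compact space `C`, so by Baire one of them has interior.
  set S : ℕ → Set C := fun N => {x | TaylorBound f x (N + 1) (N + 1)} with hS
  have hScl : ∀ N, IsClosed (S N) := by
    intro N
    simp only [hS, TaylorBound, ofPred_forall]
    refine isClosed_iInter fun n => isClosed_iInter fun y => ?_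
    refine isClosed_le (continuous_iff_continuousAt.2 fun x => ?_) continuous_const
    have h1 : ContinuousAt (iteratedFDeriv ℝ n f) x :=
      ((hf x x.2.1).iteratedFDeriv_right (m := 0) (i := n) (by simpa using (by exact_mod_cast le_top : (n : WithTop ℕ∞) ≤ ∞))).continuousAt
    have h2 : ContinuousAt (fun z : X => ‖iteratedFDeriv ℝ n f z (fun _ => y)‖) x :=
      ((ContinuousMultilinearMap.apply ℝ (fun _ : Fin n => X) F fun _ => y).continuous.continuousAt.comp
        h1).norm
    exact ContinuousAt.comp (g := fun z : X => ‖iteratedFDeriv ℝ n f z (fun _ => y)‖)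
      (f := ((↑) : C → X)) h2 continuous_subtype_val.continuousAt
  have hScov : ⋃ N, S N = univ := by
    refine eq_univ_of_forall fun x => ?_
    obtain ⟨ε, hε, hball⟩ := Metric.isOpen_iff.1 hΩ x x.2.1
    obtain ⟨h, w, hh, hhflat, hdet⟩ := hE.exists_full_rank hdim Metric.isOpen_ball
      (convex_ball (x : X) ε) ⟨x, Metric.mem_ball_self hε⟩
      (subset_closure (Metric.mem_ball_self hε)) (hf x x.2.1) (hW x x.2.1)
      (fun z hz => hV z (hball hz))
    obtain ⟨A, M, hA, hM, hb⟩ := exists_taylorBound_of_full_rank (fun i => hh i _ (hW x x.2.1))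
      (hf x x.2.1) hhflat hdet
    obtain ⟨N, hN⟩ := exists_nat_ge (max A M)
    refine mem_iUnion.2 ⟨N, ?_⟩
    have h1 := (le_max_left A M).trans hN
    have h2 := (le_max_right A M).trans hN
    exact hb.mono (by linarith) (by positivity) hM.le (by linarith)
  obtain ⟨N, ⟨x₁, hx₁⟩⟩ := nonempty_interior_of_iUnion_of_closed hScl hScov
  obtain ⟨O, hO, hOint⟩ := isOpen_induced_iff.1 (isOpen_interior (s := S N))
  have hx₁O : (x₁ : X) ∈ O := by
    have : x₁ ∈ Subtype.val ⁻¹' O := hOint ▸ hx₁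
    exact this
  obtain ⟨ε, hε, hball⟩ := Metric.isOpen_iff.1 (hO.inter hΩ) x₁ ⟨hx₁O, x₁.2.1⟩
  have hbC : ∀ x ∈ C, x ∈ Metric.ball (x₁ : X) ε → TaylorBound f x (N + 1) (N + 1) := by
    intro x hxC hx
    have : (⟨x, hxC⟩ : C) ∈ interior (S N) := by rw [← hOint]; exact (hball hx).1
    exact interior_subset this
  set M : ℝ := N + 1 with hM
  have hM0 : 0 < M := by positivity
  set K := 4 * (2 * Real.exp 1 * M) with hK
  have hK0 : 0 < K := by positivity
  have hKM : M ≤ K := by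
    have : 1 ≤ Real.exp 1 := Real.one_le_exp zero_le_one
    nlinarith
  set δ := min (ε / 4) K⁻¹ with hδ
  have hδ0 : 0 < δ := lt_min (by positivity) (by positivity)
  refine x₁.2.2 (analyticAt_of_taylorBound (A := 2 * M) (M := K) hδ0 (by positivity) hK0
    (fun y hy => hf y (hball (Metric.ball_subset_ball ?_ hy)).2) fun y hy => ?_)
  · exact (min_le_left _ _).trans (by linarith)
  have hyε : dist y x₁ < ε / 4 := (Metric.mem_ball.1 hy).trans_le (min_le_left _ _)
  have hyK : dist y x₁ < K⁻¹ := (Metric.mem_ball.1 hy).trans_le (min_le_right _ _)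
  by_cases hyC : y ∈ C
  · exact (hbC y hyC (Metric.mem_ball.2 (by linarith))).mono (by linarith) (by positivity) hM0.le hKM
  -- The nearest non-analytic point is sought in a ball of radius `ε / 2`. As `y` is within `ε / 4`
  -- of `x₁`, the open ball about `y` up to this point contains no other non-analytic point, so it
  -- touches the singular set from outside.
  have hcpt : IsCompact (Metric.closedBall (x₁ : X) (ε / 2) ∩ {x | AnalyticAt ℝ f x}ᶜ) :=
    (isCompact_closedBall _ _).inter_right hclosed
  obtain ⟨x, ⟨hx1, hx2⟩, hmin⟩ := hcpt.exists_isMinOn ⟨x₁, Metric.mem_closedBall_self (by positivity),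
    x₁.2.2⟩ (f := fun z => dist y z) (by fun_prop)
  have hdle : dist y x ≤ dist y x₁ := hmin ⟨Metric.mem_closedBall_self (by positivity), x₁.2.2⟩
  have hxb : x ∈ Metric.ball (x₁ : X) ε := by
    rw [Metric.mem_closedBall] at hx1
    exact Metric.mem_ball.2 (by linarith)
  have hxC : x ∈ C := ⟨(hball hxb).2, hx2⟩
  have hcb : ∀ z ∈ Metric.closedBall y (dist y x), dist z x₁ ≤ ε / 2 := by
    intro z hz
    rw [Metric.mem_closedBall] at hz
    linarith [dist_triangle z y x₁]
  have hcbΩ : ∀ z ∈ Metric.closedBall y (dist y x), z ∈ Ω := fun z hz =>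
    (hball (Metric.mem_ball.2 ((hcb z hz).trans_lt (by linarith)))).2
  refine hE.taylorBound_of_touching_ball hdim (x := x) (fun h : x = y => hyC (h ▸ hxC)) (hf x hxC.1) ?_
    (fun z hz => hW z (hcbΩ z hz)) (fun z hz => hV z (hcbΩ z hz)) hM0 (hbC x hxC hxb)
    (by rw [← hK]; linarith)
  intro z hz
  by_contra hzn
  have h1 : dist y x ≤ dist y z :=
    hmin ⟨Metric.mem_closedBall.2 (hcb z (Metric.ball_subset_closedBall hz)), hzn⟩
  rw [Metric.mem_ball, dist_comm] at hz
  linarith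

/-- A smooth function whose graph over a convex open set is contained in an analytic set of the
same dimension extends analytically past the boundary points where it is smooth. -/
theorem IsEquationSet.exists_analyticAt_extension (hE : IsEquationSet V W 𝓕)
    (hdim : SectionDimLE V (Module.finrank ℝ X)) (hΩ : IsOpen Ω) (hc : Convex ℝ Ω)
    (hne : Ω.Nonempty) (hp : p ∈ closure Ω) (hfp : ContDiffAt ℝ ∞ f p) (hWp : (p, f p) ∈ W)
    (hf : ∀ x ∈ Ω, ContDiffAt ℝ ∞ f x) (hW : ∀ x ∈ Ω, (x, f x) ∈ W)
    (hV : ∀ x ∈ Ω, (x, f x) ∈ V) :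
    ∃ g, AnalyticAt ℝ g p ∧ g p = f p ∧ ∀ᶠ x in 𝓝 p, x ∈ Ω → f x = g x := by
  obtain ⟨h, w, hh, hhflat, hdet⟩ := hE.exists_full_rank hdim hΩ hc hne hp hfp hWp hV
  obtain ⟨A, M, hA, hM, hb⟩ := exists_taylorBound_of_full_rank (fun i => hh i _ hWp)
      hfp hhflat hdet
  obtain ⟨g, P, hP, -, hflat⟩ := exists_hasFPowerSeriesOnBall_isFlatAt_sub hfp hM hb
  have hgp : g p = f p := (sub_eq_zero.1 hflat.apply_eq_zero).symm
  exact ⟨g, hP.analyticAt, hgp, hE.eventually_eq_of_flat hdim hΩ hc hp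
    (hE.analyticOnNhd_of_contDiff hdim hΩ hf hW hV) hW hV hP.analyticAt (hgp ▸ hWp) hflat⟩

end Extension

/-! ### Submanifolds in product coordinates, and the dimension of `V` in terms of sections. -/

section Straightening

/-- `θ` is a `C^n` change of coordinates which maps `Y` to the part of `X × {0}` over `K`. -/
structure IsStraightening {E X F : Type} [NormedAddCommGroup E] [NormedSpace ℝ E]
    [NormedAddCommGroup X] [NormedSpace ℝ X] [NormedAddCommGroup F] [NormedSpace ℝ F]
    (n : WithTop ℕ∞) (θ : OpenPartialHomeomorph E (X × F)) (K : Set X) (Y : Set E) : Prop where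
  contDiffOn : ContDiffOn ℝ n θ θ.source
  contDiffOn_symm : ContDiffOn ℝ n θ.symm θ.target
  mem_iff : ∀ x ∈ θ.source, x ∈ Y ↔ (θ x).1 ∈ K ∧ (θ x).2 = 0

variable {N m : ℕ}

/-- The splitting of `ℝ^N` into the first `m` and the last `N - m` coordinates. -/
noncomputable def coordSplit (h : m ≤ N) :
    EuclideanSpace ℝ (Fin N) ≃L[ℝ] (Fin m → ℝ) × (Fin (N - m) → ℝ) :=
  (EuclideanSpace.equiv (Fin N) ℝ).trans
    ((LinearEquiv.funCongrLeft ℝ ℝ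
        (finSumFinEquiv.trans (finCongr (Nat.add_sub_of_le h)))).trans
      (LinearEquiv.sumArrowLequivProdArrow (Fin m) (Fin (N - m)) ℝ ℝ)).toContinuousLinearEquiv

theorem coordSplit_snd (h : m ≤ N) (x : EuclideanSpace ℝ (Fin N)) (i : Fin (N - m)) :
    (coordSplit h x).2 i = x ⟨m + i, by omega⟩ := rfl

theorem mem_flatModel_iff (h : m ≤ N) (x : EuclideanSpace ℝ (Fin N)) :
    x ∈ flatModel N m ↔ (coordSplit h x).2 = 0 := by
  constructor
  · intro hx
    ext i
    rw [coordSplit_snd]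
    exact hx _ (Nat.le_add_right m i)
  · intro hx i hi
    have := congrFun hx ⟨i - m, by omega⟩
    rw [coordSplit_snd] at this
    simp only [Nat.add_sub_of_le hi, Pi.zero_apply] at this
    exact this

/-- The half space where the last of `m` coordinates is nonnegative. -/
def lastNonneg (m : ℕ) : Set (Fin m → ℝ) := {a | ∀ i : Fin m, (i : ℕ) + 1 = m → 0 ≤ a i}

theorem mem_halfModel_iff (h : m ≤ N) (x : EuclideanSpace ℝ (Fin N)) :
    x ∈ halfModel N m ↔ (coordSplit h x).1 ∈ lastNonneg m ∧ (coordSplit h x).2 = 0 := by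
  rw [halfModel, mem_ofPred, mem_flatModel_iff h, and_comm]
  refine and_congr_left fun _ => ⟨fun hx i hi => hx (Fin.castLE h i) hi, fun hx i hi => ?_⟩
  exact hx ⟨i, by omega⟩ hi

theorem mem_halfModelBoundary_iff (h : m ≤ N) (x : EuclideanSpace ℝ (Fin N)) :
    x ∈ halfModelBoundary N m ↔
      (∀ i : Fin m, (i : ℕ) + 1 = m → (coordSplit h x).1 i = 0) ∧ (coordSplit h x).2 = 0 := by
  rw [halfModelBoundary, mem_ofPred, mem_flatModel_iff h, and_comm]
  refine and_congr_left fun _ => ⟨fun hx i hi => hx (Fin.castLE h i) hi, fun hx i hi => ?_⟩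
  exact hx ⟨i, by omega⟩ hi

theorem isStraightening_of_image_eq (h : m ≤ N) {n : WithTop ℕ∞}
    {φ : OpenPartialHomeomorph (EuclideanSpace ℝ (Fin N)) (EuclideanSpace ℝ (Fin N))}
    (hφ : IsLocalDiffeo n φ) {Y S : Set (EuclideanSpace ℝ (Fin N))}
    (himg : φ '' (Y ∩ φ.source) = S ∩ φ.target) {K : Set (Fin m → ℝ)}
    (hS : ∀ x, x ∈ S ↔ (coordSplit h x).1 ∈ K ∧ (coordSplit h x).2 = 0) :
    IsStraightening n (φ.transHomeomorph (coordSplit h).toHomeomorph) K Y where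
  contDiffOn := (coordSplit h).contDiff.comp_contDiffOn hφ.contDiffOn
  contDiffOn_symm := by
    refine hφ.contDiffOn_symm.comp (coordSplit h).symm.contDiff.contDiffOn fun x hx => ?_
    exact hx
  mem_iff := by
    intro x hx
    have hx' : x ∈ φ.source := hx
    refine Iff.trans ?_ (hS (φ x))
    constructor
    · intro hxY
      have : φ x ∈ S ∩ φ.target := himg ▸ mem_image_of_mem φ ⟨hxY, hx'⟩
      exact this.1
    · intro hxS
      have : φ x ∈ φ '' (Y ∩ φ.source) := himg ▸ ⟨hxS, φ.map_source hx'⟩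
      obtain ⟨y, ⟨hy, hys⟩, hyx⟩ := this
      rwa [← φ.injOn hys hx' hyx]

theorem IsSubmanifold.exists_isStraightening {n : WithTop ℕ∞} {M : Set (EuclideanSpace ℝ (Fin N))}
    (hM : IsSubmanifold n m M) {p : EuclideanSpace ℝ (Fin N)} (hp : p ∈ M) :
    ∃ θ : OpenPartialHomeomorph (EuclideanSpace ℝ (Fin N)) ((Fin m → ℝ) × (Fin (N - m) → ℝ)),
      p ∈ θ.source ∧ IsStraightening n θ univ M := by
  obtain ⟨φ, hpφ, hφ, himg⟩ := hM.exists_chart p hp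
  exact ⟨_, hpφ, isStraightening_of_image_eq hM.dim_le hφ himg
    fun x => by simp [mem_flatModel_iff hM.dim_le]⟩

theorem IsSubmanifold.of_isStraightening {n : WithTop ℕ∞} (h : m ≤ N)
    {M : Set (EuclideanSpace ℝ (Fin N))}
    (hM : ∀ p ∈ M, ∃ θ : OpenPartialHomeomorph (EuclideanSpace ℝ (Fin N))
      ((Fin m → ℝ) × (Fin (N - m) → ℝ)), p ∈ θ.source ∧ IsStraightening n θ univ M) :
    IsSubmanifold n m M := by
  refine ⟨h, fun p hp => ?_⟩
  obtain ⟨θ, hpθ, hθ⟩ := hM p hp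
  refine ⟨θ.transHomeomorph (coordSplit h).symm.toHomeomorph, hpθ, ⟨?_, ?_⟩, ?_⟩
  · exact (coordSplit h).symm.contDiff.comp_contDiffOn hθ.contDiffOn
  · refine hθ.contDiffOn_symm.comp (coordSplit h).contDiff.contDiffOn fun x hx => ?_
    exact hx
  · ext y
    constructor
    · rintro ⟨x, ⟨hxM, hx⟩, rfl⟩
      have hx' : x ∈ θ.source := hx
      refine ⟨(mem_flatModel_iff h _).2 ?_, ?_⟩
      · change (coordSplit h ((coordSplit h).symm (θ x))).2 = 0
        rw [ContinuousLinearEquiv.apply_symm_apply]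
        exact ((hθ.mem_iff x hx').1 hxM).2
      · exact OpenPartialHomeomorph.map_source _ hx
    · rintro ⟨hy, hyt⟩
      have hyt' : coordSplit h y ∈ θ.target := hyt
      refine ⟨θ.symm (coordSplit h y), ⟨(hθ.mem_iff _ (θ.map_target hyt')).2 ⟨mem_univ _, ?_⟩,
        θ.map_target hyt'⟩, ?_⟩
      · rw [θ.right_inv hyt']
        exact (mem_flatModel_iff h y).1 hy
      · change (coordSplit h).symm (θ (θ.symm (coordSplit h y))) = y
        rw [θ.right_inv hyt', ContinuousLinearEquiv.symm_apply_apply]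

theorem IsSubmanifold.of_locally {n : WithTop ℕ∞} (h : m ≤ N)
    {M : Set (EuclideanSpace ℝ (Fin N))}
    (hM : ∀ p ∈ M, ∃ M' O : Set (EuclideanSpace ℝ (Fin N)), IsSubmanifold n m M' ∧ IsOpen O ∧
      p ∈ O ∧ M ∩ O = M' ∩ O) : IsSubmanifold n m M := by
  refine IsSubmanifold.of_isStraightening h fun p hp => ?_
  obtain ⟨M', O, hM', hO, hpO, heq⟩ := hM p hp
  have hmem : ∀ x ∈ O, x ∈ M ↔ x ∈ M' := fun x hx =>
    ⟨fun h => (heq ▸ ⟨h, hx⟩ : x ∈ M' ∩ O).1, fun h => (heq ▸ ⟨h, hx⟩ : x ∈ M ∩ O).1⟩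
  obtain ⟨θ, hpθ, hθ⟩ := hM'.exists_isStraightening ((hmem p hpO).1 hp)
  refine ⟨θ.restrOpen O hO, ⟨hpθ, hpO⟩, ?_, ?_, ?_⟩
  · exact hθ.contDiffOn.mono inter_subset_left
  · exact hθ.contDiffOn_symm.mono inter_subset_left
  · intro x hx
    rw [hmem x hx.2]
    exact hθ.mem_iff x hx.1

/-- The shear `(a, b) ↦ (a, b - g a)` straightens the graph. -/
theorem isSubmanifold_graph (h : m ≤ N)
    (L : ((Fin m → ℝ) × (Fin (N - m) → ℝ)) ≃L[ℝ] EuclideanSpace ℝ (Fin N))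
    {g : (Fin m → ℝ) → (Fin (N - m) → ℝ)} {O : Set (Fin m → ℝ)} (hO : IsOpen O)
    (hg : AnalyticOnNhd ℝ g O) : IsSubmanifold ω m ((fun a => L (a, g a)) '' O) := by
  have hgc : ContDiffOn ℝ ω g O := hg.contDiffOn hO.uniqueDiffOn
  set θ : OpenPartialHomeomorph (EuclideanSpace ℝ (Fin N))
      ((Fin m → ℝ) × (Fin (N - m) → ℝ)) :=
    { toFun := fun x => ((L.symm x).1, (L.symm x).2 - g (L.symm x).1)
      invFun := fun p => L (p.1, p.2 + g p.1)
      source := {x | (L.symm x).1 ∈ O}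
      target := {p | p.1 ∈ O}
      map_source' := fun x hx => hx
      map_target' := fun p hp => by simpa using hp
      left_inv' := fun x hx => by simp
      right_inv' := fun p hp => by simp
      open_source := hO.preimage (continuous_fst.comp L.symm.continuous)
      open_target := hO.preimage continuous_fst
      continuousOn_toFun := by
        have h1 : ContinuousOn (fun x => g (L.symm x).1) {x | (L.symm x).1 ∈ O} :=
          hgc.continuousOn.comp (continuous_fst.comp L.symm.continuous).continuousOn fun x hx => hx
        exact (by fun_prop : Continuous fun x => (L.symm x).1).continuousOn.prodMk
          ((by fun_prop : Continuous fun x => (L.symm x).2).continuousOn.sub h1)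
      continuousOn_invFun := by
        have h1 : ContinuousOn (fun p : (Fin m → ℝ) × (Fin (N - m) → ℝ) => g p.1)
            {p | p.1 ∈ O} := hgc.continuousOn.comp continuous_fst.continuousOn fun x hx => hx
        exact L.continuous.comp_continuousOn (continuous_fst.continuousOn.prodMk
          (continuous_snd.continuousOn.add h1)) } with hθ
  refine IsSubmanifold.of_isStraightening h ?_
  rintro _ ⟨a, ha, rfl⟩
  refine ⟨θ, ?_, ?_, ?_, ?_⟩
  · change (L.symm (L (a, g a))).1 ∈ O
    simpa using ha
  · have h1 : ContDiffOn ℝ ω (fun x => g (L.symm x).1) {x | (L.symm x).1 ∈ O} :=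
      hgc.comp (contDiff_fst.comp L.symm.contDiff).contDiffOn fun x hx => hx
    exact (contDiff_fst.comp L.symm.contDiff).contDiffOn.prodMk
      ((contDiff_snd.comp L.symm.contDiff).contDiffOn.sub h1)
  · have h1 : ContDiffOn ℝ ω (fun p : (Fin m → ℝ) × (Fin (N - m) → ℝ) => g p.1)
        {p | p.1 ∈ O} := hgc.comp contDiff_fst.contDiffOn fun x hx => hx
    exact L.contDiff.comp_contDiffOn (contDiff_fst.contDiffOn.prodMk
      (contDiff_snd.contDiffOn.add h1))
  · intro x hx
    have hx' : (L.symm x).1 ∈ O := hx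
    change _ ↔ _ ∧ (L.symm x).2 - g (L.symm x).1 = 0
    rw [sub_eq_zero]
    constructor
    · rintro ⟨b, -, rfl⟩
      simp
    · rintro ⟨-, h1⟩
      refine ⟨(L.symm x).1, hx', ?_⟩
      change L ((L.symm x).1, g (L.symm x).1) = x
      rw [← h1]
      simp

theorem exists_prod_equiv_of_surjective {A : Type} [NormedAddCommGroup A] [NormedSpace ℝ A]
    [FiniteDimensional ℝ A] (l : EuclideanSpace ℝ (Fin N) →L[ℝ] A) (hl : Function.Surjective l) :
    Module.finrank ℝ A ≤ N ∧ ∃ (e : A ≃L[ℝ] (Fin (Module.finrank ℝ A) → ℝ))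
      (Λ : EuclideanSpace ℝ (Fin N) ≃L[ℝ]
        (Fin (Module.finrank ℝ A) → ℝ) × (Fin (N - Module.finrank ℝ A) → ℝ)),
      ∀ x, (Λ x).1 = e (l x) := by
  have h1 := LinearMap.finrank_range_add_finrank_ker (l : EuclideanSpace ℝ (Fin N) →ₗ[ℝ] A)
  rw [LinearMap.range_eq_top.2 hl, finrank_top, finrank_euclideanSpace_fin] at h1
  refine ⟨by omega, (Module.finBasis ℝ A).equivFun.toContinuousLinearEquiv, ?_⟩
  set K := LinearMap.ker (l : EuclideanSpace ℝ (Fin N) →ₗ[ℝ] A) with hK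
  obtain ⟨Q, hQ⟩ := K.exists_isCompl
  let e2 : K ≃ₗ[ℝ] (Fin (N - Module.finrank ℝ A) → ℝ) :=
    LinearEquiv.ofFinrankEq _ _ (by rw [Module.finrank_fin_fun]; omega)
  set e := (Module.finBasis ℝ A).equivFun
  refine ⟨(LinearMap.equivProdOfSurjectiveOfIsCompl
    ((e : A →ₗ[ℝ] _).comp (l : EuclideanSpace ℝ (Fin N) →ₗ[ℝ] A))
    ((e2 : K →ₗ[ℝ] _).comp (K.projectionOnto Q hQ)) ?_ ?_ ?_).toContinuousLinearEquiv, fun x => rfl⟩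
  · rw [LinearMap.range_eq_top]
    exact e.surjective.comp hl
  · rw [LinearMap.range_eq_top]
    exact e2.surjective.comp (Submodule.projectionOnto_surjective hQ)
  · rw [LinearMap.ker_comp_of_ker_eq_bot _ e.ker, LinearMap.ker_comp_of_ker_eq_bot _ e2.ker,
      Submodule.ker_projectionOnto]
    exact hQ

/-- Differentiating `l ∘ s = id` shows that `l` is onto, so it can be completed to linear
coordinates in which the section is a graph, hence an analytic submanifold inside `V`. -/
theorem sectionDimLE_of_hasAnalyticDim {V : Set (EuclideanSpace ℝ (Fin N))}
    (hV : HasAnalyticDim V m) : SectionDimLE V m := by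
  intro A _ _ _ l s O hO hne hs hls
  have hl : Function.Surjective l := by
    obtain ⟨a, ha⟩ := hne
    intro v
    refine ⟨fderiv ℝ s a v, ?_⟩
    have h1 := (l.hasFDerivAt.comp a (hs a ha).differentiableAt.hasFDerivAt)
    have h2 : HasFDerivAt (l ∘ s) (ContinuousLinearMap.id ℝ A) a := by
      refine (hasFDerivAt_id a).congr_of_eventuallyEq ?_
      filter_upwards [hO.mem_nhds ha] with b hb using (hls b hb).1
    exact congrFun (congrArg DFunLike.coe (h1.unique h2)) v
  obtain ⟨hle, e, Λ, hΛ⟩ := exists_prod_equiv_of_surjective l hl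
  have hgs : ∀ a ∈ O, Λ.symm (e a, (Λ (s a)).2) = s a := by
    intro a ha
    have : (e a, (Λ (s a)).2) = Λ (s a) := by
      ext1
      · rw [hΛ, (hls a ha).1]
      · rfl
    rw [this, Λ.symm_apply_apply]
  have hM := isSubmanifold_graph hle Λ.symm (g := fun b => (Λ (s (e.symm b))).2)
    (O := e.symm ⁻¹' O) (hO.preimage e.symm.continuous) (fun b hb =>
      (((ContinuousLinearMap.snd ℝ _ _).comp (Λ : EuclideanSpace ℝ (Fin N) →L[ℝ]
        (Fin (Module.finrank ℝ A) → ℝ) × (Fin (N - Module.finrank ℝ A) → ℝ))).analyticAt _).fun_comp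
        ((hs _ hb).fun_comp ((e.symm : (Fin (Module.finrank ℝ A) → ℝ) →L[ℝ] A).analyticAt b)))
  refine hV.2 ⟨_, hM, ?_, ?_⟩
  · obtain ⟨a, ha⟩ := hne
    exact ⟨_, mem_image_of_mem _ (show e a ∈ e.symm ⁻¹' O by simpa using ha)⟩
  · rintro _ ⟨b, hb, rfl⟩
    have := hgs (e.symm b) hb
    rw [e.apply_symm_apply] at this
    change Λ.symm (b, (Λ (s (e.symm b))).2) ∈ V
    rw [this]
    exact (hls _ hb).2

theorem SectionDimLE.preimage {E E' : Type} [NormedAddCommGroup E] [NormedSpace ℝ E]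
    [NormedAddCommGroup E'] [NormedSpace ℝ E'] {V : Set E} {d : ℕ} (hV : SectionDimLE V d)
    (L : E' ≃L[ℝ] E) : SectionDimLE (L ⁻¹' V) d := by
  intro A _ _ _ l s O hO hne hs hls
  refine hV A (l.comp (L.symm : E →L[ℝ] E')) (fun a => L (s a)) O hO hne
    (fun a ha => ((L : E' →L[ℝ] E).analyticAt _).fun_comp (hs a ha)) fun a ha => ⟨?_, (hls a ha).2⟩
  simpa using (hls a ha).1

end Straightening

/-! ### Transition maps and uniqueness of analytic germs containing `Y`. -/

section Transition

variable {E X F : Type} [NormedAddCommGroup E] [NormedSpace ℝ E] [NormedAddCommGroup X]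
  [NormedSpace ℝ X] [NormedAddCommGroup F] [NormedSpace ℝ F]

theorem IsStraightening.exists_hasStrictFDerivAt {n : WithTop ℕ∞} (hn : n ≠ 0)
    {θ : OpenPartialHomeomorph E (X × F)} {K : Set X} {Y : Set E} (hθ : IsStraightening n θ K Y)
    {p : E} (hp : p ∈ θ.source) : ∃ D : E ≃L[ℝ] X × F,
      HasStrictFDerivAt θ (D : E →L[ℝ] X × F) p ∧
      HasStrictFDerivAt θ.symm (D.symm : X × F →L[ℝ] E) (θ p) := by
  have h1 := (hθ.contDiffOn.contDiffAt (θ.open_source.mem_nhds hp)).hasStrictFDerivAt hn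
  have h2 := (hθ.contDiffOn_symm.contDiffAt
    (θ.open_target.mem_nhds (θ.map_source hp))).hasStrictFDerivAt hn
  have h3 : (fderiv ℝ θ.symm (θ p)).comp (fderiv ℝ θ p) = ContinuousLinearMap.id ℝ E := by
    refine (h2.hasFDerivAt.comp p h1.hasFDerivAt).unique ?_
    refine (hasFDerivAt_id p).congr_of_eventuallyEq ?_
    filter_upwards [θ.open_source.mem_nhds hp] with x hx using θ.left_inv hx
  have h4 : (fderiv ℝ θ p).comp (fderiv ℝ θ.symm (θ p)) = ContinuousLinearMap.id ℝ (X × F) := by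
    have h5 : HasFDerivAt θ (fderiv ℝ θ p) (θ.symm (θ p)) := by
      rw [θ.left_inv hp]; exact h1.hasFDerivAt
    refine (h5.comp (θ p) h2.hasFDerivAt).unique ?_
    refine (hasFDerivAt_id (θ p)).congr_of_eventuallyEq ?_
    filter_upwards [θ.open_target.mem_nhds (θ.map_source hp)] with x hx using θ.right_inv hx
  refine ⟨ContinuousLinearEquiv.equivOfInverse (fderiv ℝ θ p) (fderiv ℝ θ.symm (θ p))
    (fun v => congrFun (congrArg DFunLike.coe h3) v)
    (fun v => congrFun (congrArg DFunLike.coe h4) v), h1, h2⟩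

/-- The transition map between two straightenings of sets of the same dimension is open where it
takes values in the plane `X × {0}`. -/
theorem map_transition_nhds [FiniteDimensional ℝ X] {n n' : WithTop ℕ∞} (hn : n ≠ 0) (hn' : n' ≠ 0)
    {θ θ' : OpenPartialHomeomorph E (X × F)} {K K' : Set X} {Y Y' : Set E}
    (hθ : IsStraightening n θ K Y) (hθ' : IsStraightening n' θ' K' Y') {a : X}
    (ha : (a, 0) ∈ θ.target) (ha' : θ.symm (a, 0) ∈ θ'.source)
    (h0 : ∀ᶠ b in 𝓝 a, (θ' (θ.symm (b, 0))).2 = 0) :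
    map (fun b => (θ' (θ.symm (b, 0))).1) (𝓝 a) = 𝓝 (θ' (θ.symm (a, 0))).1 := by
  obtain ⟨D, -, hD⟩ := hθ.exists_hasStrictFDerivAt hn (θ.map_target ha)
  obtain ⟨D', hD', -⟩ := hθ'.exists_hasStrictFDerivAt hn' ha'
  rw [θ.right_inv ha] at hD
  have h1 : HasStrictFDerivAt (fun b : X => (b, (0 : F))) (ContinuousLinearMap.inl ℝ X F) a :=
    (ContinuousLinearMap.inl ℝ X F).hasStrictFDerivAt
  have h2 : HasStrictFDerivAt (fun b => θ' (θ.symm (b, 0))) _ a := hD'.comp a (hD.comp a h1)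
  set M := (D' : E →L[ℝ] X × F).comp ((D.symm : X × F →L[ℝ] E).comp
    (ContinuousLinearMap.inl ℝ X F)) with hM
  have h3 : (ContinuousLinearMap.snd ℝ X F).comp M = 0 := by
    refine (((ContinuousLinearMap.snd ℝ X F).hasFDerivAt).comp a h2.hasFDerivAt).unique ?_
    exact (hasFDerivAt_const (0 : F) a).congr_of_eventuallyEq h0
  -- The full derivative is injective and its `F`-component vanishes because the map stays in `X ×
  -- {0}`; hence the `X`-component is injective, and the inverse function theorem applies.
  have hinj : Function.Injective ((ContinuousLinearMap.fst ℝ X F).comp M) := by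
    rw [injective_iff_map_eq_zero]
    intro v hv
    have h4 : M v = 0 := Prod.ext hv (congrFun (congrArg DFunLike.coe h3) v)
    have h5 : D' (D.symm (v, 0)) = 0 := h4
    have h6 : ((v, 0) : X × F) = 0 := by simpa using h5
    exact congrArg Prod.fst h6
  let e : X ≃L[ℝ] X := (LinearEquiv.ofInjectiveEndo
    (((ContinuousLinearMap.fst ℝ X F).comp M : X →L[ℝ] X) : X →ₗ[ℝ] X)
      hinj).toContinuousLinearEquiv
  have h7 : HasStrictFDerivAt (fun b => (θ' (θ.symm (b, 0))).1) (e : X →L[ℝ] X) a :=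
    ((ContinuousLinearMap.fst ℝ X F).hasStrictFDerivAt).comp a h2
  exact h7.map_nhds_eq_of_equiv

theorem IsStraightening.mem_of_symm {n : WithTop ℕ∞} {θ : OpenPartialHomeomorph E (X × F)}
    {K : Set X} {Y : Set E} (hθ : IsStraightening n θ K Y) {a : X} (ha : (a, 0) ∈ θ.target)
    (haK : a ∈ K) : θ.symm (a, 0) ∈ Y := by
  rw [hθ.mem_iff _ (θ.map_target ha), θ.right_inv ha]
  exact ⟨haK, rfl⟩

/-- If two analytic submanifolds contain the same smooth submanifold with boundary of the same
dimension, the first one is contained in the second one near each point of the latter. -/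
theorem exists_open_inter_subset [FiniteDimensional ℝ X] {n : WithTop ℕ∞} (hn : n ≠ 0)
    {θ θ₁ θ₂ : OpenPartialHomeomorph E (X × F)} {K : Set X} {Y Z₁ Z₂ : Set E}
    (hθ : IsStraightening n θ K Y) (hK : Convex ℝ K) (hKne : (interior K).Nonempty)
    (hθ₁ : IsStraightening ω θ₁ univ Z₁) (hθ₂ : IsStraightening ω θ₂ univ Z₂) {y : E}
    (hyθ : y ∈ θ.source) (hyθ₁ : y ∈ θ₁.source) (hyθ₂ : y ∈ θ₂.source) (hy : y ∈ Y)
    {O : Set E} (hO : IsOpen O) (hyO : y ∈ O) (h₁ : Y ∩ O ⊆ Z₁) (h₂ : Y ∩ O ⊆ Z₂) :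
    ∃ O', IsOpen O' ∧ y ∈ O' ∧ Z₁ ∩ O' ⊆ Z₂ := by
  obtain ⟨ha₀K, ha₀⟩ := (hθ.mem_iff y hyθ).1 hy
  have ha₁ := ((hθ₁.mem_iff y hyθ₁).1 (h₁ ⟨hy, hyO⟩)).2
  set a₀ := (θ y).1 with ha₀'
  set a₁ := (θ₁ y).1 with ha₁'
  have hy0 : θ y = (a₀, 0) := Prod.ext rfl ha₀
  have hy1 : θ₁ y = (a₁, 0) := Prod.ext rfl ha₁
  have hi : ∀ a : X, Continuous fun a : X => (a, (0 : F)) := fun a => by fun_prop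
  -- a ball on which the second submanifold can be tested
  have hev₁ : ∀ᶠ c in 𝓝 a₁, (c, (0 : F)) ∈ θ₁.target ∧ θ₁.symm (c, 0) ∈ θ₂.source := by
    have t1 : Tendsto (fun c : X => (c, (0 : F))) (𝓝 a₁) (𝓝 (θ₁ y)) := hy1 ▸ (hi a₁).tendsto a₁
    refine (t1.eventually (θ₁.open_target.mem_nhds (θ₁.map_source hyθ₁))).and ?_
    exact (θ₁.tendsto_symm hyθ₁).comp t1 (θ₂.open_source.mem_nhds hyθ₂)
  obtain ⟨r, hr, hball⟩ := Metric.eventually_nhds_iff_ball.1 hev₁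
  -- `H` measures how far the first submanifold is from the second. It is analytic on a ball and
  -- vanishes where the chart of `Y` covers an open set of parameters, so it vanishes on the ball.
  set H : X → F := fun c => (θ₂ (θ₁.symm (c, 0))).2 with hH
  have hHA : AnalyticOnNhd ℝ H (Metric.ball a₁ r) := by
    intro c hc
    have t1 := (hθ₁.contDiffOn_symm.contDiffAt (θ₁.open_target.mem_nhds (hball c hc).1)).analyticAt
    have t2 := (hθ₂.contDiffOn.contDiffAt (θ₂.open_source.mem_nhds (hball c hc).2)).analyticAt
    have t3 : AnalyticAt ℝ (fun c : X => θ₁.symm (c, 0)) c :=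
      AnalyticAt.fun_comp (g := θ₁.symm) (f := fun c : X => (c, (0 : F))) t1
        ((ContinuousLinearMap.inl ℝ X F).analyticAt c)
    have t4 : AnalyticAt ℝ (fun c : X => θ₂ (θ₁.symm (c, 0))) c :=
      AnalyticAt.fun_comp (g := θ₂) (f := fun c : X => θ₁.symm (c, 0)) t2 t3
    exact ((ContinuousLinearMap.snd ℝ X F).analyticAt _).fun_comp t4
  -- points of `Y` near `y`
  have hev : ∀ᶠ a in 𝓝 a₀, (a, (0 : F)) ∈ θ.target ∧ θ.symm (a, 0) ∈ O ∧
      θ.symm (a, 0) ∈ θ₁.source ∧ (θ₁ (θ.symm (a, 0))).1 ∈ Metric.ball a₁ r := by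
    have t1 : Tendsto (fun c : X => (c, (0 : F))) (𝓝 a₀) (𝓝 (θ y)) := hy0 ▸ (hi a₀).tendsto a₀
    have t2 : Tendsto (fun c : X => θ.symm (c, (0 : F))) (𝓝 a₀) (𝓝 y) :=
      (θ.tendsto_symm hyθ).comp t1
    refine (t1.eventually (θ.open_target.mem_nhds (θ.map_source hyθ))).and
      ((t2.eventually (hO.mem_nhds hyO)).and ((t2.eventually (θ₁.open_source.mem_nhds hyθ₁)).and ?_))
    have t3 : Tendsto (fun c : X => (θ₁ (θ.symm (c, (0 : F)))).1) (𝓝 a₀) (𝓝 a₁) :=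
      (continuous_fst.tendsto _).comp ((θ₁.continuousAt hyθ₁).tendsto.comp t2)
    exact t3 (Metric.ball_mem_nhds _ hr)
  have hcl : a₀ ∈ closure (interior K) := by
    rw [hK.closure_interior_eq_closure_of_nonempty_interior hKne]
    exact subset_closure ha₀K
  obtain ⟨P, hP, hPo, ha₀P⟩ := eventually_nhds_iff.1 hev
  obtain ⟨a, haP, haK⟩ := mem_closure_iff.1 hcl P hPo ha₀P
  have hnear : ∀ᶠ b in 𝓝 a, b ∈ P ∧ b ∈ K := by
    filter_upwards [hPo.mem_nhds haP, isOpen_interior.mem_nhds haK] with b h1 h2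
    exact ⟨h1, interior_subset h2⟩
  have hYb : ∀ b, b ∈ P ∧ b ∈ K → θ.symm (b, 0) ∈ Y ∩ O := fun b hb =>
    ⟨hθ.mem_of_symm (hP b hb.1).1 hb.2, (hP b hb.1).2.1⟩
  have hZ₁b : ∀ b, b ∈ P ∧ b ∈ K → (θ₁ (θ.symm (b, 0))).2 = 0 := fun b hb =>
    ((hθ₁.mem_iff _ (hP b hb.1).2.2.1).1 (h₁ (hYb b hb))).2
  have hmap := map_transition_nhds (θ' := θ₁) hn (by simp) hθ hθ₁ (hP a haP).1 (hP a haP).2.2.1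
    (hnear.mono hZ₁b)
  have hzero : ∀ᶠ c in 𝓝 (θ₁ (θ.symm (a, 0))).1, H c = 0 := by
    rw [← hmap, eventually_map]
    filter_upwards [hnear] with b hb
    have e1 : ((θ₁ (θ.symm (b, 0))).1, (0 : F)) = θ₁ (θ.symm (b, 0)) :=
      Prod.ext rfl (hZ₁b b hb).symm
    have e2 : θ₁.symm ((θ₁ (θ.symm (b, 0))).1, (0 : F)) = θ.symm (b, 0) := by
      rw [e1, θ₁.left_inv (hP b hb.1).2.2.1]
    have h5 := (hball _ (hP b hb.1).2.2.2).2
    simp only [hH]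
    rw [e2] at h5 ⊢
    exact ((hθ₂.mem_iff _ h5).1 (h₂ (hYb b hb))).2
  have hHz := hHA.eqOn_zero_of_preconnected_of_eventuallyEq_zero (convex_ball a₁ r).isPreconnected
    (hP a haP).2.2.2 hzero
  have hfin : ∀ᶠ x in 𝓝 y, x ∈ θ₁.source ∧ (θ₁ x).1 ∈ Metric.ball a₁ r := by
    refine Eventually.and (θ₁.open_source.mem_nhds hyθ₁) ?_
    exact ((continuous_fst.tendsto _).comp (θ₁.continuousAt hyθ₁).tendsto) (Metric.ball_mem_nhds _ hr)
  obtain ⟨O', hO', hO'o, hyO'⟩ := eventually_nhds_iff.1 hfin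
  refine ⟨O', hO'o, hyO', fun x hx => ?_⟩
  obtain ⟨hxs, hxb⟩ := hO' x hx.2
  have hx2 := ((hθ₁.mem_iff x hxs).1 hx.1).2
  have e1 : ((θ₁ x).1, (0 : F)) = θ₁ x := Prod.ext rfl hx2.symm
  have h6 := (hball _ hxb).2
  have h7 : H (θ₁ x).1 = 0 := hHz hxb
  simp only [hH] at h7
  rw [e1, θ₁.left_inv hxs] at h6 h7
  exact (hθ₂.mem_iff x h6).2 ⟨mem_univ _, h7⟩

end Transition

/-! ### The local extension as an analytic graph. -/

section LocalExtension

/-- The image of a convex parameter set under a change of coordinates need not be convex. A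
truncated open cone at `q`, pointing towards an interior point of `K`, is convex and is still mapped
into the interior of `K`, since `τ` is tangent to the identity at `q`. -/
theorem exists_convex_subset_preimage_interior {X : Type*} [NormedAddCommGroup X] [NormedSpace ℝ X]
    {τ : X → X} {q : X} (hτ : HasFDerivAt τ (ContinuousLinearMap.id ℝ X) q) {K : Set X}
    (hK : Convex ℝ K) (hKne : (interior K).Nonempty) (hq : τ q ∈ K) {B : Set X} (hB : B ∈ 𝓝 q) :
    ∃ Ω, IsOpen Ω ∧ Convex ℝ Ω ∧ Ω.Nonempty ∧ q ∈ closure Ω ∧ Ω ⊆ B ∧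
      ∀ x ∈ Ω, τ x ∈ interior K := by
  obtain ⟨k, hk⟩ := hKne
  set v := k - τ q with hv
  obtain ⟨ε', hε', hball⟩ := Metric.isOpen_iff.1 isOpen_interior k hk
  set ε := ε' / 2 with hε
  have hε0 : 0 < ε := by positivity
  set R := ‖v‖ + ε with hR
  have hR0 : 0 < R := by positivity
  have h1 : ∀ᶠ x in 𝓝 q, ‖τ x - τ q - (x - q)‖ ≤ ε / R * ‖x - q‖ := by
    have := hτ.isLittleO.def (c := ε / R) (by positivity)
    simpa using this
  obtain ⟨δ, hδ, hδB⟩ := Metric.mem_nhds_iff.1 (inter_mem hB h1)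
  set t₀ := min 1 (δ / R) with ht₀
  have ht₀0 : 0 < t₀ := lt_min one_pos (by positivity)
  set Ω : Set X := (fun p : ℝ × X => q + p.1 • p.2) '' (Ioo 0 t₀ ×ˢ Metric.ball v ε) with hΩ
  have hnorm : ∀ η ∈ Metric.ball v ε, ‖η‖ < R := by
    intro η hη
    rw [mem_ball_iff_norm] at hη
    have := norm_add_le (η - v) v
    rw [sub_add_cancel] at this
    linarith
  have hmem : ∀ x ∈ Ω, x ∈ Metric.ball q δ := by
    rintro _ ⟨⟨t, η⟩, ⟨ht, hη⟩, rfl⟩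
    have ht' : t ∈ Ioo 0 t₀ := ht
    rw [mem_ball_iff_norm, add_sub_cancel_left, norm_smul, Real.norm_eq_abs, abs_of_pos ht'.1]
    calc t * ‖η‖ < t * R := by gcongr; exacts [ht'.1, hnorm η hη]
      _ ≤ δ / R * R := by gcongr; exact ht'.2.le.trans (min_le_right _ _)
      _ = δ := by field_simp
  refine ⟨Ω, ?_, ?_, ?_, ?_, fun x hx => (hδB (hmem x hx)).1, ?_⟩
  · rw [isOpen_iff_mem_nhds]
    rintro _ ⟨⟨t, η⟩, ⟨ht, hη⟩, rfl⟩
    have ht' : t ∈ Ioo 0 t₀ := ht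
    have h2 : Continuous fun x => t⁻¹ • (x - q) := by fun_prop
    have h3 : (fun x => t⁻¹ • (x - q)) (q + t • η) ∈ Metric.ball v ε := by
      simpa [smul_smul, inv_mul_cancel₀ ht'.1.ne'] using hη
    filter_upwards [h2.continuousAt.preimage_mem_nhds (Metric.isOpen_ball.mem_nhds h3)] with x hx
    refine ⟨(t, t⁻¹ • (x - q)), ⟨ht, hx⟩, ?_⟩
    simp [smul_smul, mul_inv_cancel₀ ht'.1.ne']
  · rintro _ ⟨⟨t, η⟩, ⟨ht, hη⟩, rfl⟩ _ ⟨⟨s, κ⟩, ⟨hs, hκ⟩, rfl⟩ a b ha hb hab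
    have ht' : t ∈ Ioo 0 t₀ := ht
    have hs' : s ∈ Ioo 0 t₀ := hs
    have h2 := (convex_Ioo (0 : ℝ) t₀) ht hs ha hb hab
    simp only [smul_eq_mul] at h2
    have h3 : 0 < a * t + b * s := h2.1
    have hat : 0 ≤ a * t := mul_nonneg ha ht'.1.le
    have hbs : 0 ≤ b * s := mul_nonneg hb hs'.1.le
    refine ⟨(a * t + b * s, (a * t / (a * t + b * s)) • η + (b * s / (a * t + b * s)) • κ),
      ⟨h2, ?_⟩, ?_⟩
    · exact (convex_ball v ε) hη hκ (by positivity) (by positivity) (by field_simp)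
    · simp only [smul_add, smul_smul, mul_div_cancel₀ _ h3.ne']
      rw [add_add_add_comm, ← add_smul, hab, one_smul]
  · exact ⟨_, mem_image_of_mem _ (⟨⟨half_pos ht₀0, half_lt_self ht₀0⟩, Metric.mem_ball_self hε0⟩ :
      ((t₀ / 2, v) : ℝ × X) ∈ Ioo 0 t₀ ×ˢ Metric.ball v ε)⟩
  · have h2 : Tendsto (fun t : ℝ => q + t • v) (𝓝[>] 0) (𝓝 q) := by
      have : Continuous fun t : ℝ => q + t • v := by fun_prop
      simpa using (this.tendsto 0).mono_left (nhdsWithin_le_nhds (s := Ioi 0))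
    refine mem_closure_of_tendsto h2 ?_
    filter_upwards [Ioo_mem_nhdsGT ht₀0] with t ht
    exact ⟨(t, v), ⟨ht, Metric.mem_ball_self hε0⟩, rfl⟩
  · intro x hx
    have h2 := (hδB (hmem x hx)).2
    obtain ⟨⟨t, η⟩, ⟨ht, hη⟩, rfl⟩ := hx
    have ht' : t ∈ Ioo 0 t₀ := ht
    have hη' : ‖η‖ < R := hnorm η hη
    simp only [mem_ofPred, add_sub_cancel_left] at h2
    set e := τ (q + t • η) - τ q - t • η with he
    have h3 : ‖t⁻¹ • e‖ ≤ ε := by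
      rw [norm_smul, norm_inv, Real.norm_eq_abs, abs_of_pos ht'.1, inv_mul_le_iff₀ ht'.1]
      refine h2.trans ?_
      rw [norm_smul, Real.norm_eq_abs, abs_of_pos ht'.1]
      calc ε / R * (t * ‖η‖) ≤ ε / R * (t * R) := by gcongr; exact ht'.1.le
        _ = t * ε := by field_simp
    have h4 : τ q + (η + t⁻¹ • e) ∈ interior K := by
      refine hball ?_
      rw [mem_ball_iff_norm] at hη ⊢
      have : τ q + (η + t⁻¹ • e) - k = (η - v) + t⁻¹ • e := by rw [hv]; abel
      rw [this]
      refine (norm_add_le _ _).trans_lt ?_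
      linarith
    have h5 := hK.combo_self_interior_mem_interior hq h4 (a := 1 - t) (b := t)
      (by linarith [ht'.2.le.trans (min_le_left _ _)]) ht'.1 (by ring)
    convert h5 using 1
    rw [smul_add, smul_add, smul_smul, mul_inv_cancel₀ ht'.1.ne', one_smul, he, sub_smul, one_smul]
    abel

/-- The source is shrunk until the derivative of `σ` is invertible at each of its points, so the
inverse is smooth on the whole image and not only at the image of `a`. -/
theorem exists_local_diffeo {X : Type*} [NormedAddCommGroup X] [NormedSpace ℝ X] [CompleteSpace X]
    {σ : X → X} {a : X} {B : Set X} (hB : IsOpen B) (ha : a ∈ B)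
    (hσ : ∀ b ∈ B, ContDiffAt ℝ ∞ σ b) (hd : HasFDerivAt σ (ContinuousLinearMap.id ℝ X) a) :
    ∃ S : OpenPartialHomeomorph X X, (∀ b, S b = σ b) ∧ a ∈ S.source ∧ S.source ⊆ B ∧
      (∀ b ∈ S.source, ContDiffAt ℝ ∞ S.symm (σ b)) ∧
      HasFDerivAt S.symm (ContinuousLinearMap.id ℝ X) (σ a) := by
  have hn : (∞ : WithTop ℕ∞) ≠ 0 := by simp
  have hd' : HasFDerivAt σ ((ContinuousLinearEquiv.refl ℝ X : X ≃L[ℝ] X) : X →L[ℝ] X) a := hd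
  set S₀ := (hσ a ha).toOpenPartialHomeomorph σ hd' hn with hS₀
  have h1 : ∀ᶠ b in 𝓝 a, b ∈ B ∧
      fderiv ℝ σ b ∈ range ((↑) : (X ≃L[ℝ] X) → X →L[ℝ] X) := by
    have hc : ContinuousAt (fderiv ℝ σ) a :=
      ((hσ a ha).fderiv_right (m := ∞) (by simp)).continuousAt
    refine Eventually.and (hB.mem_nhds ha) (hc.eventually ?_)
    rw [hd'.fderiv]
    exact ContinuousLinearEquiv.nhds _
  obtain ⟨P, hP, hPo, haP⟩ := eventually_nhds_iff.1 h1
  have hS : ∀ b, (S₀.restrOpen P hPo) b = σ b := fun b => rfl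
  have haS : a ∈ (S₀.restrOpen P hPo).source :=
    ⟨(hσ a ha).mem_toOpenPartialHomeomorph_source hd' hn, haP⟩
  refine ⟨S₀.restrOpen P hPo, hS, haS, fun b hb => (hP b hb.2).1, fun b hb => ?_, ?_⟩
  · obtain ⟨e, he⟩ := (hP b hb.2).2
    have h2 : (S₀.restrOpen P hPo).symm (σ b) = b := (S₀.restrOpen P hPo).left_inv hb
    have h3 := hσ b (hP b hb.2).1
    refine (S₀.restrOpen P hPo).contDiffAt_symm (f₀' := e)
      ((S₀.restrOpen P hPo).map_source hb) ?_ (by rw [h2]; exact h3)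
    rw [h2, he]
    exact (h3.differentiableAt hn).hasFDerivAt
  · have h2 : (S₀.restrOpen P hPo).symm (σ a) = a := (S₀.restrOpen P hPo).left_inv haS
    have h3 := (S₀.restrOpen P hPo).hasFDerivAt_symm (f' := ContinuousLinearEquiv.refl ℝ X)
      ((S₀.restrOpen P hPo).map_source haS)
      (by rw [(S₀.restrOpen P hPo).left_inv haS]; exact hd')
    exact h3

variable {E X F : Type} [NormedAddCommGroup E] [NormedSpace ℝ E]
  [NormedAddCommGroup X] [NormedSpace ℝ X] [FiniteDimensional ℝ X]
  [NormedAddCommGroup F] [NormedSpace ℝ F] [FiniteDimensional ℝ F]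

/-- A smooth submanifold with boundary contained in an analytic set of the same dimension is, near
each of its points, contained in an analytic graph. -/
theorem IsStraightening.exists_analytic_graph {θ : OpenPartialHomeomorph E (X × F)} {K : Set X}
    {V W Y : Set E} {𝓕 : Set (E → ℝ)} (hθ : IsStraightening ∞ θ K Y) (hK : Convex ℝ K)
    (hKne : (interior K).Nonempty) (hE : IsEquationSet V W 𝓕)
    (hdim : SectionDimLE V (Module.finrank ℝ X)) (hYV : Y ⊆ V) {p : E} (hpθ : p ∈ θ.source)
    (hpY : p ∈ Y) (hpW : p ∈ W) :
    ∃ (L : (X × F) ≃L[ℝ] E) (g : X → F) (O : Set X) (U : Set E), IsOpen O ∧ AnalyticOnNhd ℝ g O ∧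
      IsOpen U ∧ p ∈ U ∧ (∀ x ∈ U, (L.symm x).1 ∈ O) ∧
      ∀ x ∈ Y ∩ U, (L.symm x).2 = g (L.symm x).1 := by
  obtain ⟨haK, ha0⟩ := (hθ.mem_iff p hpθ).1 hpY
  set a := (θ p).1 with ha
  have hθp : θ p = (a, 0) := Prod.ext rfl ha0
  -- The derivative of the chart serves as a linear coordinate system. Unlike the smooth chart it
  -- keeps `V` analytic, and in it the projection `σ` of `Y` to `X` is tangent to the identity.
  obtain ⟨D, -, hD⟩ := hθ.exists_hasStrictFDerivAt (by simp) hpθ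
  rw [hθp] at hD
  have hat : (a, (0 : F)) ∈ θ.target := hθp ▸ θ.map_source hpθ
  have hpa : θ.symm (a, 0) = p := by rw [← hθp, θ.left_inv hpθ]
  set ψ : X → E := fun b => θ.symm (b, 0) with hψ
  have hi : Continuous fun b : X => (b, (0 : F)) := by fun_prop
  set B : Set X := (fun b : X => (b, (0 : F))) ⁻¹' θ.target ∩ ψ ⁻¹' W with hB
  have hBo : IsOpen B := by
    have h1 : ContinuousOn ψ ((fun b : X => (b, (0 : F))) ⁻¹' θ.target) :=
      θ.continuousOn_symm.comp hi.continuousOn fun b hb => hb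
    exact h1.isOpen_inter_preimage (θ.open_target.preimage hi) hE.isOpen
  have haB : a ∈ B := ⟨hat, by rw [mem_preimage, hψ]; simpa only [hpa] using hpW⟩
  have hψs : ∀ b ∈ B, ContDiffAt ℝ ∞ ψ b := fun b hb =>
    (hθ.contDiffOn_symm.contDiffAt (θ.open_target.mem_nhds hb.1)).comp b
      (contDiff_id.prodMk contDiff_const).contDiffAt
  set σ : X → X := fun b => (D (ψ b)).1 with hσ
  have hDψ : ∀ b ∈ B, ContDiffAt ℝ ∞ (fun b => D (ψ b)) b := fun b hb =>
    D.contDiff.contDiffAt.comp b (hψs b hb)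
  have hσs : ∀ b ∈ B, ContDiffAt ℝ ∞ σ b := fun b hb => (hDψ b hb).fst
  have hσd : HasFDerivAt σ (ContinuousLinearMap.id ℝ X) a := by
    have h1 : HasFDerivAt (fun b : X => (b, (0 : F))) (ContinuousLinearMap.inl ℝ X F) a :=
      (ContinuousLinearMap.inl ℝ X F).hasFDerivAt
    have h2 : HasFDerivAt ψ _ a := hD.hasFDerivAt.comp a h1
    have h3 : HasFDerivAt (fun b => D (ψ b)) _ a := D.hasFDerivAt.comp a h2
    have h4 : HasFDerivAt σ _ a := (ContinuousLinearMap.fst ℝ X F).hasFDerivAt.comp a h3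
    convert h4 using 1
    ext v
    simp
  obtain ⟨S, hSσ, haS, hSB, hSs, hSd⟩ := exists_local_diffeo hBo haB hσs hσd
  have hSσ' : ∀ b ∈ S.source, S.symm (σ b) = b := fun b hb => by rw [← hSσ, S.left_inv hb]
  set f : X → F := fun x => (D (ψ (S.symm x))).2 with hf
  have hfσ : ∀ b ∈ S.source, (σ b, f (σ b)) = D (ψ b) := fun b hb => by
    simp only [hf, hσ]
    rw [show S.symm (D (ψ b)).1 = b from hSσ' b hb]
  have hfs : ∀ b ∈ S.source, ContDiffAt ℝ ∞ f (σ b) := by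
    intro b hb
    have h1 : ContDiffAt ℝ ∞ (fun b => (D (ψ b)).2) (S.symm (σ b)) := by
      rw [hSσ' b hb]; exact (hDψ b (hSB hb)).snd
    exact ContDiffAt.comp (g := fun b => (D (ψ b)).2) (σ b) h1 (hSs b hb)
  have hE' : IsEquationSet (D.symm ⁻¹' V) (D.symm ⁻¹' W) ((fun h x => h (D.symm x)) '' 𝓕) := by
    refine ⟨hE.isOpen.preimage D.symm.continuous, ?_, fun x hx => ?_⟩
    · rintro _ ⟨h, hh, rfl⟩ x hx
      exact (hE.analyticOnNhd h hh _ hx).fun_comp ((D.symm : X × F →L[ℝ] E).analyticAt x)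
    · rw [forall_mem_image]
      exact hE.mem_iff (D.symm x) hx
  have hdim' := hdim.preimage D.symm
  have hgW : ∀ b ∈ S.source, (σ b, f (σ b)) ∈ D.symm ⁻¹' W := fun b hb => by
    rw [hfσ b hb, mem_preimage, D.symm_apply_apply]; exact (hSB hb).2
  have hgV : ∀ b ∈ S.source, b ∈ K → (σ b, f (σ b)) ∈ D.symm ⁻¹' V := fun b hb hbK => by
    rw [hfσ b hb, mem_preimage, D.symm_apply_apply]
    exact hYV (hθ.mem_of_symm (hSB hb).1 hbK)
  set q := σ a with hq
  have hqS : q ∈ S.target := by rw [hq, ← hSσ]; exact S.map_source haS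
  -- the interior part
  have himg : ∀ G : Set X, IsOpen G → G ⊆ S.source → IsOpen (σ '' G) := by
    intro G hG hGs
    have := S.isOpen_image_of_subset_source hG hGs
    rwa [show (S : X → X) = σ from funext hSσ] at this
  have hfA : ∀ G : Set X, IsOpen G → G ⊆ S.source → G ⊆ interior K → AnalyticOnNhd ℝ f (σ '' G) := by
    intro G hG hGs hGK
    refine hE'.analyticOnNhd_of_contDiff hdim' (himg G hG hGs) ?_ ?_ ?_
    · rintro _ ⟨b, hb, rfl⟩; exact hfs b (hGs hb)
    · rintro _ ⟨b, hb, rfl⟩; exact hgW b (hGs hb)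
    · rintro _ ⟨b, hb, rfl⟩; exact hgV b (hGs hb) (interior_subset (hGK hb))
  obtain ⟨Ω, hΩo, hΩc, hΩne, hqΩ, hΩS, hΩK⟩ := exists_convex_subset_preimage_interior hSd hK hKne
    (by rw [hSσ' a haS]; exact haK) (S.open_target.mem_nhds hqS)
  have hΩσ : ∀ x ∈ Ω, S.symm x ∈ S.source ∧ σ (S.symm x) = x := fun x hx =>
    ⟨S.map_target (hΩS hx), by rw [← hSσ, S.right_inv (hΩS hx)]⟩
  obtain ⟨g, hgA, -, hgf⟩ := hE'.exists_analyticAt_extension hdim' hΩo hΩc hΩne hqΩ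
    (hfs a haS) (hgW a haS)
    (fun x hx => by have := hfs _ (hΩσ x hx).1; rwa [(hΩσ x hx).2] at this)
    (fun x hx => by have := hgW _ (hΩσ x hx).1; rwa [(hΩσ x hx).2] at this)
    (fun x hx => by
      have := hgV _ (hΩσ x hx).1 (interior_subset (hΩK x hx)); rwa [(hΩσ x hx).2] at this)
  obtain ⟨s, hs, hgs⟩ := Metric.eventually_nhds_iff_ball.1 hgA.eventually_analyticAt
  have hσc : ∀ b ∈ S.source, ContinuousAt σ b := fun b hb => (hσs b (hSB hb)).continuousAt
  have hev : ∀ᶠ b in 𝓝 a, b ∈ S.source ∧ σ b ∈ Metric.ball q s :=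
    Eventually.and (S.open_source.mem_nhds haS) ((hσc a haS).eventually (Metric.ball_mem_nhds _ hs))
  obtain ⟨r, hr, hball⟩ := Metric.eventually_nhds_iff_ball.1 hev
  set G := Metric.ball a r ∩ interior K with hG
  have hGo : IsOpen G := Metric.isOpen_ball.inter isOpen_interior
  have hGS : G ⊆ S.source := fun b hb => (hball b hb.1).1
  have hGpre : IsPreconnected (σ '' G) :=
    ((convex_ball a r).inter hK.interior).isPreconnected.image σ fun b hb =>
      (hσc b (hGS hb)).continuousWithinAt
  -- Agreement is known only on the cone `Ω` near `q`. It spreads over the connected image of the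
  -- interior parameters by the identity theorem, and then to boundary parameters by continuity.
  have heqG : EqOn f g (σ '' G) := by
    have h1 : ∀ᶠ x in 𝓝 q, (x ∈ Ω → f x = g x) ∧ S.symm x ∈ Metric.ball a r := by
      refine hgf.and ?_
      have h2 : Tendsto S.symm (𝓝 q) (𝓝 a) := by
        have := hSd.continuousAt.tendsto
        rwa [hSσ' a haS] at this
      exact h2.eventually (Metric.ball_mem_nhds a hr)
    obtain ⟨P, hP, hPo, hqP⟩ := eventually_nhds_iff.1 h1
    obtain ⟨x, hxP, hxΩ⟩ := mem_closure_iff.1 hqΩ P hPo hqP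
    have hxG : x ∈ σ '' G := ⟨S.symm x, ⟨(hP x hxP).2, hΩK x hxΩ⟩, (hΩσ x hxΩ).2⟩
    refine (hfA G hGo hGS inter_subset_right).eqOn_of_preconnected_of_eventuallyEq ?_ hGpre hxG ?_
    · rintro _ ⟨b, hb, rfl⟩
      exact hgs _ (hball b hb.1).2
    · filter_upwards [hPo.mem_nhds hxP, hΩo.mem_nhds hxΩ] with z h2 h3
      exact (hP z h2).1 h3
  have heqK : ∀ b ∈ Metric.ball a r, b ∈ K → f (σ b) = g (σ b) := by
    intro b hb hbK
    have hbcl : b ∈ closure G := by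
      have h1 : b ∈ closure (interior K) := by
        rw [hK.closure_interior_eq_closure_of_nonempty_interior hKne]; exact subset_closure hbK
      exact Metric.isOpen_ball.inter_closure ⟨hb, h1⟩
    have h2 : ContinuousAt (fun b => f (σ b)) b :=
      ContinuousAt.comp (g := f) (hfs b (hball b hb).1).continuousAt (hσc b (hball b hb).1)
    have h3 : ContinuousAt (fun b => g (σ b)) b :=
      ContinuousAt.comp (g := g) (hgs _ (hball b hb).2).continuousAt (hσc b (hball b hb).1)
    refine tendsto_nhds_unique_of_frequently_eq h2 h3 ?_
    exact (mem_closure_iff_frequently.1 hbcl).mono fun c hc => heqG (mem_image_of_mem σ hc)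
  have hev2 : ∀ᶠ x in 𝓝 p, x ∈ θ.source ∧ (θ x).1 ∈ Metric.ball a r ∧
      (D x).1 ∈ Metric.ball q s := by
    refine Eventually.and (θ.open_source.mem_nhds hpθ) (Eventually.and ?_ ?_)
    · exact ((continuous_fst.tendsto _).comp (θ.continuousAt hpθ).tendsto).eventually
        (Metric.ball_mem_nhds _ hr)
    · have h1 : Continuous fun x => (D x).1 := by fun_prop
      have h2 : (D p).1 = q := by simp only [hq, hσ, hψ, hpa]
      exact (h1.tendsto p).eventually (h2 ▸ Metric.ball_mem_nhds _ hs)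
  obtain ⟨U, hU, hUo, hpU⟩ := eventually_nhds_iff.1 hev2
  refine ⟨D.symm, g, Metric.ball q s, U, Metric.isOpen_ball, hgs, hUo, hpU,
    fun x hx => (hU x hx).2.2, fun x hx => ?_⟩
  obtain ⟨hxs, hxb, hxq⟩ := hU x hx.2
  obtain ⟨hxK, hx0⟩ := (hθ.mem_iff x hxs).1 hx.1
  have h1 : ψ (θ x).1 = x := by
    have : ((θ x).1, (0 : F)) = θ x := Prod.ext rfl hx0.symm
    simp only [hψ, this, θ.left_inv hxs]
  have h2 := hfσ _ (hball _ hxb).1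
  rw [h1] at h2
  have h3 := heqK _ hxb hxK
  change (D x).2 = g (D x).1
  rw [← h2]
  exact h3

end LocalExtension

/-! ### Gluing local extensions, and the boundary. -/

section Global

variable {N m : ℕ}

/-- The cover is shrunk to a locally finite family of closed sets `A i`. The glued set consists of
the points at which all `Z i` with `x ∈ A i` have the same germ and contain `x`. Local finiteness
and closedness give finitely many conditions near each point, so the set locally coincides with one
`Z i`. -/
theorem exists_submanifold_of_locally (h : m ≤ N) {Y : Set (EuclideanSpace ℝ (Fin N))}
    (hloc : ∀ p ∈ Y, ∃ Z U : Set (EuclideanSpace ℝ (Fin N)), IsSubmanifold ω m Z ∧ IsOpen U ∧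
      p ∈ U ∧ Y ∩ U ⊆ Z)
    (hgerm : ∀ y ∈ Y, ∀ Z₁ Z₂ O : Set (EuclideanSpace ℝ (Fin N)), IsSubmanifold ω m Z₁ →
      IsSubmanifold ω m Z₂ → IsOpen O → y ∈ O → Y ∩ O ⊆ Z₁ → Y ∩ O ⊆ Z₂ →
      ∃ O', IsOpen O' ∧ y ∈ O' ∧ Z₁ ∩ O' = Z₂ ∩ O') :
    ∃ Z : Set (EuclideanSpace ℝ (Fin N)), IsSubmanifold ω m Z ∧ Y ⊆ Z := by
  choose! Z U hZ hU hpU hYU using hloc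
  set T : Set (EuclideanSpace ℝ (Fin N)) := ⋃ p : Y, U p with hT
  have hTo : IsOpen T := isOpen_iUnion fun p => hU p p.2
  obtain ⟨v, hvo, hvc, hvlf, hvu⟩ := precise_refinement (X := T)
    (fun p : Y => Subtype.val ⁻¹' U p) (fun p => (hU p p.2).preimage continuous_subtype_val) (by
      refine eq_univ_of_forall fun x => ?_
      obtain ⟨p, hp⟩ := mem_iUnion.1 x.2
      exact mem_iUnion.2 ⟨p, hp⟩)
  obtain ⟨A, hAc, hAcl, hAv⟩ := exists_iUnion_eq_closed_subset hvo hvlf.point_finite hvc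
  have hAlf : LocallyFinite A := hvlf.subset hAv
  have hcov : ∀ x : T, ∃ i, x ∈ A i := fun x => mem_iUnion.1 (hAc ▸ mem_univ x)
  set G : T → Prop := fun x => ∀ i j, x ∈ A i → x ∈ A j →
    ∃ O, IsOpen O ∧ (x : EuclideanSpace ℝ (Fin N)) ∈ O ∧ Z i ∩ O = Z j ∩ O with hG
  refine ⟨{x | ∃ hx : x ∈ T, G ⟨x, hx⟩ ∧ ∀ i : Y, (⟨x, hx⟩ : T) ∈ A i → x ∈ Z i}, ?_, ?_⟩
  · refine IsSubmanifold.of_locally h ?_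
    rintro x ⟨hx, hGx, hZx⟩
    obtain ⟨i₀, hi₀⟩ := hcov ⟨x, hx⟩
    have hex : ∀ j : Y, ∃ O, IsOpen O ∧ x ∈ O ∧ ((⟨x, hx⟩ : T) ∈ A j → Z i₀ ∩ O = Z j ∩ O) := by
      intro j
      by_cases hj : (⟨x, hx⟩ : T) ∈ A j
      · obtain ⟨O, hO, hxO, heq⟩ := hGx i₀ j hi₀ hj
        exact ⟨O, hO, hxO, fun _ => heq⟩
      · exact ⟨univ, isOpen_univ, mem_univ _, fun h => absurd h hj⟩
    choose O hOo hxO hOeq using hex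
    have hfin : {j | (⟨x, hx⟩ : T) ∈ A j}.Finite := hAlf.point_finite _
    -- Near `x` no new index `j` appears, since the `A j` not containing `x` form a locally finite
    -- closed family.
    have hev : ∀ᶠ y in 𝓝 (⟨x, hx⟩ : T), (∀ j, y ∈ A j → (⟨x, hx⟩ : T) ∈ A j) ∧
        ∀ j ∈ {j | (⟨x, hx⟩ : T) ∈ A j}, (y : EuclideanSpace ℝ (Fin N)) ∈ O j := by
      refine Eventually.and ?_ ((eventually_all_finite hfin).2 fun j _ => ?_)
      · filter_upwards [hAlf.iInter_compl_mem_nhds hAcl ⟨x, hx⟩] with y hy j hyj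
        by_contra hxj
        exact (mem_iInter₂.1 hy j hxj) hyj
      · exact continuous_subtype_val.continuousAt.eventually ((hOo j).mem_nhds (hxO j))
    obtain ⟨P, hP, hPo, hxP⟩ := eventually_nhds_iff.1 hev
    have hZeq : ∀ y ∈ P, ∀ j, y ∈ A j →
        ((y : EuclideanSpace ℝ (Fin N)) ∈ Z i₀ ↔ (y : EuclideanSpace ℝ (Fin N)) ∈ Z j) := by
      intro y hy j hj
      have h1 := (hP y hy).1 j hj
      have h2 := (hP y hy).2 j h1
      have h3 := Set.ext_iff.1 (hOeq j h1) y
      exact ⟨fun h => (h3.1 ⟨h, h2⟩).1, fun h => (h3.2 ⟨h, h2⟩).1⟩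
    refine ⟨Z i₀, Subtype.val '' P, hZ i₀ i₀.2, hTo.isOpenMap_subtype_val P hPo,
      ⟨⟨x, hx⟩, hxP, rfl⟩, ?_⟩
    ext y
    refine and_congr_left ?_
    rintro ⟨⟨y, hyT⟩, hyP, rfl⟩
    constructor
    · rintro ⟨hy, -, hyZ⟩
      obtain ⟨j, hj⟩ := hcov ⟨y, hy⟩
      exact (hZeq ⟨y, hy⟩ hyP j hj).2 (hyZ j hj)
    · intro hyZ
      refine ⟨hyT, fun i j hi hj => ?_, fun j hj => (hZeq ⟨y, hyT⟩ hyP j hj).1 hyZ⟩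
      have hi' := (hP _ hyP).1 i hi
      have hj' := (hP _ hyP).1 j hj
      refine ⟨O i ∩ O j, (hOo i).inter (hOo j), ⟨(hP _ hyP).2 i hi', (hP _ hyP).2 j hj'⟩, ?_⟩
      rw [← inter_assoc, ← hOeq i hi', inter_right_comm, inter_comm (O i), ← inter_assoc,
        ← hOeq j hj']
  · intro y hy
    have hyT : y ∈ T := mem_iUnion.2 ⟨⟨y, hy⟩, hpU y hy⟩
    have hyU : ∀ i : Y, (⟨y, hyT⟩ : T) ∈ A i → y ∈ U i := fun i hi => hvu i (hAv i hi)
    refine ⟨hyT, fun i j hi hj => ?_, fun i hi => hYU i i.2 ⟨hy, hyU i hi⟩⟩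
    exact hgerm y hy (Z i) (Z j) (U i ∩ U j) (hZ i i.2) (hZ j j.2) ((hU i i.2).inter (hU j j.2))
      ⟨hyU i hi, hyU j hj⟩ (fun z hz => hYU i i.2 ⟨hz.1, hz.2.1⟩)
      (fun z hz => hYU j j.2 ⟨hz.1, hz.2.2⟩)

theorem convex_lastNonneg (m : ℕ) : Convex ℝ (lastNonneg m) := by
  intro a ha b hb s t hs ht _ i hi
  exact add_nonneg (mul_nonneg hs (ha i hi)) (mul_nonneg ht (hb i hi))

theorem interior_lastNonneg_nonempty (m : ℕ) : (interior (lastNonneg m)).Nonempty := by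
  refine ⟨fun _ => 1, mem_interior.2 ⟨⋂ i : Fin m, {a | 0 < a i}, ?_, ?_, ?_⟩⟩
  · intro a ha i _
    exact (mem_iInter.1 ha i).le
  · exact isOpen_iInter_of_finite fun i => isOpen_lt continuous_const (continuous_apply i)
  · exact mem_iInter.2 fun _ => (one_pos : (0 : ℝ) < 1)

variable {Y B : Set (EuclideanSpace ℝ (Fin N))}

theorem IsSubmanifoldWithBoundary.exists_boundary_straightening {n : WithTop ℕ∞}
    (hY : IsSubmanifoldWithBoundary n m Y B) {p : EuclideanSpace ℝ (Fin N)} (hp : p ∈ B) :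
    ∃ (i : Fin m) (θ : OpenPartialHomeomorph (EuclideanSpace ℝ (Fin N))
        ((Fin m → ℝ) × (Fin (N - m) → ℝ))),
      (i : ℕ) + 1 = m ∧ p ∈ θ.source ∧ IsStraightening n θ (lastNonneg m) Y ∧
      (∀ x ∈ θ.source, x ∈ B → (θ x).1 i = 0) := by
  have h := hY.interior.dim_le
  obtain ⟨hm, φ, hpφ, hφ, hφY, hφB⟩ := hY.exists_boundary_chart p hp
  refine ⟨⟨m - 1, by omega⟩, _, by simp only; omega, hpφ,
    isStraightening_of_image_eq h hφ hφY (mem_halfModel_iff h), fun x hx hxB => ?_⟩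
  have h1 := isStraightening_of_image_eq h hφ hφB
    (K := {a | ∀ i : Fin m, (i : ℕ) + 1 = m → a i = 0}) (mem_halfModelBoundary_iff h)
  exact ((h1.mem_iff x hx).1 hxB).1 _ (by simp only; omega)

/-- In a boundary chart, push the point in the direction of the positive last coordinate. -/
theorem IsSubmanifoldWithBoundary.subset_closure_diff {n : WithTop ℕ∞}
    (hY : IsSubmanifoldWithBoundary n m Y B) : Y ⊆ closure (Y \ B) := by
  intro p hpY
  by_cases hpB : p ∈ B
  swap
  · exact subset_closure ⟨hpY, hpB⟩
  obtain ⟨i, θ, hi, hpθ, hθ, hθB⟩ := hY.exists_boundary_straightening hpB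
  obtain ⟨haK, ha0⟩ := (hθ.mem_iff p hpθ).1 hpY
  set a := (θ p).1
  have hθp : θ p = (a, 0) := Prod.ext rfl ha0
  have h1 : Tendsto (fun t : ℝ => (a + t • Pi.single i 1, (0 : Fin (N - m) → ℝ))) (𝓝[>] 0)
      (𝓝 (θ p)) := by
    have : Continuous fun t : ℝ =>
        (a + t • (Pi.single i 1 : Fin m → ℝ), (0 : Fin (N - m) → ℝ)) := by fun_prop
    have := (this.tendsto 0).mono_left (nhdsWithin_le_nhds (s := Ioi 0))
    rwa [zero_smul, add_zero, ← hθp] at this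
  refine mem_closure_of_tendsto ((θ.tendsto_symm hpθ).comp h1) ?_
  filter_upwards [h1.eventually (θ.open_target.mem_nhds (θ.map_source hpθ)), self_mem_nhdsWithin]
    with t ht ht0
  have ht0' : 0 < t := ht0
  have hK : a + t • Pi.single i 1 ∈ lastNonneg m := by
    intro j hj
    have : j = i := Fin.ext (by omega)
    subst this
    have h3 := haK j hj
    simp only [Pi.add_apply, Pi.smul_apply, Pi.single_eq_same, smul_eq_mul, mul_one]
    linarith
  refine ⟨hθ.mem_of_symm ht hK, fun hB => ?_⟩
  have h4 := hθB _ (θ.map_target ht) hB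
  rw [θ.right_inv ht] at h4
  have h5 := haK i hi
  simp only [Pi.add_apply, Pi.smul_apply, Pi.single_eq_same, smul_eq_mul, mul_one] at h4
  linarith

/-- Treats both kinds of points at once. At an interior point the chart describes only `Y \ B`, so a
dense subset `Y'` of `Y` is straightened instead of `Y`. -/
theorem IsSubmanifoldWithBoundary.exists_straightening {n : WithTop ℕ∞}
    (hY : IsSubmanifoldWithBoundary n m Y B) {p : EuclideanSpace ℝ (Fin N)} (hp : p ∈ Y) :
    ∃ (Y' : Set (EuclideanSpace ℝ (Fin N))) (K : Set (Fin m → ℝ))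
      (θ : OpenPartialHomeomorph (EuclideanSpace ℝ (Fin N)) ((Fin m → ℝ) × (Fin (N - m) → ℝ))),
      Y' ⊆ Y ∧ Y ⊆ closure Y' ∧ IsStraightening n θ K Y' ∧ Convex ℝ K ∧ (_root_.interior K).Nonempty ∧
      p ∈ θ.source ∧ p ∈ Y' := by
  by_cases hpB : p ∈ B
  · obtain ⟨i, θ, -, hpθ, hθ, -⟩ := hY.exists_boundary_straightening hpB
    exact ⟨Y, _, θ, subset_rfl, subset_closure, hθ, convex_lastNonneg m,
      interior_lastNonneg_nonempty m, hpθ, hp⟩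
  · obtain ⟨θ, hpθ, hθ⟩ := hY.interior.exists_isStraightening ⟨hp, hpB⟩
    exact ⟨Y \ B, univ, θ, sdiff_subset, hY.subset_closure_diff, hθ, convex_univ, by simp, hpθ,
      hp, hpB⟩

theorem IsSubmanifoldWithBoundary.exists_inter_eq {n : WithTop ℕ∞} (hn : n ≠ 0)
    (hY : IsSubmanifoldWithBoundary n m Y B) {y : EuclideanSpace ℝ (Fin N)} (hy : y ∈ Y)
    {Z₁ Z₂ O : Set (EuclideanSpace ℝ (Fin N))} (hZ₁ : IsSubmanifold ω m Z₁)
    (hZ₂ : IsSubmanifold ω m Z₂) (hO : IsOpen O) (hyO : y ∈ O) (h₁ : Y ∩ O ⊆ Z₁)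
    (h₂ : Y ∩ O ⊆ Z₂) : ∃ O', IsOpen O' ∧ y ∈ O' ∧ Z₁ ∩ O' = Z₂ ∩ O' := by
  obtain ⟨Y', K, θ, hY', -, hθ, hK, hKne, hyθ, hyY'⟩ := hY.exists_straightening hy
  obtain ⟨θ₁, hyθ₁, hθ₁⟩ := hZ₁.exists_isStraightening (h₁ ⟨hy, hyO⟩)
  obtain ⟨θ₂, hyθ₂, hθ₂⟩ := hZ₂.exists_isStraightening (h₂ ⟨hy, hyO⟩)
  have h₁' : Y' ∩ O ⊆ Z₁ := (inter_subset_inter_left O hY').trans h₁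
  have h₂' : Y' ∩ O ⊆ Z₂ := (inter_subset_inter_left O hY').trans h₂
  obtain ⟨O₁, hO₁, hyO₁, hs₁⟩ := exists_open_inter_subset hn hθ hK hKne hθ₁ hθ₂ hyθ hyθ₁ hyθ₂ hyY'
    hO hyO h₁' h₂'
  obtain ⟨O₂, hO₂, hyO₂, hs₂⟩ := exists_open_inter_subset hn hθ hK hKne hθ₂ hθ₁ hyθ hyθ₂ hyθ₁ hyY'
    hO hyO h₂' h₁'
  refine ⟨O₁ ∩ O₂, hO₁.inter hO₂, ⟨hyO₁, hyO₂⟩, Subset.antisymm ?_ ?_⟩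
  · exact fun x hx => ⟨hs₁ ⟨hx.1, hx.2.1⟩, hx.2⟩
  · exact fun x hx => ⟨hs₂ ⟨hx.1, hx.2.2⟩, hx.2⟩

/-- Otherwise `Z` is contained in `Y` near the boundary point. The transition map from a chart of
`Z` to the boundary chart is open, so the half space would be a neighbourhood of one of its boundary
points. -/
theorem IsSubmanifoldWithBoundary.boundary_subset_closure {n n' : WithTop ℕ∞} (hn : n ≠ 0)
    (hn' : n' ≠ 0) (hY : IsSubmanifoldWithBoundary n m Y B) {Z : Set (EuclideanSpace ℝ (Fin N))}
    (hZ : IsSubmanifold n' m Z) (hYZ : Y ⊆ Z) : B ⊆ closure (Z \ Y) := by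
  intro p hp
  by_contra hcon
  have hpY := hY.boundary_subset hp
  obtain ⟨i, θ, hi, hpθ, hθ, hθB⟩ := hY.exists_boundary_straightening hp
  obtain ⟨θ₁, hpθ₁, hθ₁⟩ := hZ.exists_isStraightening (hYZ hpY)
  have hO : ∀ᶠ x in 𝓝 p, x ∈ Z → x ∈ Y := by
    filter_upwards [isClosed_closure.isOpen_compl.mem_nhds hcon] with x hx hxZ
    by_contra hxY
    exact hx (subset_closure ⟨hxZ, hxY⟩)
  set a₁ := (θ₁ p).1 with ha₁
  have hθ₁p : θ₁ p = (a₁, 0) := Prod.ext rfl ((hθ₁.mem_iff p hpθ₁).1 (hYZ hpY)).2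
  have hsymm : θ₁.symm (a₁, 0) = p := by rw [← hθ₁p, θ₁.left_inv hpθ₁]
  have t1 : Tendsto (fun c : Fin m → ℝ => (c, (0 : Fin (N - m) → ℝ))) (𝓝 a₁) (𝓝 (θ₁ p)) := by
    have : Continuous fun c : Fin m → ℝ => (c, (0 : Fin (N - m) → ℝ)) := by fun_prop
    exact hθ₁p ▸ this.tendsto a₁
  have t2 : Tendsto (fun c : Fin m → ℝ => θ₁.symm (c, (0 : Fin (N - m) → ℝ))) (𝓝 a₁) (𝓝 p) :=
    (θ₁.tendsto_symm hpθ₁).comp t1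
  have hev : ∀ᶠ c in 𝓝 a₁, (θ (θ₁.symm (c, 0))).1 ∈ lastNonneg m ∧ (θ (θ₁.symm (c, 0))).2 = 0 := by
    filter_upwards [t1.eventually (θ₁.open_target.mem_nhds (θ₁.map_source hpθ₁)), t2.eventually hO,
      t2.eventually (θ.open_source.mem_nhds hpθ)] with c h1 h2 h3
    exact (hθ.mem_iff _ h3).1 (h2 (hθ₁.mem_of_symm h1 (mem_univ c)))
  have hmap := map_transition_nhds hn' hn hθ₁ hθ (hθ₁p ▸ θ₁.map_source hpθ₁)
    (by rw [hsymm]; exact hpθ) (hev.mono fun c hc => hc.2)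
  rw [hsymm] at hmap
  have hmem : lastNonneg m ∈ 𝓝 (θ p).1 := by
    rw [← hmap]
    exact hev.mono fun c hc => hc.1
  have h1 : Tendsto (fun t : ℝ => (θ p).1 + t • (Pi.single i 1 : Fin m → ℝ)) (𝓝[<] 0)
      (𝓝 (θ p).1) := by
    have : Continuous fun t : ℝ => (θ p).1 + t • (Pi.single i 1 : Fin m → ℝ) := by fun_prop
    have := (this.tendsto 0).mono_left (nhdsWithin_le_nhds (s := Iio 0))
    rwa [zero_smul, add_zero] at this
  obtain ⟨t, ht, ht0⟩ := ((h1.eventually hmem).and self_mem_nhdsWithin).exists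
  have ht0' : t < 0 := ht0
  have h2 := ht i hi
  simp only [Pi.add_apply, hθB p hpθ hp, Pi.smul_apply, Pi.single_eq_same, smul_eq_mul, mul_one,
    zero_add] at h2
  linarith

theorem IsAnalyticSubvariety.exists_isEquationSet {U V : Set (EuclideanSpace ℝ (Fin N))}
    (hV : IsAnalyticSubvariety U V) {p : EuclideanSpace ℝ (Fin N)} (hp : p ∈ V) :
    ∃ (W : Set (EuclideanSpace ℝ (Fin N))) (𝓕 : Set (EuclideanSpace ℝ (Fin N) → ℝ)),
      p ∈ W ∧ IsEquationSet V W 𝓕 := by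
  obtain ⟨W, hW, hpW, -, 𝓕, h𝓕, hVW⟩ := hV.locally_zeros p hp
  refine ⟨W, 𝓕, hpW, hW, h𝓕, fun x hx => ?_⟩
  have := Set.ext_iff.1 hVW x
  exact ⟨fun h => (this.1 ⟨h, hx⟩).2, fun h => (this.2 ⟨hx, h⟩).1⟩

theorem IsSubmanifoldWithBoundary.exists_local_extension {V : Set (EuclideanSpace ℝ (Fin N))}
    (hY : IsSubmanifoldWithBoundary ∞ m Y B) (hV : IsLocalAnalyticSubvariety V)
    (hdim : HasAnalyticDim V m) (hYV : Y ⊆ V) {p : EuclideanSpace ℝ (Fin N)} (hp : p ∈ Y) :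
    ∃ Z U : Set (EuclideanSpace ℝ (Fin N)), IsSubmanifold ω m Z ∧ IsOpen U ∧ p ∈ U ∧
      Y ∩ U ⊆ Z := by
  obtain ⟨U₀, hU₀⟩ := hV
  obtain ⟨W, 𝓕, hpW, hE⟩ := hU₀.exists_isEquationSet (hYV hp)
  obtain ⟨Y', K, θ, hY', hYcl, hθ, hK, hKne, hpθ, hpY'⟩ := hY.exists_straightening hp
  obtain ⟨L, g, O, U, hO, hg, hU, hpU, hUO, hgraph⟩ := hθ.exists_analytic_graph hK hKne hE
    (by rw [Module.finrank_fin_fun]; exact sectionDimLE_of_hasAnalyticDim hdim) (hY'.trans hYV)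
    hpθ hpY' hpW
  refine ⟨_, U, isSubmanifold_graph hY.interior.dim_le L hO hg, hU, hpU, fun x hx => ?_⟩
  have hxO := hUO x hx.2
  refine ⟨(L.symm x).1, hxO, ?_⟩
  -- The graph equation is known on `Y'` and passes to `Y` by density and continuity.
  have h1 : (L.symm x).2 = g (L.symm x).1 := by
    have hxcl : x ∈ closure (U ∩ Y') := hU.inter_closure ⟨hx.2, hYcl hx.1⟩
    have c1 : ContinuousAt (fun x => (L.symm x).2) x :=
      (continuous_snd.comp L.symm.continuous).continuousAt
    have c2 : ContinuousAt (fun x => g (L.symm x).1) x :=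
      ContinuousAt.comp (g := g) (hg _ hxO).continuousAt
        (continuous_fst.comp L.symm.continuous).continuousAt
    exact tendsto_nhds_unique_of_frequently_eq c1 c2
      ((mem_closure_iff_frequently.1 hxcl).mono fun z hz => hgraph z ⟨hz.2, hz.1⟩)
  change L ((L.symm x).1, g (L.symm x).1) = x
  rw [← h1, Prod.mk.eta, L.apply_symm_apply]

end Global

theorem mainTheorem5 (N m : ℕ) (Y B V : Set (EuclideanSpace ℝ (Fin N)))
    (hY : IsSubmanifoldWithBoundary ∞ m Y B)
    (hV : IsLocalAnalyticSubvariety V)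
    (hdim : HasAnalyticDim V m)
    (hYV : Y ⊆ V) :
    (∃ Z : Set (EuclideanSpace ℝ (Fin N)),
      IsSubmanifold ω m Z ∧ Y ⊆ Z ∧ B ⊆ closure (Z \ Y)) ∧
    (∀ Z₁ Z₂ : Set (EuclideanSpace ℝ (Fin N)),
      IsSubmanifold ω m Z₁ → Y ⊆ Z₁ → IsSubmanifold ω m Z₂ → Y ⊆ Z₂ →
      ∃ W : Set (EuclideanSpace ℝ (Fin N)), IsOpen W ∧ Y ⊆ W ∧ Z₁ ∩ W = Z₂ ∩ W) := by
  have hn : (∞ : WithTop ℕ∞) ≠ 0 := by simp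
  have hω : (ω : WithTop ℕ∞) ≠ 0 := by simp
  constructor
  · obtain ⟨Z, hZ, hYZ⟩ := exists_submanifold_of_locally hY.interior.dim_le
      (fun p hp => hY.exists_local_extension hV hdim hYV hp)
      (fun y hy Z₁ Z₂ O h1 h2 hO hyO h3 h4 => hY.exists_inter_eq hn hy h1 h2 hO hyO h3 h4)
    exact ⟨Z, hZ, hYZ, hY.boundary_subset_closure hn hω hZ hYZ⟩
  · intro Z₁ Z₂ hZ₁ hYZ₁ hZ₂ hYZ₂
    have hloc : ∀ y ∈ Y, ∃ O, IsOpen O ∧ y ∈ O ∧ Z₁ ∩ O = Z₂ ∩ O := fun y hy =>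
      hY.exists_inter_eq hn hy hZ₁ hZ₂ isOpen_univ (mem_univ y)
        (inter_subset_left.trans hYZ₁) (inter_subset_left.trans hYZ₂)
    choose! O hO hyO hOeq using hloc
    refine ⟨⋃ y ∈ Y, O y, isOpen_biUnion hO, fun y hy => mem_biUnion hy (hyO y hy), ?_⟩
    rw [inter_iUnion₂, inter_iUnion₂]
    exact iUnion₂_congr hOeq
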